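/- **Setting.** Let $n\ge 2$, let $U\subset\mathbb R^n$ be a bounded open set (for instance a bounded domain with $C^1$ boundary), let $N\ge 1$ and let $0=\alpha_0<\alpha_1<\dots<\alpha_N$ be real numbers. Put $a=\frac{\alpha_N}{\alpha_N+1}\in(0,1)$ and $\kappa_0=\frac{2+a}{2(2-a)}$. Let $\phi:U\to(0,1]$ be measurable, and let $a_0,\dots,a_N:U\to[0,\infty)$ be measurable with $a_0,a_N>0$. Define $$g(x,s)=\sum_{i=0}^N a_i(x)s^{\alpha_i},\qquad K(x,\xi)=\frac1{g(x,s(x,\xi))},\qquad W_1(x)=\frac{a_N(x)^a}{2N\max_j a_j(x)},$$ where $s=s(x,\xi)$ is the unique non-negative solution of $s\,g(x,s)=\xi$. Write $\|u\|_{L^2_\phi}^2=\int_U\phi|u|^2dx$, and call $\mathcal E(q)=\int_U K(x,|q|)|q|^2dx$ the energy of a vector field $q$ on $U$. Gradients are weak gradients on $U$, and a time derivative $u_t(t)\in L^2_\phi$ is the limit in $L^2_\phi$ of the difference quotients of $u$ at $t$. A function $u(x,t)$ is called *regular* if at each $t>0$ the derivatives $\nabla u$, $u_t$, $\nabla u_t$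 exist, $\mathcal E(\nabla u(t))<\infty$, and $$\mathcal E\Big(\frac{\nabla u(s)-\nabla u(t)}{s-t}-\nabla u_t(t)\Big)\to0\quad\text{as } s\to t.$$ A function $v$ on $U$ *vanishes on* $\partial U$ if there are $\eta_k\in C_c^\infty(U)$ with $\|\eta_k-v\|_{L^2_\phi}\to0$ and $\mathcal E(\nabla\eta_k-\nabla v)\to0$. For $i=1,2$ let $\Psi_i(x,t)$ be regular (an extension to $U$ of the boundary data), and let $p_i$ be a solution of $$\phi\,\partial_t p_i=\nabla\cdot\big(K(x,|\nabla p_i|)\nabla p_i\big)\ \text{on }U\times(0,\infty),\qquad p_i=\Psi_i\ \text{on }\partial U\times(0,\infty),\qquad p_i(\cdot,0)=p_{i,0}\ \text{on } U,$$ in the following sense, with $\bar p_i=p_i-\Psi_i$: $p_i$ is regular; $\bar p_i(t)\in L^2_\phi$ for all $t\ge0$, with $\bar p_i(t)\to\bar p_i(0)$ in $L^2_\phi$ as $t\to0^+$; for each $t>0$, $\bar p_i(t)$ vanishes on $\partial U$ and $\int_U\phi\, p_{i,t}\,\eta\,dx=-\int_U K(x,|\nabla p_i|)\nabla p_i\cdot\nabla\eta\,dx$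 for all $\eta\in C_c^\infty(U)$ with $\mathcal E(\nabla\eta)<\infty$; and $p_i(\cdot,0)=p_{i,0}$ a.e. on $U$. Put $\bar P=\bar p_1-\bar p_2$ and $\Phi=\Psi_1-\Psi_2$. Let $c_P>0$ be such that the two-weight Poincaré–Sobolev inequality $$\Big(\int_U|u|^2\phi\,dx\Big)^{1/2}\le c_P\Big(\int_U W_1|\nabla u|^{2-a}dx\Big)^{\frac1{2-a}}$$ holds for $u=\bar p_1(t),\ \bar p_2(t),\ \bar P(t)$ and all $t>0$. With $B_*=\max\{\int_U a_N\,dx,\,1\}$ define, with values in $[0,\infty]$, $$G[\Psi](t)=B_*+\int_U a_0^{-1}|\nabla\Psi|^2dx+\int_U W_1|\nabla\Psi|^{2-a}dx+\Big(\int_U|\Psi_t|^2\phi\,dx\Big)^{\frac{2-a}{2(1-a)}},\qquad G_1[\Psi](t)=\int_U a_0^{-1}|\nabla\Psi_t|^2dx,$$ $$D(t)=\int_U a_0^{-1}|\nabla\Phi|^2dx+\Big(\int_U a_0^{-1}|\nabla\Phi|^2dx\Big)^{1/2}+\Big(\int_U|\Phi_t|^2\phi\,dx\Big)^{1/2},$$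 $$\tilde{\mathcal A}=\sum_{i=1}^2\limsup_{t\to\infty}G[\Psi_i](t),\qquad \mathcal G_1=\sum_{i=1}^2\limsup_{t\to\infty}G_1[\Psi_i](t),\qquad \mathcal D=\limsup_{t\to\infty}D(t).$$ **Theorem.** There is a constant $C>0$ depending only on $n$, $U$, $N$, the exponents $\alpha_0,\dots,\alpha_N$ and $c_P$ (and not on $\phi$, the coefficients $a_i$, the functions $\Psi_i$, the solutions $p_i$ or the initial data $p_{i,0}$) such that, whenever $\tilde{\mathcal A}<\infty$ and $\mathcal G_1<\infty$, $$\limsup_{t\to\infty}\|\bar P(t)\|_{L^2_\phi}^2\le C\big(\tilde{\mathcal A}^{\frac{2}{2-a}}+\mathcal G_1\big)^{\kappa_0}\,\mathcal D.$$ -/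

import Mathlib

open MeasureTheory Filter Topology Set
open scoped ENNReal ContDiff

noncomputable section

namespace Forchheimer

/-- Euclidean space `ℝⁿ`. -/
abbrev Space (n : ℕ) : Type := EuclideanSpace ℝ (Fin n)

/-! ### The constitutive law -/

/-- `g(x,s) = a₀(x) s^{α₀} + ⋯ + a_N(x) s^{α_N}`. -/
def g {n N : ℕ} (α : Fin (N + 1) → ℝ) (a : Fin (N + 1) → Space n → ℝ)
    (x : Space n) (s : ℝ) : ℝ :=
  ∑ i, a i x * s ^ α i

/-- The non-negative solution `s = s(x,ξ)` of `s g(x,s) = ξ`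
(it exists and is unique, see `existsUnique_root`). -/
def root {n N : ℕ} (α : Fin (N + 1) → ℝ) (a : Fin (N + 1) → Space n → ℝ)
    (x : Space n) (ξ : ℝ) : ℝ :=
  Function.invFunOn (fun s : ℝ => s * g α a x s) (Ici 0) ξ

/-- `K(x,ξ) = 1 / g(x, s(x,ξ))`. -/
def K {n N : ℕ} (α : Fin (N + 1) → ℝ) (a : Fin (N + 1) → Space n → ℝ)
    (x : Space n) (ξ : ℝ) : ℝ :=
  1 / g α a x (root α a x ξ)

/-- The exponent `a = α_N / (α_N + 1)`. -/
def degExp {N : ℕ} (α : Fin (N + 1) → ℝ) : ℝ :=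
  α (Fin.last N) / (α (Fin.last N) + 1)

/-- `M(x) = max_j a_j(x)`. -/
def maxCoeff {n N : ℕ} (a : Fin (N + 1) → Space n → ℝ) (x : Space n) : ℝ :=
  Finset.univ.sup' Finset.univ_nonempty (fun j => a j x)

/-- The weight `W₁(x) = a_N(x)^a / (2 N M(x))`. -/
def W1 {n N : ℕ} (α : Fin (N + 1) → ℝ) (a : Fin (N + 1) → Space n → ℝ) (x : Space n) : ℝ :=
  a (Fin.last N) x ^ degExp α / (2 * N * maxCoeff a x)

/-- Standing assumptions on the exponents: `N ≥ 1` and `0 = α₀ < α₁ < ⋯ < α_N`. -/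
structure IsExponents {N : ℕ} (α : Fin (N + 1) → ℝ) : Prop where
  one_le : 1 ≤ N
  zero : α 0 = 0
  strictMono : StrictMono α

/-- Standing assumptions on the coefficients: measurable, non-negative, and `a₀, a_N > 0`. -/
structure IsCoeff {n N : ℕ} (U : Set (Space n)) (a : Fin (N + 1) → Space n → ℝ) : Prop where
  measurable : ∀ i, AEMeasurable (a i) (volume.restrict U)
  nonneg : ∀ i, ∀ x ∈ U, 0 ≤ a i x
  pos_zero : ∀ x ∈ U, 0 < a 0 x
  pos_last : ∀ x ∈ U, 0 < a (Fin.last N) x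

/-- Standing assumptions on the porosity: measurable with values in `(0,1]`. -/
structure IsPorosity {n : ℕ} (U : Set (Space n)) (φ : Space n → ℝ) : Prop where
  measurable : AEMeasurable φ (volume.restrict U)
  pos : ∀ x ∈ U, 0 < φ x
  le_one : ∀ x ∈ U, φ x ≤ 1

/-- The equation `s g(x,s) = ξ` has exactly one non-negative solution. -/
theorem existsUnique_root {n N : ℕ} {U : Set (Space n)} {α : Fin (N + 1) → ℝ}
    {a : Fin (N + 1) → Space n → ℝ} (hα : IsExponents α) (ha : IsCoeff U a)
    {x : Space n} (hx : x ∈ U) {ξ : ℝ} (hξ : 0 ≤ ξ) :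
    ∃! s : ℝ, 0 ≤ s ∧ s * g α a x s = ξ := by
  have hα0 : ∀ i, 0 ≤ α i := fun i => by
    have := hα.strictMono.monotone (Fin.zero_le i)
    rwa [hα.zero] at this
  have hmono : ∀ s t : ℝ, 0 ≤ s → s ≤ t → g α a x s ≤ g α a x t := fun s t hs hst =>
    Finset.sum_le_sum fun i _ =>
      mul_le_mul_of_nonneg_left (Real.rpow_le_rpow hs hst (hα0 i)) (ha.nonneg i x hx)
  have hlow : ∀ s : ℝ, 0 ≤ s → a 0 x ≤ g α a x s := fun s hs => by
    have h := Finset.single_le_sum (f := fun i => a i x * s ^ α i)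
      (fun i _ => mul_nonneg (ha.nonneg i x hx) (Real.rpow_nonneg hs _)) (Finset.mem_univ 0)
    simpa [hα.zero, g] using h
  have h0 := ha.pos_zero x hx
  have hstrict : ∀ s t : ℝ, 0 ≤ s → s < t → s * g α a x s < t * g α a x t :=
    fun s t hs hst =>
      calc s * g α a x s ≤ s * g α a x t := mul_le_mul_of_nonneg_left (hmono s t hs hst.le) hs
        _ < t * g α a x t :=
          mul_lt_mul_of_pos_right hst (h0.trans_le (hlow t (hs.trans hst.le)))
  have hcont : ContinuousOn (fun s : ℝ => s * g α a x s) (Icc 0 (ξ / a 0 x)) := by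
    refine continuousOn_id.mul (continuousOn_finsetSum _ fun i _ => continuousOn_const.mul ?_)
    exact (Real.continuous_rpow_const (hα0 i)).continuousOn
  have hb : 0 ≤ ξ / a 0 x := div_nonneg hξ h0.le
  have hmem : ξ ∈ Icc ((fun s : ℝ => s * g α a x s) 0)
      ((fun s : ℝ => s * g α a x s) (ξ / a 0 x)) := by
    refine ⟨by simpa using hξ, ?_⟩
    calc ξ = ξ / a 0 x * a 0 x := by field_simp
      _ ≤ _ := mul_le_mul_of_nonneg_left (hlow _ hb) hb
  obtain ⟨s, hs, hsξ⟩ := intermediate_value_Icc hb hcont hmem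
  refine ⟨s, ⟨hs.1, hsξ⟩, ?_⟩
  rintro t ⟨ht, htξ⟩
  have hsξ' : s * g α a x s = ξ := hsξ
  rcases lt_trichotomy t s with h | h | h
  · have := hstrict t s ht h
    linarith
  · exact h
  · have := hstrict s t hs.1 h
    linarith

/-- `root` is that solution. -/
theorem root_spec {n N : ℕ} {U : Set (Space n)} {α : Fin (N + 1) → ℝ}
    {a : Fin (N + 1) → Space n → ℝ} (hα : IsExponents α) (ha : IsCoeff U a)
    {x : Space n} (hx : x ∈ U) {ξ : ℝ} (hξ : 0 ≤ ξ) :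
    0 ≤ root α a x ξ ∧ root α a x ξ * g α a x (root α a x ξ) = ξ := by
  have h : ∃ s ∈ Ici (0 : ℝ), (fun s : ℝ => s * g α a x s) s = ξ := by
    obtain ⟨s, ⟨h1, h2⟩, -⟩ := existsUnique_root hα ha hx hξ
    exact ⟨s, h1, h2⟩
  exact ⟨Function.invFunOn_mem h, Function.invFunOn_eq h⟩

/-! ### Derivatives and function classes -/

/-- Test functions `η ∈ C_c^∞(U)`. -/
structure IsTest {n : ℕ} (U : Set (Space n)) (η : Space n → ℝ) : Prop where
  smooth : ContDiff ℝ ∞ η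
  compact : HasCompactSupport η
  support : tsupport η ⊆ U

/-- `q` is a weak gradient of `u` on `U`. -/
structure HasWeakGrad {n : ℕ} (U : Set (Space n)) (u : Space n → ℝ)
    (q : Space n → Space n) : Prop where
  locInt : LocallyIntegrableOn u U
  locInt_grad : LocallyIntegrableOn q U
  parts : ∀ η : Space n → ℝ, IsTest U η →
    ∫ x in U, u x • gradient η x = - ∫ x in U, η x • q x

open Classical in
/-- The weak gradient `∇u` on `U` (unique up to null sets; `0` if there is none). -/
def weakGrad {n : ℕ} (U : Set (Space n)) (u : Space n → ℝ) : Space n → Space n :=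
  if h : ∃ q, HasWeakGrad U u q then h.choose else 0

theorem hasWeakGrad_weakGrad {n : ℕ} {U : Set (Space n)} {u : Space n → ℝ}
    (h : ∃ q, HasWeakGrad U u q) : HasWeakGrad U u (weakGrad U u) := by
  rw [weakGrad, dif_pos h]
  exact h.choose_spec

/-- `‖u‖²_{L²_φ(U)} = ∫_U φ |u|² dx`. -/
def normSq {n : ℕ} (U : Set (Space n)) (φ u : Space n → ℝ) : ℝ≥0∞ :=
  ∫⁻ x in U, ENNReal.ofReal (φ x * u x ^ 2)

/-- `u ∈ L²_φ(U)`. -/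
def MemL2 {n : ℕ} (U : Set (Space n)) (φ u : Space n → ℝ) : Prop :=
  AEStronglyMeasurable u (volume.restrict U) ∧ normSq U φ u < ⊤

/-- `w ∈ L²_φ(U)` is the time derivative of `u` at time `t`: the difference quotients
of `u` at `t` converge to `w` in `L²_φ(U)`. -/
def HasTimeDeriv {n : ℕ} (U : Set (Space n)) (φ : Space n → ℝ) (u : ℝ → Space n → ℝ) (t : ℝ)
    (w : Space n → ℝ) : Prop :=
  MemL2 U φ w ∧
    Tendsto (fun s => normSq U φ (fun x => (u s x - u t x) / (s - t) - w x)) (𝓝[≠] t) (𝓝 0)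

open Classical in
/-- The time derivative `u_t(·,t)` (unique up to null sets; `0` if there is none). -/
def timeDeriv {n : ℕ} (U : Set (Space n)) (φ : Space n → ℝ) (u : ℝ → Space n → ℝ) (t : ℝ) :
    Space n → ℝ :=
  if h : ∃ w, HasTimeDeriv U φ u t w then h.choose else 0

theorem hasTimeDeriv_timeDeriv {n : ℕ} {U : Set (Space n)} {φ : Space n → ℝ}
    {u : ℝ → Space n → ℝ} {t : ℝ} (h : ∃ w, HasTimeDeriv U φ u t w) :
    HasTimeDeriv U φ u t (timeDeriv U φ u t) := by
  rw [timeDeriv, dif_pos h]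
  exact h.choose_spec

/-- The energy `∫_U K(x,|q|) |q|² dx` of a vector field `q`. -/
def energy {n N : ℕ} (U : Set (Space n)) (α : Fin (N + 1) → ℝ)
    (a : Fin (N + 1) → Space n → ℝ) (q : Space n → Space n) : ℝ≥0∞ :=
  ∫⁻ x in U, ENNReal.ofReal (K α a x ‖q x‖ * ‖q x‖ ^ 2)

/-- `v = 0` on `∂U`: `v` is the limit of functions in `C_c^∞(U)`, in `L²_φ(U)` and,
for the gradients, in energy. -/
def VanishesOnBoundary {n N : ℕ} (U : Set (Space n)) (φ : Space n → ℝ) (α : Fin (N + 1) → ℝ)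
    (a : Fin (N + 1) → Space n → ℝ) (v : Space n → ℝ) : Prop :=
  ∃ η : ℕ → Space n → ℝ, (∀ k, IsTest U (η k)) ∧
    Tendsto (fun k => normSq U φ (fun x => η k x - v x)) atTop (𝓝 0) ∧
    Tendsto (fun k => energy U α a (fun x => gradient (η k) x - weakGrad U v x)) atTop (𝓝 0)

/-- Regularity in space and time: at each time `t > 0`, `∇u` exists and has finite energy,
`u_t` exists, has a weak gradient, and `∇(u_t)` is the time derivative of `∇u`
with respect to convergence in energy. -/
structure IsRegular {n N : ℕ} (U : Set (Space n)) (φ : Space n → ℝ) (α : Fin (N + 1) → ℝ)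
    (a : Fin (N + 1) → Space n → ℝ) (u : ℝ → Space n → ℝ) : Prop where
  grad : ∀ t, 0 < t → ∃ q, HasWeakGrad U (u t) q
  energy_lt_top : ∀ t, 0 < t → energy U α a (weakGrad U (u t)) < ⊤
  deriv : ∀ t, 0 < t → ∃ w, HasTimeDeriv U φ u t w
  grad_deriv : ∀ t, 0 < t → ∃ q, HasWeakGrad U (timeDeriv U φ u t) q
  deriv_grad : ∀ t, 0 < t →
    Tendsto (fun s => energy U α a (fun x =>
        (s - t)⁻¹ • (weakGrad U (u s) x - weakGrad U (u t) x)
          - weakGrad U (timeDeriv U φ u t) x))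
      (𝓝[≠] t) (𝓝 0)

/-- `p` is a solution of `φ p_t = ∇ · (K(x,|∇p|) ∇p)` on `U × (0,∞)` with the boundary values
of `Ψ` on `∂U × (0,∞)` and with `p(·,0) = p₀`. The equation holds in the sense of distributions
on `U` at each time `t > 0`. -/
structure IsSolution {n N : ℕ} (U : Set (Space n)) (φ : Space n → ℝ) (α : Fin (N + 1) → ℝ)
    (a : Fin (N + 1) → Space n → ℝ) (Ψ : ℝ → Space n → ℝ) (p₀ : Space n → ℝ)
    (p : ℝ → Space n → ℝ) : Prop where
  regular : IsRegular U φ α a p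
  memL2 : ∀ t, 0 ≤ t → MemL2 U φ (p t - Ψ t)
  equation : ∀ t, 0 < t → ∀ η : Space n → ℝ, IsTest U η → energy U α a (gradient η) < ⊤ →
    ∫ x in U, φ x * timeDeriv U φ p t x * η x =
      - ∫ x in U, K α a x ‖weakGrad U (p t) x‖ * inner ℝ (weakGrad U (p t) x) (gradient η x)
  boundary : ∀ t, 0 < t → VanishesOnBoundary U φ α a (p t - Ψ t)
  initial : ∀ᵐ x ∂(volume.restrict U), p 0 x = p₀ x
  continuous_zero :
    Tendsto (fun t => normSq U φ ((p t - Ψ t) - (p 0 - Ψ 0))) (𝓝[>] 0) (𝓝 0)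

/-- The two-weight Poincaré–Sobolev inequality for `u` with constant `c`:
`(∫_U φ |u|²)^{1/2} ≤ c (∫_U W₁ |∇u|^{2-a})^{1/(2-a)}`. -/
def PoincareSobolev {n N : ℕ} (U : Set (Space n)) (φ : Space n → ℝ) (α : Fin (N + 1) → ℝ)
    (a : Fin (N + 1) → Space n → ℝ) (c : ℝ) (u : Space n → ℝ) : Prop :=
  normSq U φ u ^ (1 / 2 : ℝ) ≤
    ENNReal.ofReal c *
      (∫⁻ x in U, ENNReal.ofReal (W1 α a x * ‖weakGrad U u x‖ ^ (2 - degExp α)))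
        ^ (1 / (2 - degExp α))

/-! ### The quantities measuring the boundary data -/

/-- `∫_U a₀(x)⁻¹ |q(x)|² dx`. -/
def darcySq {n N : ℕ} (U : Set (Space n)) (a : Fin (N + 1) → Space n → ℝ)
    (q : Space n → Space n) : ℝ≥0∞ :=
  ∫⁻ x in U, ENNReal.ofReal ((a 0 x)⁻¹ * ‖q x‖ ^ 2)

/-- `B_* = max {∫_U a_N dx, 1}`. -/
def BStar {n N : ℕ} (U : Set (Space n)) (a : Fin (N + 1) → Space n → ℝ) : ℝ≥0∞ :=
  max (∫⁻ x in U, ENNReal.ofReal (a (Fin.last N) x)) 1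

/-- `G[Ψ](t)`. -/
def G {n N : ℕ} (U : Set (Space n)) (φ : Space n → ℝ) (α : Fin (N + 1) → ℝ)
    (a : Fin (N + 1) → Space n → ℝ) (Ψ : ℝ → Space n → ℝ) (t : ℝ) : ℝ≥0∞ :=
  BStar U a + darcySq U a (weakGrad U (Ψ t))
    + (∫⁻ x in U, ENNReal.ofReal (W1 α a x * ‖weakGrad U (Ψ t) x‖ ^ (2 - degExp α)))
    + normSq U φ (timeDeriv U φ Ψ t) ^ ((2 - degExp α) / (2 * (1 - degExp α)))

/-- `G₁[Ψ](t)`. -/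
def G1 {n N : ℕ} (U : Set (Space n)) (φ : Space n → ℝ)
    (a : Fin (N + 1) → Space n → ℝ) (Ψ : ℝ → Space n → ℝ) (t : ℝ) : ℝ≥0∞ :=
  darcySq U a (weakGrad U (timeDeriv U φ Ψ t))

/-- `D(t)`, for `Φ = Ψ₁ - Ψ₂`. -/
def D {n N : ℕ} (U : Set (Space n)) (φ : Space n → ℝ)
    (a : Fin (N + 1) → Space n → ℝ) (Φ : ℝ → Space n → ℝ) (t : ℝ) : ℝ≥0∞ :=
  darcySq U a (weakGrad U (Φ t)) + darcySq U a (weakGrad U (Φ t)) ^ (1 / 2 : ℝ)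
    + normSq U φ (timeDeriv U φ Φ t) ^ (1 / 2 : ℝ)

/-- `𝓐̃ = limsup G[Ψ₁](t) + limsup G[Ψ₂](t)`. -/
def calA {n N : ℕ} (U : Set (Space n)) (φ : Space n → ℝ) (α : Fin (N + 1) → ℝ)
    (a : Fin (N + 1) → Space n → ℝ) (Ψ₁ Ψ₂ : ℝ → Space n → ℝ) : ℝ≥0∞ :=
  limsup (G U φ α a Ψ₁) atTop + limsup (G U φ α a Ψ₂) atTop

/-- `𝓖₁ = limsup G₁[Ψ₁](t) + limsup G₁[Ψ₂](t)`. -/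
def calG1 {n N : ℕ} (U : Set (Space n)) (φ : Space n → ℝ)
    (a : Fin (N + 1) → Space n → ℝ) (Ψ₁ Ψ₂ : ℝ → Space n → ℝ) : ℝ≥0∞ :=
  limsup (G1 U φ a Ψ₁) atTop + limsup (G1 U φ a Ψ₂) atTop

/-- `𝓓 = limsup D(t)`. -/
def calD {n N : ℕ} (U : Set (Space n)) (φ : Space n → ℝ)
    (a : Fin (N + 1) → Space n → ℝ) (Ψ₁ Ψ₂ : ℝ → Space n → ℝ) : ℝ≥0∞ :=
  limsup (D U φ a (Ψ₁ - Ψ₂)) atTop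

/-- `κ₀ = (2 + a) / (2 (2 - a))`. -/
def kappa {N : ℕ} (α : Fin (N + 1) → ℝ) : ℝ :=
  (2 + degExp α) / (2 * (2 - degExp α))

end Forchheimer

end

/-! The squared norms and the energy satisfy dissipative differential inequalities, and each is
eventually trapped below the level at which dissipation beats the forcing. Write γ = 2 - a, and let
A and B bound G and G₁ for large times.

One solution. Testing the equation with p̄ gives (‖p̄‖²)' ≤ -E + A + 4rA, where E is the energy of
∇p and r is ‖p̄‖ in units of A^{1/γ}. The Poincaré–Sobolev inequality together with W₁ξ^γ ≤ 2Kξ² +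
a_N gives r^γ A ≤ c(E + A). As γ > 1, dissipation wins once r is large, so eventually ‖p̄‖² ≤ C
A^{2/γ}. The convex potential h with h' = Kξ is comparable to the energy density. Testing with p̄_t
bounds the growth of ∫h(|∇p|) by E/2 plus data. Adding ‖p̄‖², whose derivative contains -E, leaves
-E/2, and both quantities are eventually at most C X with X = A^{2/γ} + B (`exists_energy_bound`).

Two solutions. Testing both equations with P̄ and using strong monotonicity of the flux
(`flux_monotone`) gives (‖P̄‖²)' ≤ -2(1-a)J + 10θE + 4θ⁻¹d², where J =
∫K(max(|∇p₁|,|∇p₂|))|∇p₁-∇p₂|², E now bounds both energies and both ‖p̄ᵢ‖², and d bounds D. With θ =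
d/√X the forcing is of size √X d. Conversely `wip_difference_le` gives ‖P̄‖² ≤ C X^{a/γ}(J + d).
Hence ‖P̄‖² > C X^{κ₀} d forces decay, because κ₀ = a/γ + 1/2 (`exists_difference_bound`).

Little regularity in time is available, so no chain rule is used. Both functionals are convex, and
convexity bounds their upper left derivatives (`LeftSlopeLE`). With continuity this is enough for
the comparison principle `eventually_le_of_leftSlope`. Likewise the energy is not a norm, and
Young's inequality with a free parameter replaces Hölder's inequality throughout. -/

namespace Forchheimer

/-! ### Pointwise properties of the constitutive law -/

section Pointwise

variable {n N : ℕ} {U : Set (Space n)} {α : Fin (N + 1) → ℝ} {a : Fin (N + 1) → Space n → ℝ}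
  {x : Space n}

/-- The convex power lies above its tangent at s; this is Bernoulli's inequality for t / s - 1. At s
= 0 the exponent p = 1 is separate, because 0 ^ 0 = 1. -/
theorem rpow_sub_rpow_le_mul {p s t : ℝ} (hp : 1 ≤ p) (hs : 0 ≤ s) (ht : 0 ≤ t) :
    s ^ p - t ^ p ≤ p * s ^ (p - 1) * (s - t) := by
  rcases hs.eq_or_lt with rfl | hs
  · rw [Real.zero_rpow (by linarith)]
    rcases hp.eq_or_lt with rfl | hp
    · simp
    · rw [Real.zero_rpow (by linarith)]
      have := Real.rpow_nonneg ht p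
      simpa using this
  · have h := one_add_mul_self_le_rpow_one_add (s := t / s - 1)
      (by have := div_nonneg ht hs.le; linarith) hp
    rw [add_sub_cancel, Real.div_rpow ht hs.le, le_div_iff₀ (Real.rpow_pos_of_pos hs p)] at h
    have h1 : s ^ p = s ^ (p - 1) * s := by
      rw [← Real.rpow_add_one hs.ne', sub_add_cancel]
    have h2 : (1 + p * (t / s - 1)) * s ^ p = s ^ p + p * s ^ (p - 1) * (t - s) := by
      rw [h1]
      field_simp
    nlinarith

theorem IsExponents.nonneg (hα : IsExponents α) (i : Fin (N + 1)) : 0 ≤ α i := by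
  have := hα.strictMono.monotone (Fin.zero_le i)
  rwa [hα.zero] at this

theorem IsExponents.le_last (hα : IsExponents α) (i : Fin (N + 1)) : α i ≤ α (Fin.last N) :=
  hα.strictMono.monotone (Fin.le_last i)

theorem IsExponents.last_pos (hα : IsExponents α) : 0 < α (Fin.last N) := by
  have h := hα.strictMono (show (0 : Fin (N + 1)) < Fin.last N by
    have := hα.one_le
    rw [Fin.lt_def]
    simpa using Nat.lt_of_succ_le this)
  rwa [hα.zero] at h

theorem degExp_pos (hα : IsExponents α) : 0 < degExp α :=
  div_pos hα.last_pos (by linarith [hα.last_pos])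

theorem degExp_lt_one (hα : IsExponents α) : degExp α < 1 := by
  have := hα.last_pos
  rw [degExp, div_lt_one (by linarith)]
  linarith

theorem one_sub_degExp (hα : IsExponents α) : 1 - degExp α = (α (Fin.last N) + 1)⁻¹ := by
  have := hα.last_pos
  rw [degExp]
  field_simp
  ring

theorem g_mono (hα : IsExponents α) (ha : IsCoeff U a) (hx : x ∈ U) {s t : ℝ} (hs : 0 ≤ s)
    (hst : s ≤ t) : g α a x s ≤ g α a x t :=
  Finset.sum_le_sum fun i _ =>
    mul_le_mul_of_nonneg_left (Real.rpow_le_rpow hs hst (hα.nonneg i)) (ha.nonneg i x hx)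

theorem le_g (ha : IsCoeff U a) (hx : x ∈ U) {s : ℝ} (hs : 0 ≤ s) (i : Fin (N + 1)) :
    a i x * s ^ α i ≤ g α a x s :=
  Finset.single_le_sum (f := fun i => a i x * s ^ α i)
    (fun i _ => mul_nonneg (ha.nonneg i x hx) (Real.rpow_nonneg hs _)) (Finset.mem_univ i)

theorem coeff_zero_le_g (hα : IsExponents α) (ha : IsCoeff U a) (hx : x ∈ U) {s : ℝ}
    (hs : 0 ≤ s) : a 0 x ≤ g α a x s := by
  simpa [hα.zero] using le_g (α := α) ha hx hs 0

theorem g_pos (hα : IsExponents α) (ha : IsCoeff U a) (hx : x ∈ U) {s : ℝ} (hs : 0 ≤ s) :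
    0 < g α a x s :=
  (ha.pos_zero x hx).trans_le (coeff_zero_le_g hα ha hx hs)

theorem mul_g_strictMono (hα : IsExponents α) (ha : IsCoeff U a) (hx : x ∈ U) {s t : ℝ}
    (hs : 0 ≤ s) (hst : s < t) : s * g α a x s < t * g α a x t :=
  calc s * g α a x s ≤ s * g α a x t := mul_le_mul_of_nonneg_left (g_mono hα ha hx hs hst.le) hs
    _ < t * g α a x t := mul_lt_mul_of_pos_right hst (g_pos hα ha hx (hs.trans hst.le))

theorem root_nonneg (hα : IsExponents α) (ha : IsCoeff U a) (hx : x ∈ U) {ξ : ℝ} (hξ : 0 ≤ ξ) :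
    0 ≤ root α a x ξ :=
  (root_spec hα ha hx hξ).1

theorem root_mul_g (hα : IsExponents α) (ha : IsCoeff U a) (hx : x ∈ U) {ξ : ℝ} (hξ : 0 ≤ ξ) :
    root α a x ξ * g α a x (root α a x ξ) = ξ :=
  (root_spec hα ha hx hξ).2

/-- Strict monotonicity of s ↦ s g(x,s) inverts the inequality. The right-hand side no longer
mentions `root`, which makes sublevel sets explicit and yields both monotonicity and measurability.
-/
theorem root_le_iff (hα : IsExponents α) (ha : IsCoeff U a) (hx : x ∈ U) {ξ c : ℝ} (hξ : 0 ≤ ξ)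
    (hc : 0 ≤ c) : root α a x ξ ≤ c ↔ ξ ≤ c * g α a x c := by
  have h := root_spec hα ha hx hξ
  constructor
  · intro hle
    rcases hle.eq_or_lt with heq | hlt
    · rw [← heq, h.2]
    · have := mul_g_strictMono hα ha hx h.1 hlt
      rw [h.2] at this
      exact this.le
  · intro hle
    by_contra! hlt
    have := mul_g_strictMono hα ha hx hc hlt
    rw [h.2] at this
    linarith

theorem root_mono (hα : IsExponents α) (ha : IsCoeff U a) (hx : x ∈ U) {ξ ζ : ℝ} (hξ : 0 ≤ ξ)
    (h : ξ ≤ ζ) : root α a x ξ ≤ root α a x ζ := by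
  rw [root_le_iff hα ha hx hξ (root_nonneg hα ha hx (hξ.trans h)),
    root_mul_g hα ha hx (hξ.trans h)]
  exact h

theorem K_pos (hα : IsExponents α) (ha : IsCoeff U a) (hx : x ∈ U) {ξ : ℝ} (hξ : 0 ≤ ξ) :
    0 < K α a x ξ :=
  one_div_pos.2 (g_pos hα ha hx (root_nonneg hα ha hx hξ))

/-- Since K = 1/g(s) and s g(s) = ξ, the size of the flux is s itself, so monotonicity of the flux
is monotonicity of `root`. -/
theorem K_mul_self (hα : IsExponents α) (ha : IsCoeff U a) (hx : x ∈ U) {ξ : ℝ} (hξ : 0 ≤ ξ) :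
    K α a x ξ * ξ = root α a x ξ := by
  have hg := g_pos hα ha hx (root_nonneg hα ha hx hξ)
  have h := root_mul_g hα ha hx hξ
  rw [K, one_div, inv_mul_eq_iff_eq_mul₀ hg.ne', mul_comm, h]

theorem K_anti (hα : IsExponents α) (ha : IsCoeff U a) (hx : x ∈ U) {ξ ζ : ℝ} (hξ : 0 ≤ ξ)
    (h : ξ ≤ ζ) : K α a x ζ ≤ K α a x ξ :=
  one_div_le_one_div_of_le (g_pos hα ha hx (root_nonneg hα ha hx hξ))
    (g_mono hα ha hx (root_nonneg hα ha hx hξ) (root_mono hα ha hx hξ h))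

theorem K_le_inv (hα : IsExponents α) (ha : IsCoeff U a) (hx : x ∈ U) {ξ : ℝ} (hξ : 0 ≤ ξ) :
    K α a x ξ ≤ (a 0 x)⁻¹ := by
  rw [← one_div]
  exact one_div_le_one_div_of_le (ha.pos_zero x hx)
    (coeff_zero_le_g hα ha hx (root_nonneg hα ha hx hξ))

theorem K_mul_sq_nonneg (hα : IsExponents α) (ha : IsCoeff U a) (hx : x ∈ U) {ξ : ℝ}
    (hξ : 0 ≤ ξ) : 0 ≤ K α a x ξ * ξ ^ 2 :=
  mul_nonneg (K_pos hα ha hx hξ).le (sq_nonneg _)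

theorem K_mul_sq (hα : IsExponents α) (ha : IsCoeff U a) (hx : x ∈ U) {ξ : ℝ} (hξ : 0 ≤ ξ) :
    K α a x ξ * ξ ^ 2 = root α a x ξ * ξ := by
  rw [sq, ← mul_assoc, K_mul_self hα ha hx hξ]

theorem K_mul_sq_mono (hα : IsExponents α) (ha : IsCoeff U a) (hx : x ∈ U) {ξ ζ : ℝ}
    (hξ : 0 ≤ ξ) (h : ξ ≤ ζ) : K α a x ξ * ξ ^ 2 ≤ K α a x ζ * ζ ^ 2 := by
  rw [K_mul_sq hα ha hx hξ, K_mul_sq hα ha hx (hξ.trans h)]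
  exact mul_le_mul (root_mono hα ha hx hξ h) h hξ (root_nonneg hα ha hx (hξ.trans h))

/-- Scaling of the energy density. -/
theorem K_mul_sq_scale (hα : IsExponents α) (ha : IsCoeff U a) (hx : x ∈ U) {c ξ : ℝ}
    (hc : 0 ≤ c) (hξ : 0 ≤ ξ) :
    K α a x (c * ξ) * (c * ξ) ^ 2 ≤ (c + c ^ 2) * (K α a x ξ * ξ ^ 2) := by
  have h0 := K_mul_sq_nonneg hα ha hx hξ
  have hcξ := mul_nonneg hc hξ
  -- For c ≤ 1 the increasing flux gives the factor c; for c ≥ 1 the decreasing K gives c². The sum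
  -- covers both.
  rcases le_total c 1 with h | h
  · have hle : c * ξ ≤ ξ := mul_le_of_le_one_left hξ h
    rw [K_mul_sq hα ha hx hcξ, K_mul_sq hα ha hx hξ] at *
    have h1 := mul_le_mul_of_nonneg_right (root_mono hα ha hx hcξ hle) hcξ
    nlinarith [mul_nonneg (sq_nonneg c) h0]
  · have hle : ξ ≤ c * ξ := le_mul_of_one_le_left hξ h
    have h1 := mul_le_mul_of_nonneg_right (K_anti hα ha hx hξ hle) (sq_nonneg (c * ξ))
    nlinarith [mul_nonneg hc h0]

/-- Young's inequality for the flux. -/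
theorem root_mul_le (hα : IsExponents α) (ha : IsCoeff U a) (hx : x ∈ U) {δ ξ ζ : ℝ}
    (hδ : 0 < δ) (hδ1 : δ ≤ 1) (hξ : 0 ≤ ξ) (hζ : 0 ≤ ζ) :
    K α a x ξ * (ξ * ζ) ≤ δ * (K α a x ξ * ξ ^ 2) + δ⁻¹ * (K α a x ζ * ζ ^ 2) := by
  have hK := K_pos hα ha hx hξ
  have h1 := mul_nonneg hδ.le (K_mul_sq_nonneg hα ha hx hξ)
  have h2 := mul_nonneg (inv_nonneg.2 hδ.le) (K_mul_sq_nonneg hα ha hx hζ)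
  -- Either ζ is small against ξ and the first term suffices, or ξ ≤ δ⁻¹ζ, where the flux increases
  -- up to δ⁻¹ζ and K may then be evaluated at the smaller argument ζ.
  rcases le_total ζ (δ * ξ) with h | h
  · have : K α a x ξ * (ξ * ζ) ≤ K α a x ξ * (ξ * (δ * ξ)) := by gcongr
    nlinarith
  · have hle : ξ ≤ δ⁻¹ * ζ := by
      rw [inv_mul_eq_div, le_div_iff₀ hδ]
      linarith
    have hz : 0 ≤ δ⁻¹ * ζ := by positivity
    have hle2 : ζ ≤ δ⁻¹ * ζ := le_mul_of_one_le_left hζ (one_le_inv_iff₀.2 ⟨hδ, hδ1⟩)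
    have h3 := root_mono hα ha hx hξ hle
    rw [← K_mul_self hα ha hx hξ, ← K_mul_self hα ha hx hz] at h3
    have h4 := K_anti hα ha hx hζ hle2
    calc K α a x ξ * (ξ * ζ) = K α a x ξ * ξ * ζ := by ring
      _ ≤ K α a x (δ⁻¹ * ζ) * (δ⁻¹ * ζ) * ζ := mul_le_mul_of_nonneg_right h3 hζ
      _ ≤ K α a x ζ * (δ⁻¹ * ζ) * ζ := by gcongr
      _ = δ⁻¹ * (K α a x ζ * ζ ^ 2) := by ring
      _ ≤ _ := by linarith

/-- The sum has norm at most twice the larger vector, and doubling the argument costs 2² because K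
decreases. This quasi-triangle inequality is what makes the fields of finite energy a vector space.
-/
theorem K_norm_add_le (hα : IsExponents α) (ha : IsCoeff U a) (hx : x ∈ U) (u v : Space n) :
    K α a x ‖u + v‖ * ‖u + v‖ ^ 2
      ≤ 4 * (K α a x ‖u‖ * ‖u‖ ^ 2 + K α a x ‖v‖ * ‖v‖ ^ 2) := by
  wlog huv : ‖v‖ ≤ ‖u‖ generalizing u v
  · rw [add_comm u v, add_comm (K α a x ‖u‖ * ‖u‖ ^ 2)]
    exact this v u (le_of_not_ge huv)
  have hu := norm_nonneg u
  have h1 : ‖u + v‖ ≤ 2 * ‖u‖ := (norm_add_le u v).trans (by linarith)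
  have h2 := K_mul_sq_mono hα ha hx (norm_nonneg (u + v)) h1
  have h3 := K_anti hα ha hx hu (show ‖u‖ ≤ 2 * ‖u‖ by linarith)
  have h4 := K_mul_sq_nonneg hα ha hx (norm_nonneg v)
  nlinarith [mul_le_mul_of_nonneg_right h3 (sq_nonneg (2 * ‖u‖))]

/-- Strong monotonicity of `ξ ↦ K(ξ) ξ`. -/
theorem root_sub_root (hα : IsExponents α) (ha : IsCoeff U a) (hx : x ∈ U) {ξ ζ : ℝ}
    (hζ : 0 ≤ ζ) (h : ζ ≤ ξ) :
    (1 - degExp α) * K α a x ξ * (ξ - ζ) ≤ root α a x ξ - root α a x ζ := by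
  have hξ := hζ.trans h
  set s := root α a x ξ with hs
  set t := root α a x ζ with ht
  have hs0 : 0 ≤ s := root_nonneg hα ha hx hξ
  have ht0 : 0 ≤ t := root_nonneg hα ha hx hζ
  have hts : t ≤ s := root_mono hα ha hx hζ h
  have e1 : s * g α a x s = ξ := root_mul_g hα ha hx hξ
  have e2 : t * g α a x t = ζ := root_mul_g hα ha hx hζ
  have hg := g_pos hα ha hx hs0
  have hL := hα.last_pos
  -- Term by term, this is the tangent inequality for the power α i + 1. The worst factor α_N + 1
  -- equals 1 / (1 - a).
  have key : ξ - ζ ≤ (α (Fin.last N) + 1) * g α a x s * (s - t) := by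
    rw [← e1, ← e2, g, g, Finset.mul_sum, Finset.mul_sum, ← Finset.sum_sub_distrib,
      Finset.mul_sum, Finset.sum_mul]
    refine Finset.sum_le_sum fun i _ => ?_
    have hi := hα.nonneg i
    have h1 := rpow_sub_rpow_le_mul (p := α i + 1) (by linarith) hs0 ht0
    rw [add_sub_cancel_right, Real.rpow_add_one' hs0 (by linarith),
      Real.rpow_add_one' ht0 (by linarith)] at h1
    have h2 : (α i + 1) * s ^ α i * (s - t) ≤ (α (Fin.last N) + 1) * s ^ α i * (s - t) := by
      have := hα.le_last i
      have := Real.rpow_nonneg hs0 (α i)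
      have : 0 ≤ s - t := by linarith
      gcongr
    have h3 := mul_le_mul_of_nonneg_left (h1.trans h2) (ha.nonneg i x hx)
    linarith
  rw [one_sub_degExp hα, K, ← hs]
  calc (α (Fin.last N) + 1)⁻¹ * (1 / g α a x s) * (ξ - ζ)
      ≤ (α (Fin.last N) + 1)⁻¹ * (1 / g α a x s) *
        ((α (Fin.last N) + 1) * g α a x s * (s - t)) := by gcongr
    _ = s - t := by field_simp

/-- For |v| ≤ |u| the right-hand side splits into a radial part (K(|u|)|u| - K(|v|)|v|)(|u| - |v|),
handled by `root_sub_root`, and (K(|u|) + K(|v|))(|u||v| - u·v). The left-hand side splits in the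
same way, and K(|v|) ≥ K(|u|) settles the second part. -/
theorem flux_monotone (hα : IsExponents α) (ha : IsCoeff U a) (hx : x ∈ U) (u v : Space n) :
    (1 - degExp α) * (K α a x (max ‖u‖ ‖v‖) * ‖u - v‖ ^ 2)
      ≤ K α a x ‖u‖ * inner ℝ u (u - v) - K α a x ‖v‖ * inner ℝ v (u - v) := by
  wlog huv : ‖v‖ ≤ ‖u‖ generalizing u v
  · have h := this v u (le_of_not_ge huv)
    rw [max_comm, norm_sub_rev] at h
    have e : v - u = -(u - v) := by abel
    rw [e, inner_neg_right, inner_neg_right] at h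
    linarith
  rw [max_eq_left huv, inner_sub_right, inner_sub_right, real_inner_self_eq_norm_sq,
    real_inner_self_eq_norm_sq, real_inner_comm, norm_sub_sq_real, real_inner_comm v u]
  have h1 := root_sub_root hα ha hx (norm_nonneg v) huv
  rw [← K_mul_self hα ha hx (norm_nonneg u), ← K_mul_self hα ha hx (norm_nonneg v)] at h1
  have h2 := mul_le_mul_of_nonneg_right h1 (sub_nonneg.2 huv)
  have h3 := K_anti hα ha hx (norm_nonneg v) huv
  have h4 := K_pos hα ha hx (norm_nonneg u)
  have h5 := real_inner_le_norm v u
  have h6 := degExp_pos hα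
  have h7 : 0 ≤ K α a x ‖v‖ - K α a x ‖u‖ + 2 * degExp α * K α a x ‖u‖ := by
    have := mul_pos h6 h4
    linarith
  nlinarith [mul_le_mul_of_nonneg_left h5 h7]

/-! ### The convex potential -/

/-- The potential `h(x,ξ) = ∫₀^ξ K(x,σ) σ dσ`, in closed form. -/
noncomputable def potential (α : Fin (N + 1) → ℝ) (a : Fin (N + 1) → Space n → ℝ)
    (x : Space n) (ξ : ℝ) : ℝ :=
  root α a x ξ * ξ - ∑ i, a i x * (root α a x ξ ^ (α i + 2) / (α i + 2))

/-- The potential is the Legendre transform of Γ(s) = ∑ aᵢ s^(αᵢ+2)/(αᵢ+2), for which Γ'(s) = s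
g(s). The tangent inequality of Γ at t is therefore the tangent inequality of the potential at ξ,
without differentiating in ξ. -/
theorem potential_convex (hα : IsExponents α) (ha : IsCoeff U a) (hx : x ∈ U) {ξ ζ : ℝ}
    (hξ : 0 ≤ ξ) (hζ : 0 ≤ ζ) :
    potential α a x ξ - potential α a x ζ ≤ root α a x ξ * (ξ - ζ) := by
  rw [potential, potential]
  set s := root α a x ξ with hs
  set t := root α a x ζ with ht
  have hs0 : 0 ≤ s := root_nonneg hα ha hx hξ
  have ht0 : 0 ≤ t := root_nonneg hα ha hx hζ
  have e2 : t * g α a x t = ζ := root_mul_g hα ha hx hζ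
  have key : ∑ i, a i x * (t ^ (α i + 2) / (α i + 2)) - ∑ i, a i x * (s ^ (α i + 2) / (α i + 2))
      ≤ (t - s) * ζ := by
    rw [← e2, g, ← Finset.sum_sub_distrib, Finset.mul_sum, Finset.mul_sum]
    refine Finset.sum_le_sum fun i _ => ?_
    have hi := hα.nonneg i
    have h1 := rpow_sub_rpow_le_mul (p := α i + 2) (by linarith) ht0 hs0
    have e : α i + 2 - 1 = α i + 1 := by ring
    rw [e, Real.rpow_add_one' ht0 (by linarith)] at h1
    have hp : 0 < α i + 2 := by linarith
    have h2 : t ^ (α i + 2) / (α i + 2) - s ^ (α i + 2) / (α i + 2) ≤ t ^ α i * t * (t - s) := by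
      rw [← sub_div, div_le_iff₀ hp]
      linarith
    have := mul_le_mul_of_nonneg_left h2 (ha.nonneg i x hx)
    linarith
  linarith

theorem potential_le (hα : IsExponents α) (ha : IsCoeff U a) (hx : x ∈ U) {ξ : ℝ}
    (hξ : 0 ≤ ξ) : potential α a x ξ ≤ K α a x ξ * ξ ^ 2 := by
  rw [K_mul_sq hα ha hx hξ, potential]
  have : 0 ≤ ∑ i, a i x * (root α a x ξ ^ (α i + 2) / (α i + 2)) :=
    Finset.sum_nonneg fun i _ => mul_nonneg (ha.nonneg i x hx)
      (div_nonneg (Real.rpow_nonneg (root_nonneg hα ha hx hξ) _) (by linarith [hα.nonneg i]))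
  linarith

/-- All exponents αᵢ + 2 are at least 2, so the subtracted sum removes at most half of the energy
density. -/
theorem le_potential (hα : IsExponents α) (ha : IsCoeff U a) (hx : x ∈ U) {ξ : ℝ}
    (hξ : 0 ≤ ξ) : K α a x ξ * ξ ^ 2 ≤ 2 * potential α a x ξ := by
  rw [K_mul_sq hα ha hx hξ, potential]
  have hs0 := root_nonneg hα ha hx hξ
  have e1 := root_mul_g hα ha hx hξ
  set s := root α a x ξ
  have : ∑ i, a i x * (s ^ (α i + 2) / (α i + 2)) ≤ s * ξ / 2 := by
    rw [← e1, g, Finset.mul_sum, Finset.mul_sum, Finset.sum_div]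
    refine Finset.sum_le_sum fun i _ => ?_
    have hi := hα.nonneg i
    have e : s ^ (α i + 2) = s ^ α i * s * s := by
      rw [show α i + 2 = α i + 1 + 1 by ring, Real.rpow_add_one' hs0 (by linarith),
        Real.rpow_add_one' hs0 (by linarith)]
    have h1 : 0 ≤ s ^ α i * s * s :=
      mul_nonneg (mul_nonneg (Real.rpow_nonneg hs0 _) hs0) hs0
    have h2 : s ^ (α i + 2) / (α i + 2) ≤ s ^ α i * s * s / 2 := by
      rw [e]
      exact div_le_div_of_nonneg_left h1 (by norm_num) (by linarith)
    have := mul_le_mul_of_nonneg_left h2 (ha.nonneg i x hx)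
    linarith
  linarith

theorem potential_norm_sub_le (hα : IsExponents α) (ha : IsCoeff U a) (hx : x ∈ U)
    (u v : Space n) :
    potential α a x ‖u‖ - potential α a x ‖v‖ ≤ K α a x ‖u‖ * inner ℝ u (u - v) := by
  have h := potential_convex hα ha hx (norm_nonneg u) (norm_nonneg v)
  rw [← K_mul_self hα ha hx (norm_nonneg u)] at h
  rw [inner_sub_right, real_inner_self_eq_norm_sq]
  have := mul_le_mul_of_nonneg_left (real_inner_le_norm u v) (K_pos hα ha hx (norm_nonneg u)).le
  linarith

/-! ### Lower bounds in terms of the weight -/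

theorem coeff_le_maxCoeff (i : Fin (N + 1)) : a i x ≤ maxCoeff a x :=
  Finset.le_sup' (fun j => a j x) (Finset.mem_univ i)

theorem maxCoeff_pos (ha : IsCoeff U a) (hx : x ∈ U) : 0 < maxCoeff a x :=
  (ha.pos_zero x hx).trans_le (coeff_le_maxCoeff 0)

theorem W1_pos (hα : IsExponents α) (ha : IsCoeff U a) (hx : x ∈ U) : 0 < W1 α a x := by
  have h1 := maxCoeff_pos ha hx
  have h2 := Real.rpow_pos_of_pos (ha.pos_last x hx) (degExp α)
  have h3 : (0 : ℝ) < N := by exact_mod_cast hα.one_le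
  rw [W1]
  positivity

/-- The weight is designed for this bound. Raising a_N s^(α_N+1) ≤ ξ to the power a gives a_N^a
s^(α_N) ≤ ξ^a, while g(s) ≤ (N+1) M (s^(α_N) + 1) and N + 1 ≤ 2N. -/
theorem W1_le_K_mul (hα : IsExponents α) (ha : IsCoeff U a) (hx : x ∈ U) {ξ : ℝ} (hξ : 0 ≤ ξ) :
    W1 α a x ≤ K α a x ξ * (ξ ^ degExp α + a (Fin.last N) x ^ degExp α) := by
  have hs0 := root_nonneg hα ha hx hξ
  have e1 := root_mul_g hα ha hx hξ
  have hL := hα.last_pos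
  have hM := maxCoeff_pos ha hx
  have haN := ha.pos_last x hx
  have hN : (1 : ℝ) ≤ N := by exact_mod_cast hα.one_le
  rw [K]
  set s := root α a x ξ
  have hg := g_pos hα ha hx hs0
  have h1 : a (Fin.last N) x ^ degExp α * s ^ α (Fin.last N) ≤ ξ ^ degExp α := by
    have h : a (Fin.last N) x * s ^ (α (Fin.last N) + 1) ≤ ξ := by
      rw [Real.rpow_add_one' hs0 (by linarith), ← mul_assoc, mul_comm, ← e1]
      exact mul_le_mul_of_nonneg_left (le_g ha hx hs0 _) hs0
    have h2 := Real.rpow_le_rpow (by positivity) h (degExp_pos hα).le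
    rwa [Real.mul_rpow haN.le (by positivity), ← Real.rpow_mul hs0, degExp,
      mul_div_cancel₀ _ (by linarith)] at h2
  have h2 : g α a x s ≤ (N + 1) * maxCoeff a x * (s ^ α (Fin.last N) + 1) := by
    have : g α a x s ≤ ∑ _i : Fin (N + 1), maxCoeff a x * (s ^ α (Fin.last N) + 1) := by
      refine Finset.sum_le_sum fun i _ => ?_
      refine mul_le_mul (coeff_le_maxCoeff i) ?_ (Real.rpow_nonneg hs0 _) hM.le
      rcases le_total s 1 with h | h
      · have := Real.rpow_le_one hs0 h (hα.nonneg i)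
        have := Real.rpow_nonneg hs0 (α (Fin.last N))
        linarith
      · have := Real.rpow_le_rpow_of_exponent_le h (hα.le_last i)
        linarith
    refine this.trans (le_of_eq ?_)
    rw [Finset.sum_const, Finset.card_univ, Fintype.card_fin, nsmul_eq_mul]
    push_cast
    ring
  have hA := Real.rpow_pos_of_pos haN (degExp α)
  rw [W1, one_div, inv_mul_eq_div, div_le_div_iff₀ (by positivity) hg]
  have hS : 0 ≤ s ^ α (Fin.last N) := Real.rpow_nonneg hs0 _
  calc a (Fin.last N) x ^ degExp α * g α a x s
      ≤ a (Fin.last N) x ^ degExp α * ((N + 1) * maxCoeff a x * (s ^ α (Fin.last N) + 1)) := by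
        gcongr
    _ ≤ a (Fin.last N) x ^ degExp α * ((N + N) * maxCoeff a x * (s ^ α (Fin.last N) + 1)) := by
        gcongr
    _ = (a (Fin.last N) x ^ degExp α * s ^ α (Fin.last N) + a (Fin.last N) x ^ degExp α) *
        (2 * N * maxCoeff a x) := by ring
    _ ≤ _ := by gcongr

theorem W1_mul_last (hα : IsExponents α) (ha : IsCoeff U a) (hx : x ∈ U) :
    W1 α a x * a (Fin.last N) x ^ (2 - degExp α) ≤ a (Fin.last N) x := by
  have hM := maxCoeff_pos ha hx
  have haN := ha.pos_last x hx
  have hN : (1 : ℝ) ≤ N := by exact_mod_cast hα.one_le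
  have e : a (Fin.last N) x ^ degExp α * a (Fin.last N) x ^ (2 - degExp α)
      = a (Fin.last N) x ^ 2 := by
    rw [← Real.rpow_add haN, add_sub_cancel, Real.rpow_two]
  rw [W1, div_mul_eq_mul_div, e, div_le_iff₀ (by positivity)]
  have h := coeff_le_maxCoeff (a := a) (x := x) (Fin.last N)
  nlinarith [mul_le_mul_of_nonneg_left h haN.le, mul_pos haN hM]

/-- Below the threshold ξ = a_N the left side is controlled by its value there. Above it, ξ^a
dominates a_N^a in `W1_le_K_mul`. -/
theorem W1_mul_rpow_le (hα : IsExponents α) (ha : IsCoeff U a) (hx : x ∈ U) {ξ : ℝ}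
    (hξ : 0 ≤ ξ) :
    W1 α a x * ξ ^ (2 - degExp α) ≤ 2 * (K α a x ξ * ξ ^ 2) + a (Fin.last N) x := by
  have haN := ha.pos_last x hx
  have hW := W1_pos hα ha hx
  have hK := K_pos hα ha hx hξ
  have h0 := degExp_pos hα
  have h1 := degExp_lt_one hα
  have hE := K_mul_sq_nonneg hα ha hx hξ
  rcases le_total ξ (a (Fin.last N) x) with h | h
  · have h2 := mul_le_mul_of_nonneg_left
      (Real.rpow_le_rpow hξ h (by linarith : 0 ≤ 2 - degExp α)) hW.le
    linarith [W1_mul_last hα ha hx]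
  · have h2 := W1_le_K_mul hα ha hx hξ
    have h3 : a (Fin.last N) x ^ degExp α ≤ ξ ^ degExp α := Real.rpow_le_rpow haN.le h h0.le
    have h4 : W1 α a x ≤ 2 * K α a x ξ * ξ ^ degExp α := by nlinarith
    have h5 := mul_le_mul_of_nonneg_right h4 (Real.rpow_nonneg hξ (2 - degExp α))
    have e : ξ ^ degExp α * ξ ^ (2 - degExp α) = ξ ^ 2 := by
      rw [← Real.rpow_add (haN.trans_le h), add_sub_cancel, Real.rpow_two]
    rw [mul_assoc, e] at h5
    linarith

theorem add_rpow_le {p u v : ℝ} (hp : 0 ≤ p) (hu : 0 ≤ u) (hv : 0 ≤ v) :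
    (u + v) ^ p ≤ 2 ^ p * (u ^ p + v ^ p) := by
  wlog h : v ≤ u generalizing u v
  · rw [add_comm u v, add_comm (u ^ p)]
    exact this hv hu (le_of_not_ge h)
  have := Real.rpow_le_rpow (by positivity) (show u + v ≤ 2 * u by linarith) hp
  rw [Real.mul_rpow (by norm_num) hu] at this
  have h2 := Real.rpow_nonneg hv p
  have h3 : (0 : ℝ) ≤ 2 ^ p := by positivity
  nlinarith [mul_nonneg h3 h2]

/-- Young's inequality relating the weighted `(2-a)`-density to the `K`-weighted
quadratic density. -/
theorem W1_mul_rpow_le_young (hα : IsExponents α) (ha : IsCoeff U a) (hx : x ∈ U)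
    {ξ ρ σ : ℝ} (hξ : 0 ≤ ξ) (hρ : 0 ≤ ρ) (hσ : 0 < σ) :
    W1 α a x * ρ ^ (2 - degExp α) ≤ σ ^ (-degExp α) * (K α a x ξ * ρ ^ 2)
      + σ ^ (2 - degExp α) * (2 ^ (2 / degExp α + 1) *
        (W1 α a x * ξ ^ (2 - degExp α) + W1 α a x * a (Fin.last N) x ^ (2 - degExp α))) := by
  have haN := ha.pos_last x hx
  have hW := W1_pos hα ha hx
  have hK := K_pos hα ha hx hξ
  have h0 := degExp_pos hα
  have h1 := degExp_lt_one hα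
  set e := degExp α with he
  set b := a (Fin.last N) x
  have hS : 0 ≤ ξ ^ e + b ^ e := by positivity
  have t1 : 0 ≤ σ ^ (-e) * (K α a x ξ * ρ ^ 2) := by positivity
  have t2 : 0 ≤ σ ^ (2 - e) * (2 ^ (2 / e + 1) * (W1 α a x * ξ ^ (2 - e) + W1 α a x * b ^ (2 - e))) := by
    positivity
  -- The split is at ρ = σ (ξ^a + b^a)^(1/a). For larger ρ, `W1_le_K_mul` trades ρ^(2-a) for K ρ²;
  -- for smaller ρ, ρ is at most a multiple of σ(ξ + b).
  rcases le_total ((ξ ^ e + b ^ e) * σ ^ e) (ρ ^ e) with h | h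
  · refine le_add_of_le_of_nonneg ?_ t2
    have hσe : 0 < σ ^ e := Real.rpow_pos_of_pos hσ e
    have h2 : ξ ^ e + b ^ e ≤ σ ^ (-e) * ρ ^ e := by
      rw [Real.rpow_neg hσ.le, inv_mul_eq_div, le_div_iff₀ hσe]
      exact h
    have e3 : ρ ^ e * ρ ^ (2 - e) = ρ ^ 2 := by
      rw [← Real.rpow_add' hρ (by norm_num), add_sub_cancel, Real.rpow_two]
    calc W1 α a x * ρ ^ (2 - e)
        ≤ K α a x ξ * (σ ^ (-e) * ρ ^ e) * ρ ^ (2 - e) := by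
          refine mul_le_mul_of_nonneg_right ?_ (by positivity)
          exact (W1_le_K_mul hα ha hx hξ).trans (mul_le_mul_of_nonneg_left h2 hK.le)
      _ = σ ^ (-e) * (K α a x ξ * (ρ ^ e * ρ ^ (2 - e))) := by ring
      _ = _ := by rw [e3]
  · refine le_add_of_nonneg_of_le t1 ?_
    have h2 : ρ ≤ (ξ ^ e + b ^ e) ^ e⁻¹ * σ := by
      have := Real.rpow_le_rpow (by positivity) h (inv_nonneg.2 h0.le)
      rwa [Real.rpow_rpow_inv hρ h0.ne', Real.mul_rpow hS (by positivity),
        Real.rpow_rpow_inv hσ.le h0.ne'] at this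
    have h3 : (ξ ^ e + b ^ e) ^ e⁻¹ ≤ 2 ^ e⁻¹ * (ξ + b) := by
      have hm : ξ ^ e + b ^ e ≤ 2 * (ξ + b) ^ e := by
        have u1 := Real.rpow_le_rpow hξ (show ξ ≤ ξ + b by linarith) h0.le
        have u2 := Real.rpow_le_rpow haN.le (show b ≤ ξ + b by linarith) h0.le
        linarith
      have := Real.rpow_le_rpow hS hm (inv_nonneg.2 h0.le)
      rwa [Real.mul_rpow (by norm_num) (by positivity),
        Real.rpow_rpow_inv (by positivity) h0.ne'] at this
    have h4 : ρ ^ (2 - e) ≤ σ ^ (2 - e) * (2 ^ (2 / e + 1) * (ξ ^ (2 - e) + b ^ (2 - e))) := by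
      have u1 := Real.rpow_le_rpow hρ (h2.trans (mul_le_mul_of_nonneg_right h3 hσ.le))
        (by linarith : 0 ≤ 2 - e)
      rw [Real.mul_rpow (by positivity) hσ.le, Real.mul_rpow (by positivity) (by positivity),
        ← Real.rpow_mul (by norm_num)] at u1
      have u2 := add_rpow_le (by linarith : 0 ≤ 2 - e) hξ haN.le
      -- The exponents add up to 2/e + 1 - e.
      have e5 : (2 : ℝ) ^ (e⁻¹ * (2 - e)) * 2 ^ (2 - e) ≤ 2 ^ (2 / e + 1) := by
        rw [← Real.rpow_add (by norm_num)]
        refine Real.rpow_le_rpow_of_exponent_le (by norm_num) ?_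
        have : e⁻¹ * (2 - e) = 2 / e - 1 := by field_simp
        linarith
      calc ρ ^ (2 - e) ≤ 2 ^ (e⁻¹ * (2 - e)) * (ξ + b) ^ (2 - e) * σ ^ (2 - e) := u1
        _ ≤ 2 ^ (e⁻¹ * (2 - e)) * (2 ^ (2 - e) * (ξ ^ (2 - e) + b ^ (2 - e))) * σ ^ (2 - e) := by
          gcongr
        _ = σ ^ (2 - e) * (2 ^ (e⁻¹ * (2 - e)) * 2 ^ (2 - e) * (ξ ^ (2 - e) + b ^ (2 - e))) := by
          ring
        _ ≤ _ := by gcongr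
    calc W1 α a x * ρ ^ (2 - e)
        ≤ W1 α a x * (σ ^ (2 - e) * (2 ^ (2 / e + 1) * (ξ ^ (2 - e) + b ^ (2 - e)))) := by gcongr
      _ = _ := by ring

end Pointwise

/-! ### Energy and `L²_φ` functionals -/

section Functional

variable {n N : ℕ} {U : Set (Space n)} {φ : Space n → ℝ} {α : Fin (N + 1) → ℝ}
  {a : Fin (N + 1) → Space n → ℝ}

/-- The standing assumptions. -/
structure Setting {n N : ℕ} (U : Set (Space n)) (φ : Space n → ℝ) (α : Fin (N + 1) → ℝ)
    (a : Fin (N + 1) → Space n → ℝ) : Prop where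
  isOpen : IsOpen U
  exps : IsExponents α
  coeff : IsCoeff U a
  poro : IsPorosity U φ

theorem Setting.ae_mem (hS : Setting U φ α a) : ∀ᵐ x ∂(volume.restrict U), x ∈ U :=
  ae_restrict_mem hS.isOpen.measurableSet

/-- `root` is defined by choice, so measurability goes through its sublevel sets: by `root_le_iff`
they agree on U with {ξ ≤ c g(x,c)}. This is only up to null sets, hence the null-measurable
σ-algebra. -/
theorem aemeasurable_root (hS : Setting U φ α a) {ξ : Space n → ℝ}
    (hξ : AEMeasurable ξ (volume.restrict U)) (h0 : ∀ x, 0 ≤ ξ x) :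
    AEMeasurable (fun x => root α a x (ξ x)) (volume.restrict U) := by
  refine NullMeasurable.aemeasurable ?_
  have key : ∀ c, NullMeasurableSet ((fun x => root α a x (ξ x)) ⁻¹' Iic c)
      (volume.restrict U) := ?_
  · exact @measurable_of_Iic ℝ (NullMeasurableSpace (Space n) (volume.restrict U)) _ _ _ _ _ _ _
      (fun x => root α a x (ξ x)) key
  intro c
  rcases lt_or_ge c 0 with hc | hc
  · refine (nullMeasurableSet_empty (μ := volume.restrict U)).congr ?_
    filter_upwards [hS.ae_mem] with x hx
    refine propext (iff_of_false (fun h => h) fun h => ?_)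
    have := root_nonneg hS.exps hS.coeff hx (h0 x)
    have h' : root α a x (ξ x) ≤ c := h
    linarith
  · have hg : AEMeasurable (fun x => c * g α a x c) (volume.restrict U) := by
      unfold g
      refine AEMeasurable.const_mul ?_ _
      exact Finset.aemeasurable_fun_sum _ fun i _ => (hS.coeff.measurable i).mul_const _
    refine (nullMeasurableSet_le hξ hg).congr ?_
    filter_upwards [hS.ae_mem] with x hx
    exact propext (root_le_iff hS.exps hS.coeff hx (h0 x) hc).symm

theorem aemeasurable_K (hS : Setting U φ α a) {ξ : Space n → ℝ}
    (hξ : AEMeasurable ξ (volume.restrict U)) (h0 : ∀ x, 0 ≤ ξ x) :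
    AEMeasurable (fun x => K α a x (ξ x)) (volume.restrict U) := by
  unfold K g
  refine AEMeasurable.const_div ?_ _
  exact Finset.aemeasurable_fun_sum _ fun i _ =>
    (hS.coeff.measurable i).mul ((aemeasurable_root hS hξ h0).pow_const _)

/-- A measurable field of finite energy. -/
structure FinEnergy (U : Set (Space n)) (α : Fin (N + 1) → ℝ) (a : Fin (N + 1) → Space n → ℝ)
    (q : Space n → Space n) : Prop where
  meas : AEStronglyMeasurable q (volume.restrict U)
  lt_top : energy U α a q < ⊤

/-- The energy as a real number. -/
noncomputable def en (U : Set (Space n)) (α : Fin (N + 1) → ℝ) (a : Fin (N + 1) → Space n → ℝ)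
    (q : Space n → Space n) : ℝ :=
  (energy U α a q).toReal

/-- The pairing `∫ K(x,|q|) q · r` of the flux of `q` with `r`. -/
noncomputable def pair (U : Set (Space n)) (α : Fin (N + 1) → ℝ)
    (a : Fin (N + 1) → Space n → ℝ) (q r : Space n → Space n) : ℝ :=
  ∫ x in U, K α a x ‖q x‖ * inner ℝ (q x) (r x)

/-- The `L²_φ` inner product. -/
noncomputable def wip (U : Set (Space n)) (φ u v : Space n → ℝ) : ℝ :=
  ∫ x in U, φ x * u x * v x

theorem en_nonneg (q : Space n → Space n) : 0 ≤ en U α a q := ENNReal.toReal_nonneg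

theorem aestronglyMeasurable_density (hS : Setting U φ α a) {q : Space n → Space n}
    (hq : AEStronglyMeasurable q (volume.restrict U)) :
    AEStronglyMeasurable (fun x => K α a x ‖q x‖ * ‖q x‖ ^ 2) (volume.restrict U) :=
  ((aemeasurable_K hS hq.norm.aemeasurable fun _ => norm_nonneg _).mul
    (hq.norm.aemeasurable.pow_const 2)).aestronglyMeasurable

theorem density_nonneg (hS : Setting U φ α a) (q : Space n → Space n) :
    0 ≤ᵐ[volume.restrict U] fun x => K α a x ‖q x‖ * ‖q x‖ ^ 2 := by
  filter_upwards [hS.ae_mem] with x hx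
  exact K_mul_sq_nonneg hS.exps hS.coeff hx (norm_nonneg _)

theorem finEnergy_iff (hS : Setting U φ α a) {q : Space n → Space n}
    (hq : AEStronglyMeasurable q (volume.restrict U)) :
    FinEnergy U α a q ↔
      Integrable (fun x => K α a x ‖q x‖ * ‖q x‖ ^ 2) (volume.restrict U) := by
  rw [← lintegral_ofReal_ne_top_iff_integrable (aestronglyMeasurable_density hS hq)
    (density_nonneg hS q), ← lt_top_iff_ne_top]
  exact ⟨fun h => h.lt_top, fun h => ⟨hq, h⟩⟩

theorem FinEnergy.integrable (hS : Setting U φ α a) {q : Space n → Space n}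
    (hq : FinEnergy U α a q) :
    Integrable (fun x => K α a x ‖q x‖ * ‖q x‖ ^ 2) (volume.restrict U) :=
  (finEnergy_iff hS hq.meas).1 hq

theorem en_eq (hS : Setting U φ α a) {q : Space n → Space n}
    (hq : AEStronglyMeasurable q (volume.restrict U)) :
    en U α a q = ∫ x in U, K α a x ‖q x‖ * ‖q x‖ ^ 2 :=
  (integral_eq_lintegral_of_nonneg_ae (density_nonneg hS q)
    (aestronglyMeasurable_density hS hq)).symm

theorem FinEnergy.of_le (hS : Setting U φ α a) {q : Space n → Space n} {f : Space n → ℝ}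
    (hq : AEStronglyMeasurable q (volume.restrict U)) (hf : Integrable f (volume.restrict U))
    (h : ∀ x ∈ U, K α a x ‖q x‖ * ‖q x‖ ^ 2 ≤ f x) :
    FinEnergy U α a q ∧ en U α a q ≤ ∫ x in U, f x := by
  have h' : ∀ᵐ x ∂(volume.restrict U), K α a x ‖q x‖ * ‖q x‖ ^ 2 ≤ f x := by
    filter_upwards [hS.ae_mem] with x hx using h x hx
  have hi : Integrable (fun x => K α a x ‖q x‖ * ‖q x‖ ^ 2) (volume.restrict U) := by
    refine hf.mono' (aestronglyMeasurable_density hS hq) ?_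
    filter_upwards [h', density_nonneg hS q] with x hx h0
    rwa [Real.norm_of_nonneg h0]
  refine ⟨(finEnergy_iff hS hq).2 hi, ?_⟩
  rw [en_eq hS hq]
  exact integral_mono_ae hi hf h'

theorem FinEnergy.add_and_le (hS : Setting U φ α a) {q r : Space n → Space n}
    (hq : FinEnergy U α a q) (hr : FinEnergy U α a r) :
    FinEnergy U α a (q + r) ∧ en U α a (q + r) ≤ 4 * (en U α a q + en U α a r) := by
  have h := FinEnergy.of_le hS (hq.meas.add hr.meas)
    (((hq.integrable hS).add (hr.integrable hS)).const_mul 4)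
    fun x hx => K_norm_add_le hS.exps hS.coeff hx (q x) (r x)
  rw [integral_const_mul, integral_add' (hq.integrable hS) (hr.integrable hS),
    ← en_eq hS hq.meas, ← en_eq hS hr.meas] at h
  exact h

theorem FinEnergy.smul_and_le (hS : Setting U φ α a) {q : Space n → Space n}
    (hq : FinEnergy U α a q) (c : ℝ) :
    FinEnergy U α a (c • q) ∧ en U α a (c • q) ≤ (|c| + c ^ 2) * en U α a q := by
  have h := FinEnergy.of_le (q := c • q) hS (hq.meas.const_smul c)
    ((hq.integrable hS).const_mul (|c| + |c| ^ 2)) fun x hx => by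
      rw [Pi.smul_apply, norm_smul, Real.norm_eq_abs]
      exact K_mul_sq_scale hS.exps hS.coeff hx (abs_nonneg c) (norm_nonneg _)
  rwa [integral_const_mul, ← en_eq hS hq.meas, sq_abs] at h

theorem FinEnergy.neg (hS : Setting U φ α a) {q : Space n → Space n}
    (hq : FinEnergy U α a q) : FinEnergy U α a (-q) := by
  have := (hq.smul_and_le hS (-1)).1
  rwa [neg_one_smul] at this

theorem energy_neg (q : Space n → Space n) : energy U α a (-q) = energy U α a q := by
  simp [energy]

theorem FinEnergy.sub_and_le (hS : Setting U φ α a) {q r : Space n → Space n}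
    (hq : FinEnergy U α a q) (hr : FinEnergy U α a r) :
    FinEnergy U α a (q - r) ∧ en U α a (q - r) ≤ 4 * (en U α a q + en U α a r) := by
  have h := hq.add_and_le hS (hr.neg hS)
  rwa [← sub_eq_add_neg, en, en, en, energy_neg] at h

theorem energy_congr {q r : Space n → Space n} (h : q =ᵐ[volume.restrict U] r) :
    energy U α a q = energy U α a r := by
  refine lintegral_congr_ae ?_
  filter_upwards [h] with x hx
  rw [hx]

theorem abs_flux_inner_le (hS : Setting U φ α a) {x : Space n} (hx : x ∈ U) (u v : Space n)
    {δ : ℝ} (hδ : 0 < δ) (hδ1 : δ ≤ 1) :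
    |K α a x ‖u‖ * inner ℝ u v|
      ≤ δ * (K α a x ‖u‖ * ‖u‖ ^ 2) + δ⁻¹ * (K α a x ‖v‖ * ‖v‖ ^ 2) := by
  rw [abs_mul, abs_of_pos (K_pos hS.exps hS.coeff hx (norm_nonneg u))]
  exact (mul_le_mul_of_nonneg_left (abs_real_inner_le_norm u v)
    (K_pos hS.exps hS.coeff hx (norm_nonneg u)).le).trans
    (root_mul_le hS.exps hS.coeff hx hδ hδ1 (norm_nonneg u) (norm_nonneg v))

theorem integrable_pair (hS : Setting U φ α a) {q r : Space n → Space n}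
    (hq : FinEnergy U α a q) (hr : FinEnergy U α a r) :
    Integrable (fun x => K α a x ‖q x‖ * inner ℝ (q x) (r x)) (volume.restrict U) := by
  refine (((hq.integrable hS).const_mul 1).add ((hr.integrable hS).const_mul 1⁻¹)).mono' ?_ ?_
  · exact (aemeasurable_K hS hq.meas.norm.aemeasurable
      fun _ => norm_nonneg _).aestronglyMeasurable.mul (hq.meas.inner hr.meas)
  · filter_upwards [hS.ae_mem] with x hx
    exact abs_flux_inner_le hS hx (q x) (r x) one_pos le_rfl

theorem abs_pair_le (hS : Setting U φ α a) {q r : Space n → Space n}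
    (hq : FinEnergy U α a q) (hr : FinEnergy U α a r) {δ : ℝ} (hδ : 0 < δ) (hδ1 : δ ≤ 1) :
    |pair U α a q r| ≤ δ * en U α a q + δ⁻¹ * en U α a r := by
  have hi := ((hq.integrable hS).const_mul δ).add ((hr.integrable hS).const_mul δ⁻¹)
  have h := norm_integral_le_of_norm_le
    (f := fun x => K α a x ‖q x‖ * inner ℝ (q x) (r x)) hi (by
      filter_upwards [hS.ae_mem] with x hx
      exact abs_flux_inner_le hS hx (q x) (r x) hδ hδ1)
  rw [Pi.add_def, integral_add ((hq.integrable hS).const_mul δ)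
    ((hr.integrable hS).const_mul δ⁻¹), integral_const_mul, integral_const_mul,
    ← en_eq hS hq.meas, ← en_eq hS hr.meas] at h
  exact h

theorem pair_sub (hS : Setting U φ α a) {q r s : Space n → Space n}
    (hq : FinEnergy U α a q) (hr : FinEnergy U α a r) (hs : FinEnergy U α a s) :
    pair U α a q (r - s) = pair U α a q r - pair U α a q s := by
  rw [pair, pair, pair, ← integral_sub (integrable_pair hS hq hr) (integrable_pair hS hq hs)]
  simp only [Pi.sub_apply, inner_sub_right, mul_sub]

theorem pair_smul (q r : Space n → Space n) (c : ℝ) :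
    pair U α a q (c • r) = c * pair U α a q r := by
  rw [pair, pair, ← integral_const_mul]
  simp only [Pi.smul_apply, real_inner_smul_right, mul_left_comm]

theorem pair_self (hS : Setting U φ α a) {q : Space n → Space n} (hq : FinEnergy U α a q) :
    pair U α a q q = en U α a q := by
  rw [en_eq hS hq.meas, pair]
  simp only [real_inner_self_eq_norm_sq]

/-! #### The space `L²_φ` -/

theorem aestronglyMeasurable_wip (hS : Setting U φ α a) {u v : Space n → ℝ}
    (hu : AEStronglyMeasurable u (volume.restrict U))
    (hv : AEStronglyMeasurable v (volume.restrict U)) :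
    AEStronglyMeasurable (fun x => φ x * u x * v x) (volume.restrict U) :=
  (hS.poro.measurable.aestronglyMeasurable.mul hu).mul hv

theorem sqDensity_nonneg (hS : Setting U φ α a) (u : Space n → ℝ) :
    0 ≤ᵐ[volume.restrict U] fun x => φ x * u x * u x := by
  filter_upwards [hS.ae_mem] with x hx
  rw [mul_assoc]
  exact mul_nonneg (hS.poro.pos x hx).le (mul_self_nonneg _)

theorem normSq_eq_lintegral (u : Space n → ℝ) :
    normSq U φ u = ∫⁻ x in U, ENNReal.ofReal (φ x * u x * u x) := by
  simp only [normSq, sq, mul_assoc]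

theorem memL2_iff (hS : Setting U φ α a) {u : Space n → ℝ}
    (hu : AEStronglyMeasurable u (volume.restrict U)) :
    MemL2 U φ u ↔ Integrable (fun x => φ x * u x * u x) (volume.restrict U) := by
  rw [← lintegral_ofReal_ne_top_iff_integrable (aestronglyMeasurable_wip hS hu hu)
    (sqDensity_nonneg hS u), ← lt_top_iff_ne_top, ← normSq_eq_lintegral]
  exact ⟨fun h => h.2, fun h => ⟨hu, h⟩⟩

theorem memL2_integrable (hS : Setting U φ α a) {u : Space n → ℝ} (hu : MemL2 U φ u) :
    Integrable (fun x => φ x * u x * u x) (volume.restrict U) :=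
  (memL2_iff hS hu.1).1 hu

theorem wip_self_eq (hS : Setting U φ α a) {u : Space n → ℝ}
    (hu : AEStronglyMeasurable u (volume.restrict U)) :
    wip U φ u u = (normSq U φ u).toReal := by
  rw [normSq_eq_lintegral]
  exact integral_eq_lintegral_of_nonneg_ae (sqDensity_nonneg hS u)
    (aestronglyMeasurable_wip hS hu hu)

theorem normSq_eq (hS : Setting U φ α a) {u : Space n → ℝ} (hu : MemL2 U φ u) :
    normSq U φ u = ENNReal.ofReal (wip U φ u u) := by
  rw [wip_self_eq hS hu.1, ENNReal.ofReal_toReal hu.2.ne]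

theorem wip_self_nonneg (hS : Setting U φ α a) (u : Space n → ℝ) : 0 ≤ wip U φ u u :=
  integral_nonneg_of_ae (sqDensity_nonneg hS u)

theorem abs_wip_density_le (hS : Setting U φ α a) {x : Space n} (hx : x ∈ U) (s t : ℝ) {δ : ℝ}
    (hδ : 0 < δ) : |φ x * s * t| ≤ δ * (φ x * s * s) + δ⁻¹ * (φ x * t * t) := by
  have hp := hS.poro.pos x hx
  have h2 : |s * t| ≤ δ * (s * s) + δ⁻¹ * (t * t) := by
    have h1 : 0 ≤ δ⁻¹ * (δ * |s| - |t|) ^ 2 := by positivity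
    have e : δ⁻¹ * (δ * |s| - |t|) ^ 2 = δ * (|s| * |s|) + δ⁻¹ * (|t| * |t|) - 2 * (|s| * |t|) := by
      field_simp
      ring
    rw [abs_mul]
    rw [e, abs_mul_abs_self, abs_mul_abs_self] at h1
    have := mul_nonneg (abs_nonneg s) (abs_nonneg t)
    linarith
  rw [mul_assoc, abs_mul, abs_of_pos hp]
  have := mul_le_mul_of_nonneg_left h2 hp.le
  linarith

theorem integrable_wip (hS : Setting U φ α a) {u v : Space n → ℝ} (hu : MemL2 U φ u)
    (hv : MemL2 U φ v) : Integrable (fun x => φ x * u x * v x) (volume.restrict U) := by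
  refine (((memL2_integrable hS hu).const_mul 1).add
    ((memL2_integrable hS hv).const_mul 1⁻¹)).mono' (aestronglyMeasurable_wip hS hu.1 hv.1) ?_
  filter_upwards [hS.ae_mem] with x hx
  exact abs_wip_density_le hS hx (u x) (v x) one_pos

theorem abs_wip_le (hS : Setting U φ α a) {u v : Space n → ℝ} (hu : MemL2 U φ u)
    (hv : MemL2 U φ v) {δ : ℝ} (hδ : 0 < δ) :
    |wip U φ u v| ≤ δ * wip U φ u u + δ⁻¹ * wip U φ v v := by
  have h1 := (memL2_integrable hS hu).const_mul δ
  have h2 := (memL2_integrable hS hv).const_mul δ⁻¹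
  have h := norm_integral_le_of_norm_le (f := fun x => φ x * u x * v x) (h1.add h2) (by
      filter_upwards [hS.ae_mem] with x hx
      exact abs_wip_density_le hS hx (u x) (v x) hδ)
  rw [Pi.add_def, integral_add h1 h2, integral_const_mul, integral_const_mul] at h
  exact h

theorem MemL2.add (hS : Setting U φ α a) {u v : Space n → ℝ} (hu : MemL2 U φ u)
    (hv : MemL2 U φ v) : MemL2 U φ (u + v) := by
  rw [memL2_iff hS (hu.1.add hv.1)]
  refine ((((memL2_integrable hS hu).add (integrable_wip hS hu hv)).add
    (integrable_wip hS hv hu)).add (memL2_integrable hS hv)).congr (.of_forall fun x => ?_)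
  simp only [Pi.add_apply]
  ring

theorem MemL2.const_smul (hS : Setting U φ α a) {u : Space n → ℝ} (hu : MemL2 U φ u) (c : ℝ) :
    MemL2 U φ (c • u) := by
  rw [memL2_iff hS (hu.1.const_smul c)]
  refine ((memL2_integrable hS hu).const_mul (c ^ 2)).congr (.of_forall fun x => ?_)
  simp only [Pi.smul_apply, smul_eq_mul]
  ring

theorem MemL2.sub (hS : Setting U φ α a) {u v : Space n → ℝ} (hu : MemL2 U φ u)
    (hv : MemL2 U φ v) : MemL2 U φ (u - v) := by
  have h := hu.add hS (hv.const_smul hS (-1))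
  rwa [neg_one_smul, ← sub_eq_add_neg] at h

theorem wip_comm (u v : Space n → ℝ) : wip U φ u v = wip U φ v u := by
  simp only [wip, mul_right_comm]

theorem wip_sub (hS : Setting U φ α a) {u v w : Space n → ℝ} (hu : MemL2 U φ u)
    (hv : MemL2 U φ v) (hw : MemL2 U φ w) :
    wip U φ u (v - w) = wip U φ u v - wip U φ u w := by
  rw [wip, wip, wip, ← integral_sub (integrable_wip hS hu hv) (integrable_wip hS hu hw)]
  simp only [Pi.sub_apply, mul_sub]

theorem wip_smul (u v : Space n → ℝ) (c : ℝ) : wip U φ u (c • v) = c * wip U φ u v := by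
  rw [wip, wip, ← integral_const_mul]
  simp only [Pi.smul_apply, smul_eq_mul, mul_left_comm]

theorem wip_sub_self (hS : Setting U φ α a) {u v : Space n → ℝ} (hu : MemL2 U φ u)
    (hv : MemL2 U φ v) :
    wip U φ (u - v) (u - v) = wip U φ u u - 2 * wip U φ u v + wip U φ v v := by
  rw [wip_sub hS (hu.sub hS hv) hu hv, wip_comm (u - v) u, wip_comm (u - v) v,
    wip_sub hS hu hu hv, wip_sub hS hv hu hv, wip_comm v u]
  ring

theorem wip_sub_self_le (hS : Setting U φ α a) {u v : Space n → ℝ} (hu : MemL2 U φ u)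
    (hv : MemL2 U φ v) :
    wip U φ (u - v) (u - v) ≤ 2 * (wip U φ u u + wip U φ v v) := by
  rw [wip_sub_self hS hu hv]
  have := abs_le.1 (abs_wip_le hS hu hv one_pos)
  rw [inv_one] at this
  -- The constant 2 uses ‖u + v‖² ≥ 0, with u + v written as u - (-1) • v so that the expansion of a
  -- difference applies.
  nlinarith [wip_self_nonneg hS u, wip_self_nonneg hS v, wip_sub_self hS hu (hv.const_smul hS (-1)),
    wip_self_nonneg hS (u - (-1 : ℝ) • v), wip_smul (U := U) (φ := φ) u v (-1),
    wip_smul (U := U) (φ := φ) ((-1 : ℝ) • v) v (-1), wip_comm (U := U) (φ := φ) ((-1 : ℝ) • v) v,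
    wip_smul (U := U) (φ := φ) v v (-1)]

/-! ### Limits of pairings -/

/-- Fix δ with δA < ε/2 first, then wait until δ⁻¹e is small. -/
theorem tendsto_of_young {ι : Type*} {l : Filter ι} {u e : ι → ℝ} {L A : ℝ}
    (he : Tendsto e l (𝓝 0))
    (h : ∀ δ : ℝ, 0 < δ → δ ≤ 1 → ∀ᶠ k in l, |u k - L| ≤ δ * A + δ⁻¹ * e k) :
    Tendsto u l (𝓝 L) := by
  rw [Metric.tendsto_nhds]
  intro ε hε
  have hA : 0 < 2 * (|A| + 1) := by positivity
  set δ := min 1 (ε / (2 * (|A| + 1))) with hδ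
  have hδ0 : 0 < δ := lt_min one_pos (div_pos hε hA)
  have h1 : δ * A < ε / 2 := by
    have h2 : δ ≤ ε / (2 * (|A| + 1)) := min_le_right _ _
    calc δ * A ≤ δ * |A| := mul_le_mul_of_nonneg_left (le_abs_self A) hδ0.le
      _ < δ * (|A| + 1) := mul_lt_mul_of_pos_left (lt_add_one _) hδ0
      _ ≤ ε / (2 * (|A| + 1)) * (|A| + 1) := by gcongr
      _ = ε / 2 := by field_simp
  have h3 : ∀ᶠ k in l, δ⁻¹ * e k < ε / 2 := by
    have : Tendsto (fun k => δ⁻¹ * e k) l (𝓝 0) := by simpa using he.const_mul δ⁻¹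
    exact this.eventually_lt_const (by linarith)
  filter_upwards [h δ hδ0 (min_le_left _ _), h3] with k hk hk'
  rw [Real.dist_eq]
  linarith

theorem tendsto_en {ι : Type*} {l : Filter ι} {r : ι → Space n → Space n}
    (h : Tendsto (fun k => energy U α a (r k)) l (𝓝 0)) :
    Tendsto (fun k => en U α a (r k)) l (𝓝 0) :=
  (ENNReal.tendsto_toReal ENNReal.zero_ne_top).comp h

theorem tendsto_pair (hS : Setting U φ α a) {ι : Type*} {l : Filter ι}
    {q w : Space n → Space n} {v : ι → Space n → Space n} (hq : FinEnergy U α a q)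
    (hw : FinEnergy U α a w) (hv : ∀ᶠ k in l, AEStronglyMeasurable (v k) (volume.restrict U))
    (h : Tendsto (fun k => energy U α a (v k - w)) l (𝓝 0)) :
    Tendsto (fun k => pair U α a q (v k)) l (𝓝 (pair U α a q w)) := by
  refine tendsto_of_young (A := en U α a q) (tendsto_en h) fun δ hδ hδ1 => ?_
  filter_upwards [hv, h.eventually_lt_const ENNReal.zero_lt_top] with k hk hk'
  have hf : FinEnergy U α a (v k - w) := ⟨hk.sub hw.meas, hk'⟩
  have hf' : FinEnergy U α a (v k) := by
    have := (hf.add_and_le hS hw).1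
    rwa [sub_add_cancel] at this
  rw [← pair_sub hS hq hf' hw]
  exact abs_pair_le hS hq hf hδ hδ1

theorem tendsto_wip (hS : Setting U φ α a) {ι : Type*} {l : Filter ι}
    {f w : Space n → ℝ} {v : ι → Space n → ℝ} (hf : MemL2 U φ f)
    (hw : MemL2 U φ w) (hv : ∀ᶠ k in l, AEStronglyMeasurable (v k) (volume.restrict U))
    (h : Tendsto (fun k => normSq U φ (v k - w)) l (𝓝 0)) :
    Tendsto (fun k => wip U φ f (v k)) l (𝓝 (wip U φ f w)) := by
  refine tendsto_of_young (A := wip U φ f f)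
    ((ENNReal.tendsto_toReal ENNReal.zero_ne_top).comp h) fun δ hδ hδ1 => ?_
  filter_upwards [hv, h.eventually_lt_const ENNReal.zero_lt_top] with k hk hk'
  have hf1 : MemL2 U φ (v k - w) := ⟨hk.sub hw.1, hk'⟩
  have hf' : MemL2 U φ (v k) := by
    have := hf1.add hS hw
    rwa [sub_add_cancel] at this
  rw [← wip_sub hS hf hf' hw, Function.comp_apply, ← wip_self_eq hS hf1.1]
  exact abs_wip_le hS hf hf1 hδ

end Functional

/-! ### Weak gradients -/

section WeakGradient

variable {n : ℕ} {U : Set (Space n)}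

theorem IsTest.continuous_gradient {η : Space n → ℝ} (hη : IsTest U η) :
    Continuous (gradient η) :=
  (InnerProductSpace.toDual ℝ (Space n)).symm.continuous.comp
    (hη.smooth.continuous_fderiv (by simp))

theorem IsTest.gradient_eq_zero {η : Space n → ℝ} {x : Space n} (hx : x ∉ tsupport η) :
    gradient η x = 0 := by
  have h : fderiv ℝ η x = 0 :=
    image_eq_zero_of_notMem_tsupport fun h => hx (tsupport_fderiv_subset ℝ h)
  rw [gradient, h, map_zero]

theorem IsTest.integrable_smul {η : Space n → ℝ} (hη : IsTest U η) {q : Space n → Space n}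
    (hq : LocallyIntegrableOn q U) : Integrable (fun x => η x • q x) := by
  have h : IntegrableOn (fun x => η x • q x) (tsupport η) :=
    (hq.integrableOn_compact_subset hη.support hη.compact).continuousOn_smul
      hη.smooth.continuous.continuousOn hη.compact
  rwa [integrableOn_iff_integrable_of_support_subset] at h
  intro x hx
  by_contra hx'
  exact hx (by simp [image_eq_zero_of_notMem_tsupport hx'])

theorem IsTest.integrable_smul_gradient {η : Space n → ℝ} (hη : IsTest U η) {u : Space n → ℝ}
    (hu : LocallyIntegrableOn u U) : Integrable (fun x => u x • gradient η x) := by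
  have h : IntegrableOn (fun x => u x • gradient η x) (tsupport η) :=
    (hu.integrableOn_compact_subset hη.support hη.compact).smul_continuousOn
      hη.continuous_gradient.continuousOn hη.compact
  rwa [integrableOn_iff_integrable_of_support_subset] at h
  intro x hx
  by_contra hx'
  exact hx (by simp [IsTest.gradient_eq_zero hx'])

theorem HasWeakGrad.sub {u v : Space n → ℝ} {q r : Space n → Space n} (hu : HasWeakGrad U u q)
    (hv : HasWeakGrad U v r) : HasWeakGrad U (u - v) (q - r) where
  locInt := hu.locInt.sub hv.locInt
  locInt_grad := hu.locInt_grad.sub hv.locInt_grad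
  parts η hη := by
    simp only [Pi.sub_apply, sub_smul, smul_sub]
    rw [integral_sub (hη.integrable_smul_gradient hu.locInt).integrableOn
      (hη.integrable_smul_gradient hv.locInt).integrableOn,
      integral_sub (hη.integrable_smul hu.locInt_grad).integrableOn
      (hη.integrable_smul hv.locInt_grad).integrableOn, hu.parts η hη, hv.parts η hη]
    abel

/-- By the fundamental lemma of the calculus of variations. Since `weakGrad` is a choice, this
uniqueness is the only route to its linearity. -/
theorem HasWeakGrad.ae_eq (hU : IsOpen U) {u : Space n → ℝ} {q r : Space n → Space n}
    (hq : HasWeakGrad U u q) (hr : HasWeakGrad U u r) : q =ᵐ[volume.restrict U] r := by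
  have h : ∀ᵐ x, x ∈ U → (q - r) x = 0 := by
    refine hU.ae_eq_zero_of_integral_contDiff_smul_eq_zero
      (hq.locInt_grad.sub hr.locInt_grad) fun η h1 h2 h3 => ?_
    have hη : IsTest U η := ⟨h1, h2, h3⟩
    rw [← setIntegral_eq_integral_of_forall_compl_eq_zero (s := U) fun x hx => by
      rw [image_eq_zero_of_notMem_tsupport fun h => hx (h3 h), zero_smul]]
    simp only [Pi.sub_apply, smul_sub]
    rw [integral_sub (hη.integrable_smul hq.locInt_grad).integrableOn
      (hη.integrable_smul hr.locInt_grad).integrableOn, sub_eq_zero, ← neg_inj,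
      ← hq.parts η hη, ← hr.parts η hη]
  filter_upwards [(ae_restrict_iff' hU.measurableSet).2 h] with x hx
  exact sub_eq_zero.1 hx

theorem weakGrad_sub (hU : IsOpen U) {u v : Space n → ℝ} (hu : ∃ q, HasWeakGrad U u q)
    (hv : ∃ q, HasWeakGrad U v q) :
    weakGrad U (u - v) =ᵐ[volume.restrict U] weakGrad U u - weakGrad U v := by
  have h := (hasWeakGrad_weakGrad hu).sub (hasWeakGrad_weakGrad hv)
  exact (hasWeakGrad_weakGrad ⟨_, h⟩).ae_eq hU h

end WeakGradient

/-! ### Curves in `L²_φ` and in the energy class -/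

section Curves

variable {n N : ℕ} {U : Set (Space n)} {φ : Space n → ℝ} {α : Fin (N + 1) → ℝ}
  {a : Fin (N + 1) → Space n → ℝ}

theorem normSq_sub_le (hS : Setting U φ α a) {u v : Space n → ℝ}
    (hu : AEStronglyMeasurable u (volume.restrict U))
    (hv : AEStronglyMeasurable v (volume.restrict U)) :
    normSq U φ (u - v) ≤ 2 * (normSq U φ u + normSq U φ v) := by
  by_cases h : normSq U φ u + normSq U φ v < ⊤
  · obtain ⟨h1, h2⟩ := ENNReal.add_lt_top.1 h
    have hu' : MemL2 U φ u := ⟨hu, h1⟩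
    have hv' : MemL2 U φ v := ⟨hv, h2⟩
    rw [normSq_eq hS hu', normSq_eq hS hv', normSq_eq hS (hu'.sub hS hv'),
      ← ENNReal.ofReal_add (wip_self_nonneg hS u) (wip_self_nonneg hS v),
      ← ENNReal.ofReal_ofNat, ← ENNReal.ofReal_mul (by norm_num)]
    exact ENNReal.ofReal_le_ofReal (wip_sub_self_le hS hu' hv')
  · rw [not_lt_top_iff] at h
    rw [h, ENNReal.mul_top (by norm_num)]
    exact le_top

theorem energy_sub_le (hS : Setting U φ α a) {q r : Space n → Space n}
    (hq : AEStronglyMeasurable q (volume.restrict U))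
    (hr : AEStronglyMeasurable r (volume.restrict U)) :
    energy U α a (q - r) ≤ 4 * (energy U α a q + energy U α a r) := by
  by_cases h : energy U α a q + energy U α a r < ⊤
  · obtain ⟨h1, h2⟩ := ENNReal.add_lt_top.1 h
    have h3 := FinEnergy.sub_and_le hS ⟨hq, h1⟩ ⟨hr, h2⟩
    rw [← ENNReal.toReal_le_toReal h3.1.lt_top.ne (by finiteness), ENNReal.toReal_mul,
      ENNReal.toReal_add h1.ne h2.ne]
    exact h3.2
  · rw [not_lt_top_iff] at h
    rw [h, ENNReal.mul_top (by norm_num)]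
    exact le_top

theorem tendsto_zero_of_le_mul_add {ι : Type*} {l : Filter ι} {f g h : ι → ℝ≥0∞} {c : ℝ≥0∞}
    (hc : c ≠ ⊤) (hg : Tendsto g l (𝓝 0)) (hh : Tendsto h l (𝓝 0))
    (hle : ∀ᶠ k in l, f k ≤ c * (g k + h k)) : Tendsto f l (𝓝 0) := by
  have h1 : Tendsto (fun k => c * (g k + h k)) l (𝓝 0) := by
    have := ENNReal.Tendsto.const_mul (hg.add hh) (Or.inr hc)
    simpa using this
  exact tendsto_of_tendsto_of_tendsto_of_le_of_le' tendsto_const_nhds h1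
    (.of_forall fun _ => zero_le) hle

theorem HasTimeDeriv.tendsto {u : ℝ → Space n → ℝ} {t : ℝ} {w : Space n → ℝ}
    (h : HasTimeDeriv U φ u t w) :
    Tendsto (fun s => normSq U φ ((s - t)⁻¹ • (u s - u t) - w)) (𝓝[≠] t) (𝓝 0) := by
  refine h.2.congr fun s => ?_
  congr 1
  funext x
  simp [div_eq_inv_mul]

theorem eventually_punctured_pos {t : ℝ} (ht : 0 < t) : ∀ᶠ s in 𝓝[≠] t, 0 < s ∧ s - t ≠ 0 := by
  filter_upwards [eventually_nhdsWithin_of_eventually_nhds (lt_mem_nhds ht),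
    self_mem_nhdsWithin] with s h1 h2
  exact ⟨h1, sub_ne_zero.2 h2⟩

theorem HasTimeDeriv.sub (hS : Setting U φ α a) {u v : ℝ → Space n → ℝ} {t : ℝ}
    {w z : Space n → ℝ} (ht : 0 < t)
    (hum : ∀ s, 0 < s → AEStronglyMeasurable (u s) (volume.restrict U))
    (hvm : ∀ s, 0 < s → AEStronglyMeasurable (v s) (volume.restrict U))
    (hu : HasTimeDeriv U φ u t w) (hv : HasTimeDeriv U φ v t z) :
    HasTimeDeriv U φ (u - v) t (w - z) := by
  refine ⟨hu.1.sub hS hv.1, ?_⟩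
  refine tendsto_zero_of_le_mul_add (c := 2) (by simp) hu.tendsto hv.tendsto ?_
  filter_upwards [eventually_punctured_pos ht] with s hs
  have h := normSq_sub_le hS
    ((((hum s hs.1).sub (hum t ht)).const_smul (s - t)⁻¹).sub hu.1.1)
    ((((hvm s hs.1).sub (hvm t ht)).const_smul (s - t)⁻¹).sub hv.1.1)
  refine le_trans (le_of_eq ?_) h
  congr 1
  funext x
  simp only [Pi.sub_apply, Pi.smul_apply, smul_eq_mul, div_eq_inv_mul]
  ring

/-- The limit of the difference quotients is unique in the weighted norm, and φ > 0 on U turns a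
vanishing norm into equality almost everywhere. -/
theorem HasTimeDeriv.ae_eq (hS : Setting U φ α a) {u : ℝ → Space n → ℝ} {t : ℝ}
    {w z : Space n → ℝ} (ht : 0 < t)
    (hum : ∀ s, 0 < s → AEStronglyMeasurable (u s) (volume.restrict U))
    (hw : HasTimeDeriv U φ u t w) (hz : HasTimeDeriv U φ u t z) :
    w =ᵐ[volume.restrict U] z := by
  have h1 : Tendsto (fun _ : ℝ => normSq U φ (w - z)) (𝓝[≠] t) (𝓝 0) := by
    refine tendsto_zero_of_le_mul_add (c := 2) (by simp) hz.tendsto hw.tendsto ?_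
    filter_upwards [eventually_punctured_pos ht] with s hs
    have hm := ((hum s hs.1).sub (hum t ht)).const_smul (s - t)⁻¹
    refine le_trans (le_of_eq ?_) (normSq_sub_le hS (hm.sub hz.1.1) (hm.sub hw.1.1))
    rw [sub_sub_sub_cancel_left]
  have h2 : normSq U φ (w - z) = 0 := tendsto_nhds_unique tendsto_const_nhds h1
  have hm : MemL2 U φ (w - z) := hw.1.sub hS hz.1
  have h3 : wip U φ (w - z) (w - z) = 0 := by rw [wip_self_eq hS hm.1, h2, ENNReal.toReal_zero]
  have h4 := (integral_eq_zero_iff_of_nonneg_ae (sqDensity_nonneg hS _)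
    (memL2_integrable hS hm)).1 h3
  filter_upwards [h4, hS.ae_mem] with x hx hxU
  have hp := hS.poro.pos x hxU
  have : φ x * (w - z) x * (w - z) x = 0 := hx
  rw [mul_assoc, mul_eq_zero, mul_self_eq_zero] at this
  exact sub_eq_zero.1 (this.resolve_left hp.ne')

/-- A differentiable curve `v` in `L²_φ`, with derivative `v'`. -/
structure L2Curve (U : Set (Space n)) (φ : Space n → ℝ) (v v' : ℝ → Space n → ℝ) : Prop where
  mem : ∀ t, 0 < t → MemL2 U φ (v t)
  deriv : ∀ t, 0 < t → HasTimeDeriv U φ v t (v' t)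

/-- A curve `q` of fields of finite energy that is differentiable in energy, with derivative
`q'`. -/
structure EnCurve (U : Set (Space n)) (α : Fin (N + 1) → ℝ) (a : Fin (N + 1) → Space n → ℝ)
    (q q' : ℝ → Space n → Space n) : Prop where
  fin : ∀ t, 0 < t → FinEnergy U α a (q t)
  meas_deriv : ∀ t, 0 < t → AEStronglyMeasurable (q' t) (volume.restrict U)
  deriv : ∀ t, 0 < t → Tendsto (fun s => energy U α a ((s - t)⁻¹ • (q s - q t) - q' t))
    (𝓝[≠] t) (𝓝 0)

theorem L2Curve.sub (hS : Setting U φ α a) {u u' v v' : ℝ → Space n → ℝ}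
    (hu : L2Curve U φ u u') (hv : L2Curve U φ v v') : L2Curve U φ (u - v) (u' - v') where
  mem t ht := (hu.mem t ht).sub hS (hv.mem t ht)
  deriv t ht := HasTimeDeriv.sub hS ht (fun s hs => (hu.mem s hs).1)
    (fun s hs => (hv.mem s hs).1) (hu.deriv t ht) (hv.deriv t ht)

theorem EnCurve.eventually_fin (hS : Setting U φ α a) {q q' : ℝ → Space n → Space n}
    (hq : EnCurve U α a q q') {t : ℝ} (ht : 0 < t) :
    ∀ᶠ s in 𝓝[≠] t, 0 < s ∧ s - t ≠ 0 ∧ FinEnergy U α a ((s - t)⁻¹ • (q s - q t)) ∧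
      FinEnergy U α a ((s - t)⁻¹ • (q s - q t) - q' t) := by
  filter_upwards [eventually_punctured_pos ht,
    (hq.deriv t ht).eventually_lt_const ENNReal.zero_lt_top] with s h1 h2
  have h3 := (((hq.fin s h1.1).sub_and_le hS (hq.fin t ht)).1.smul_and_le hS (s - t)⁻¹).1
  exact ⟨h1.1, h1.2, h3, h3.meas.sub (hq.meas_deriv t ht), h2⟩

/-- Finite energy of the derivative follows from one nearby time: q' is the difference quotient
minus its error, and both have finite energy. -/
theorem EnCurve.fin_deriv (hS : Setting U φ α a) {q q' : ℝ → Space n → Space n}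
    (hq : EnCurve U α a q q') {t : ℝ} (ht : 0 < t) : FinEnergy U α a (q' t) := by
  obtain ⟨s, -, -, h1, h2⟩ := (hq.eventually_fin hS ht).exists
  have := (h1.sub_and_le hS h2).1
  rwa [sub_sub_cancel] at this

theorem EnCurve.sub (hS : Setting U φ α a) {q q' r r' : ℝ → Space n → Space n}
    (hq : EnCurve U α a q q') (hr : EnCurve U α a r r') : EnCurve U α a (q - r) (q' - r') where
  fin t ht := ((hq.fin t ht).sub_and_le hS (hr.fin t ht)).1
  meas_deriv t ht := (hq.meas_deriv t ht).sub (hr.meas_deriv t ht)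
  deriv t ht := by
    refine tendsto_zero_of_le_mul_add (c := 4) (by simp) (hq.deriv t ht) (hr.deriv t ht) ?_
    filter_upwards [hq.eventually_fin hS ht, hr.eventually_fin hS ht] with s h1 h2
    refine le_trans (le_of_eq ?_) (energy_sub_le hS h1.2.2.2.meas h2.2.2.2.meas)
    congr 1
    simp only [Pi.sub_apply, smul_sub]
    abel

/-- The upper left derivative of `f` at `t` is at most `c`. -/
def LeftSlopeLE (f : ℝ → ℝ) (t c : ℝ) : Prop :=
  ∀ ε, 0 < ε → ∀ᶠ s in 𝓝[<] t, f t - f s ≤ (c + ε) * (t - s)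

theorem LeftSlopeLE.add {f g : ℝ → ℝ} {t c d : ℝ} (hf : LeftSlopeLE f t c)
    (hg : LeftSlopeLE g t d) : LeftSlopeLE (fun s => f s + g s) t (c + d) := by
  intro ε hε
  filter_upwards [hf (ε / 2) (by linarith), hg (ε / 2) (by linarith)] with s h1 h2
  linarith

theorem LeftSlopeLE.mono {f : ℝ → ℝ} {t c d : ℝ} (hf : LeftSlopeLE f t c) (h : c ≤ d) :
    LeftSlopeLE f t d := by
  intro ε hε
  filter_upwards [hf ε hε, self_mem_nhdsWithin] with s h1 h2
  have : s < t := h2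
  nlinarith

/-- Convexity supplies the inequality, with d s the derivative of the functional at time t applied
to the difference quotient. For s < t the factor t - s is positive, so the limit of d bounds the
left slope. -/
theorem leftSlopeLE_of_tendsto {f : ℝ → ℝ} {t c : ℝ} {d : ℝ → ℝ} (hd : Tendsto d (𝓝[≠] t) (𝓝 c))
    (h : ∀ᶠ s in 𝓝[≠] t, f t - f s ≤ (t - s) * d s) : LeftSlopeLE f t c := by
  intro ε hε
  have h0 : ∀ᶠ s in 𝓝[≠] t, f t - f s ≤ (t - s) * d s ∧ d s < c + ε :=
    h.and (hd.eventually_lt_const (by linarith))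
  have hle : 𝓝[<] t ≤ 𝓝[≠] t := nhdsWithin_mono t fun s hs => ne_of_lt hs
  filter_upwards [hle h0, self_mem_nhdsWithin] with s h1 h2
  have h3 : s < t := h2
  nlinarith [h1.1, h1.2]

theorem L2Curve.eventually_mem (hS : Setting U φ α a) {v v' : ℝ → Space n → ℝ}
    (hv : L2Curve U φ v v') {t : ℝ} (ht : 0 < t) :
    ∀ᶠ s in 𝓝[≠] t, s - t ≠ 0 ∧ MemL2 U φ (v s) ∧ MemL2 U φ ((s - t)⁻¹ • (v s - v t)) := by
  filter_upwards [eventually_punctured_pos ht] with s hs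
  exact ⟨hs.2, hv.mem s hs.1, ((hv.mem s hs.1).sub hS (hv.mem t ht)).const_smul hS _⟩

theorem L2Curve.tendsto_wip (hS : Setting U φ α a) {v v' : ℝ → Space n → ℝ}
    (hv : L2Curve U φ v v') {t : ℝ} (ht : 0 < t) {f : Space n → ℝ} (hf : MemL2 U φ f) :
    Tendsto (fun s => wip U φ f ((s - t)⁻¹ • (v s - v t))) (𝓝[≠] t) (𝓝 (wip U φ f (v' t))) :=
  Forchheimer.tendsto_wip hS hf (hv.deriv t ht).1
    ((hv.eventually_mem hS ht).mono fun _ h => h.2.2.1) (hv.deriv t ht).tendsto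

/-- From ‖v t - v s‖² ≥ 0 comes ‖v t‖² - ‖v s‖² ≤ 2⟨v t, v t - v s⟩. -/
theorem L2Curve.leftSlope (hS : Setting U φ α a) {v v' : ℝ → Space n → ℝ}
    (hv : L2Curve U φ v v') {t : ℝ} (ht : 0 < t) :
    LeftSlopeLE (fun s => wip U φ (v s) (v s)) t (2 * wip U φ (v t) (v' t)) := by
  refine leftSlopeLE_of_tendsto ((hv.tendsto_wip hS ht (hv.mem t ht)).const_mul 2) ?_
  filter_upwards [hv.eventually_mem hS ht] with s hs
  have h := wip_self_nonneg hS (v t - v s)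
  rw [wip_sub_self hS (hv.mem t ht) hs.2.1] at h
  rw [wip_smul, wip_sub hS (hv.mem t ht) hs.2.1 (hv.mem t ht)]
  have e : (t - s) * (2 * ((s - t)⁻¹ * (wip U φ (v t) (v s) - wip U φ (v t) (v t))))
      = 2 * (wip U φ (v t) (v t) - wip U φ (v t) (v s)) := by
    have := hs.1
    field_simp
    ring
  rw [e]
  linarith

theorem L2Curve.continuousAt (hS : Setting U φ α a) {v v' : ℝ → Space n → ℝ}
    (hv : L2Curve U φ v v') {t : ℝ} (ht : 0 < t) :
    ContinuousAt (fun s => wip U φ (v s) (v s)) t := by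
  rw [continuousAt_iff_punctured_nhds]
  set d : ℝ → Space n → ℝ := fun s => (s - t)⁻¹ • (v s - v t) with hd
  have hw := (hv.deriv t ht).1
  have h1 : Tendsto (fun s => wip U φ (v t) (d s)) _ _ := hv.tendsto_wip hS ht (hv.mem t ht)
  have h2 : Tendsto (fun s => wip U φ (v' t) (d s)) _ _ := hv.tendsto_wip hS ht hw
  have h3 : Tendsto (fun s => wip U φ (d s - v' t) (d s - v' t)) (𝓝[≠] t) (𝓝 0) := by
    refine ((ENNReal.tendsto_toReal ENNReal.zero_ne_top).comp
      (hv.deriv t ht).tendsto).congr' ?_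
    filter_upwards [hv.eventually_mem hS ht] with s hs
    exact (wip_self_eq hS (hs.2.2.1.sub hw.1)).symm
  have hst : Tendsto (fun s : ℝ => s - t) (𝓝[≠] t) (𝓝 0) := by
    have : Tendsto (fun s : ℝ => s - t) (𝓝 t) (𝓝 (t - t)) :=
      (continuous_id.sub continuous_const).tendsto t
    rw [sub_self] at this
    exact this.mono_left nhdsWithin_le_nhds
  have h4 := (hst.mul (h1.const_mul 2)).add ((hst.mul hst).mul
    ((h3.add (h2.const_mul 2)).sub_const (wip U φ (v' t) (v' t))))
  -- This is the expansion of ‖v t + (s - t) d s‖², where ‖d‖² = ‖d - v'‖² + 2⟨v',d⟩ - ‖v'‖²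
  -- converges.
  have h5 := h4.const_add (wip U φ (v t) (v t))
  simp only [zero_mul, add_zero] at h5
  refine h5.congr' ?_
  filter_upwards [hv.eventually_mem hS ht] with s hs
  have e : v s = v t - (t - s) • d s := by
    rw [hd]
    simp only
    rw [smul_smul, ← neg_sub s t, neg_mul, mul_inv_cancel₀ hs.1]
    simp
  have md : MemL2 U φ (d s) := hs.2.2
  have e2 := wip_sub_self hS md hw
  have e3 := wip_sub_self hS (hv.mem t ht) (md.const_smul hS (t - s))
  have e4 : wip U φ ((t - s) • d s) ((t - s) • d s) = (t - s) * ((t - s) * wip U φ (d s) (d s)) := by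
    rw [wip_smul, wip_comm, wip_smul]
  have e5 := wip_smul (U := U) (φ := φ) (v t) (d s) (t - s)
  rw [e, e3, e4, e5, e2, wip_comm (v' t) (d s)]
  ring

theorem EnCurve.tendsto_pair (hS : Setting U φ α a) {q q' : ℝ → Space n → Space n}
    (hq : EnCurve U α a q q') {t : ℝ} (ht : 0 < t) {r : Space n → Space n}
    (hr : FinEnergy U α a r) :
    Tendsto (fun s => pair U α a r ((s - t)⁻¹ • (q s - q t))) (𝓝[≠] t)
      (𝓝 (pair U α a r (q' t))) :=
  Forchheimer.tendsto_pair hS hr (hq.fin_deriv hS ht)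
    ((hq.eventually_fin hS ht).mono fun _ h => h.2.2.1.meas) (hq.deriv t ht)

/-- The potential energy `∫ h(x,|q|)`. -/
noncomputable def pot (U : Set (Space n)) (α : Fin (N + 1) → ℝ) (a : Fin (N + 1) → Space n → ℝ)
    (q : Space n → Space n) : ℝ :=
  ∫ x in U, potential α a x ‖q x‖

theorem integrable_potential (hS : Setting U φ α a) {q : Space n → Space n}
    (hq : FinEnergy U α a q) :
    Integrable (fun x => potential α a x ‖q x‖) (volume.restrict U) := by
  refine (hq.integrable hS).mono' ?_ ?_
  · have hn := hq.meas.norm.aemeasurable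
    have hr := aemeasurable_root hS hn fun _ => norm_nonneg _
    unfold potential
    exact ((hr.mul hn).sub (Finset.aemeasurable_fun_sum _ fun i _ =>
      (hS.coeff.measurable i).mul ((hr.pow_const _).div_const _))).aestronglyMeasurable
  · filter_upwards [hS.ae_mem] with x hx
    have h1 := le_potential hS.exps hS.coeff hx (norm_nonneg (q x))
    have h2 := K_mul_sq_nonneg hS.exps hS.coeff hx (norm_nonneg (q x))
    rw [Real.norm_of_nonneg (by linarith)]
    exact potential_le hS.exps hS.coeff hx (norm_nonneg (q x))

theorem pot_le_en (hS : Setting U φ α a) {q : Space n → Space n} (hq : FinEnergy U α a q) :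
    pot U α a q ≤ en U α a q := by
  rw [en_eq hS hq.meas]
  refine integral_mono_ae (integrable_potential hS hq) (hq.integrable hS) ?_
  filter_upwards [hS.ae_mem] with x hx
  exact potential_le hS.exps hS.coeff hx (norm_nonneg (q x))

theorem en_le_pot (hS : Setting U φ α a) {q : Space n → Space n} (hq : FinEnergy U α a q) :
    en U α a q ≤ 2 * pot U α a q := by
  rw [en_eq hS hq.meas, pot, ← integral_const_mul]
  refine integral_mono_ae (hq.integrable hS) ((integrable_potential hS hq).const_mul 2) ?_
  filter_upwards [hS.ae_mem] with x hx
  exact le_potential hS.exps hS.coeff hx (norm_nonneg (q x))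

theorem pot_sub_le (hS : Setting U φ α a) {q r : Space n → Space n} (hq : FinEnergy U α a q)
    (hr : FinEnergy U α a r) : pot U α a q - pot U α a r ≤ pair U α a q (q - r) := by
  rw [pot, pot, ← integral_sub (integrable_potential hS hq) (integrable_potential hS hr)]
  refine integral_mono_ae ((integrable_potential hS hq).sub (integrable_potential hS hr))
    (integrable_pair hS hq (hq.sub_and_le hS hr).1) ?_
  filter_upwards [hS.ae_mem] with x hx
  exact potential_norm_sub_le hS.exps hS.coeff hx (q x) (r x)

/-- The tangent inequality `pot_sub_le` at q t involves only the fixed flux of q t, so convergence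
of the difference quotients in energy suffices. -/
theorem EnCurve.leftSlope (hS : Setting U φ α a) {q q' : ℝ → Space n → Space n}
    (hq : EnCurve U α a q q') {t : ℝ} (ht : 0 < t) :
    LeftSlopeLE (fun s => pot U α a (q s)) t (pair U α a (q t) (q' t)) := by
  refine leftSlopeLE_of_tendsto (hq.tendsto_pair hS ht (hq.fin t ht)) ?_
  filter_upwards [hq.eventually_fin hS ht] with s hs
  refine (pot_sub_le hS (hq.fin t ht) (hq.fin s hs.1)).trans (le_of_eq ?_)
  rw [← pair_smul, smul_smul, ← neg_sub s t, neg_mul, mul_inv_cancel₀ hs.2.1, neg_one_smul,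
    neg_sub]

theorem EnCurve.continuousAt (hS : Setting U φ α a) {q q' : ℝ → Space n → Space n}
    (hq : EnCurve U α a q q') {t : ℝ} (ht : 0 < t) :
    ContinuousAt (fun s => pot U α a (q s)) t := by
  rw [continuousAt_iff_punctured_nhds]
  have hst : Tendsto (fun s : ℝ => |s - t| + (s - t) ^ 2) (𝓝[≠] t) (𝓝 0) := by
    have h : Continuous fun s : ℝ => |s - t| + (s - t) ^ 2 := by fun_prop
    have := h.tendsto t
    simp only [sub_self, abs_zero, ne_eq, OfNat.ofNat_ne_zero, not_false_eq_true, zero_pow,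
      add_zero] at this
    exact this.mono_left nhdsWithin_le_nhds
  have h1 := hst.mul (((tendsto_en (hq.deriv t ht)).add_const (en U α a (q' t))).const_mul 4)
  rw [zero_mul] at h1
  -- Here q s - q t is (s - t) times a quotient whose energy stays bounded, and scaling contributes
  -- |s - t| + (s - t)².
  have he : Tendsto (fun s => en U α a (q s - q t)) (𝓝[≠] t) (𝓝 0) := by
    refine tendsto_of_tendsto_of_tendsto_of_le_of_le' tendsto_const_nhds h1
      (.of_forall fun _ => en_nonneg _) ?_
    filter_upwards [hq.eventually_fin hS ht] with s hs
    have h2 := (hs.2.2.1.smul_and_le hS (s - t)).2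
    rw [smul_smul, mul_inv_cancel₀ hs.2.1, one_smul] at h2
    have h3 := (hs.2.2.2.add_and_le hS (hq.fin_deriv hS ht)).2
    rw [sub_add_cancel] at h3
    exact h2.trans (mul_le_mul_of_nonneg_left h3 (by positivity))
  -- Convexity at both end points bounds the increment from both sides. Once the energy of q s - q t
  -- is at most 1, that of q s is at most 4 + 4 en(q t), so A dominates the energies of q s and q t.
  refine tendsto_of_young (A := 5 * en U α a (q t) + 4) he fun δ hδ hδ1 => ?_
  filter_upwards [hq.eventually_fin hS ht, he.eventually_le_const one_pos] with s hs hs1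
  have hqt := hq.fin t ht
  have hqs := hq.fin s hs.1
  have hd := hqs.sub_and_le hS hqt
  have a1 := (abs_le.1 (abs_pair_le hS hqs hd.1 hδ hδ1)).2
  have a2 := (abs_le.1 (abs_pair_le hS hqt hd.1 hδ hδ1)).1
  have b1 := pot_sub_le hS hqs hqt
  have b2 := pot_sub_le hS hqt hqs
  rw [pair_sub hS hqt hqt hqs] at b2
  rw [pair_sub hS hqt hqs hqt] at a2
  have c1 := (hd.1.add_and_le hS hqt).2
  rw [sub_add_cancel] at c1
  have n1 := en_nonneg (U := U) (α := α) (a := a) (q t)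
  have n2 := en_nonneg (U := U) (α := α) (a := a) (q s)
  have d1 : δ * en U α a (q s) ≤ δ * (5 * en U α a (q t) + 4) := by
    gcongr
    linarith
  have d2 : δ * en U α a (q t) ≤ δ * (5 * en U α a (q t) + 4) := by
    gcongr
    linarith
  rw [abs_le]
  constructor <;> linarith

end Curves

/-! ### A comparison principle -/

section Comparison

/-- Continuous induction run backwards from c: the times τ with u c ≤ u (c - τ) form a closed set,
and the local hypothesis always extends it further to the left. -/
theorem le_of_eventually_le_left {u : ℝ → ℝ} {b c : ℝ} (hbc : b ≤ c)
    (hu : ContinuousOn u (Icc b c)) (h : ∀ t ∈ Ioc b c, ∀ᶠ s in 𝓝[<] t, u t ≤ u s) :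
    u c ≤ u b := by
  have hmaps : MapsTo (fun τ => c - τ) (Icc 0 (c - b)) (Icc b c) := fun τ hτ => by
    have h1 := hτ.1
    have h2 := hτ.2
    exact ⟨by linarith, by linarith⟩
  have hcont : ContinuousOn (fun τ => u (c - τ)) (Icc 0 (c - b)) :=
    hu.comp (continuous_const.sub continuous_id).continuousOn hmaps
  have hcl : IsClosed ({τ | u c ≤ u (c - τ)} ∩ Icc 0 (c - b)) := by
    have := hcont.preimage_isClosed_of_isClosed isClosed_Icc (isClosed_Ici (a := u c))
    rwa [inter_comm] at this
  have hsub := hcl.Icc_subset_of_forall_exists_gt (by simp) fun τ hτ y hy => by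
    have h1 : u c ≤ u (c - τ) := hτ.1
    have h2 := hτ.2.1
    have h3 := hτ.2.2
    have h4 : τ < y := hy
    have hev := h (c - τ) ⟨by linarith, by linarith⟩
    have hnear : ∀ᶠ s in 𝓝[<] (c - τ), c - y < s :=
      eventually_nhdsWithin_of_eventually_nhds (lt_mem_nhds (by linarith))
    obtain ⟨s, hs1, hs2, hs3⟩ := (hev.and (hnear.and self_mem_nhdsWithin)).exists
    have hs4 : s < c - τ := hs3
    refine ⟨c - s, ?_, by linarith, by linarith⟩
    change u c ≤ u (c - (c - s))
    rw [sub_sub_cancel]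
    linarith
  have := hsub (right_mem_Icc.2 (by linarith : 0 ≤ c - b))
  have h' : u c ≤ u (c - (c - b)) := this
  rwa [sub_sub_cancel] at h'

/-- While f exceeds Y, the function f + (δ/2)t is nonincreasing. Hence f ≥ 0 cannot stay above Y
forever, and once at or below Y it cannot rise above it again. -/
theorem eventually_le_of_leftSlope {f : ℝ → ℝ} {Y δ T : ℝ} (hδ : 0 < δ)
    (hcont : ∀ t, T < t → ContinuousAt f t) (hf : ∀ t, T < t → 0 ≤ f t)
    (h : ∀ t, T < t → Y < f t → LeftSlopeLE f t (-δ)) : ∀ᶠ t in atTop, f t ≤ Y := by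
  have key : ∀ b c, T < b → b ≤ c → (∀ t ∈ Ioc b c, Y < f t) →
      f c + δ / 2 * c ≤ f b + δ / 2 * b := by
    intro b c hb hbc hY
    refine le_of_eventually_le_left (u := fun t => f t + δ / 2 * t) hbc ?_ fun t ht => ?_
    · intro t ht
      exact ((hcont t (hb.trans_le ht.1)).add
        (continuousAt_const.mul continuousAt_id)).continuousWithinAt
    · filter_upwards [h t (hb.trans ht.1) (hY t ht) (δ / 2) (by linarith)] with s hs
      linarith
  by_cases hex : ∃ t₀, T < t₀ ∧ f t₀ ≤ Y
  · obtain ⟨t₀, hT, h₀⟩ := hex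
    filter_upwards [eventually_ge_atTop t₀] with t₁ ht₁
    by_contra! hlt
    have hcl : IsClosed (Icc t₀ t₁ ∩ f ⁻¹' Iic Y) :=
      ContinuousOn.preimage_isClosed_of_isClosed
        (fun t ht => (hcont t (hT.trans_le ht.1)).continuousWithinAt) isClosed_Icc isClosed_Iic
    -- The last time before t₁ at which f ≤ Y; after it, f decreases, contradicting f t₁ > Y.
    obtain ⟨m, hm, hmax⟩ := (isCompact_Icc.inter_right hcl |>.of_isClosed_subset hcl
      (fun t ht => ⟨ht.1, ht⟩)).exists_isGreatest ⟨t₀, left_mem_Icc.2 ht₁, h₀⟩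
    have hmY : f m ≤ Y := hm.2
    have := key m t₁ (hT.trans_le hm.1.1) hm.1.2 fun t ht => by
      by_contra! hle
      have := hmax (show t ∈ Icc t₀ t₁ ∩ f ⁻¹' Iic Y from ⟨⟨hm.1.1.trans ht.1.le, ht.2⟩, hle⟩)
      linarith [ht.1]
    have h2 := hm.1.2
    nlinarith
  · push Not at hex
    exfalso
    have hb : T < T + 1 := by linarith
    -- Late enough that a decrease at rate δ/2 would give f c ≤ -1.
    set c := T + 1 + 2 * (f (T + 1) + 1) / δ with hc
    have h0 := hf (T + 1) hb
    have hbc : T + 1 ≤ c := by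
      have : 0 ≤ 2 * (f (T + 1) + 1) / δ := by positivity
      linarith
    have h1 := key (T + 1) c hb hbc fun t ht => hex t (hb.trans ht.1)
    have h2 := hf c (hb.trans_le hbc)
    have h3 : δ / 2 * c = δ / 2 * (T + 1) + (f (T + 1) + 1) := by
      rw [hc]
      field_simp
    linarith

end Comparison

/-! ### Regular functions and solutions -/

section Solutions

variable {n N : ℕ} {U : Set (Space n)} {φ : Space n → ℝ} {α : Fin (N + 1) → ℝ}
  {a : Fin (N + 1) → Space n → ℝ}

theorem IsRegular.aestronglyMeasurable {u : ℝ → Space n → ℝ}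
    (hu : IsRegular U φ α a u) {t : ℝ} (ht : 0 < t) :
    AEStronglyMeasurable (u t) (volume.restrict U) :=
  (hasWeakGrad_weakGrad (hu.grad t ht)).locInt.aestronglyMeasurable

theorem IsRegular.enCurve {u : ℝ → Space n → ℝ} (hu : IsRegular U φ α a u) :
    EnCurve U α a (fun t => weakGrad U (u t)) (fun t => weakGrad U (timeDeriv U φ u t)) where
  fin t ht := ⟨(hasWeakGrad_weakGrad (hu.grad t ht)).locInt_grad.aestronglyMeasurable,
    hu.energy_lt_top t ht⟩
  meas_deriv t ht :=
    (hasWeakGrad_weakGrad (hu.grad_deriv t ht)).locInt_grad.aestronglyMeasurable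
  deriv t ht := hu.deriv_grad t ht

theorem IsRegular.hasTimeDeriv {u : ℝ → Space n → ℝ} (hu : IsRegular U φ α a u) {t : ℝ}
    (ht : 0 < t) : HasTimeDeriv U φ u t (timeDeriv U φ u t) :=
  hasTimeDeriv_timeDeriv (hu.deriv t ht)

theorem IsSolution.l2Curve (hS : Setting U φ α a) {Ψ p : ℝ → Space n → ℝ} {p₀ : Space n → ℝ}
    (hΨ : IsRegular U φ α a Ψ) (hp : IsSolution U φ α a Ψ p₀ p) :
    L2Curve U φ (p - Ψ) (fun t => timeDeriv U φ p t - timeDeriv U φ Ψ t) where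
  mem t ht := hp.memL2 t ht.le
  deriv _ ht := HasTimeDeriv.sub hS ht (fun _ hs => hp.regular.aestronglyMeasurable hs)
    (fun _ hs => hΨ.aestronglyMeasurable hs) (hp.regular.hasTimeDeriv ht) (hΨ.hasTimeDeriv ht)

/-- Both sides of the weak equation are continuous along the approximating test functions. Their
gradients eventually have finite energy, because r has, so the equation applies to them. -/
theorem IsSolution.test (hS : Setting U φ α a) {Ψ p : ℝ → Space n → ℝ} {p₀ : Space n → ℝ}
    (hp : IsSolution U φ α a Ψ p₀ p) {t : ℝ} (ht : 0 < t) {v : Space n → ℝ}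
    {r : Space n → Space n} (hv : MemL2 U φ v) (hr : FinEnergy U α a r)
    (hvr : weakGrad U v =ᵐ[volume.restrict U] r) (hb : VanishesOnBoundary U φ α a v) :
    wip U φ (timeDeriv U φ p t) v = - pair U α a (weakGrad U (p t)) r := by
  obtain ⟨η, hη, h1, h2⟩ := hb
  have hq := hp.regular.enCurve.fin t ht
  have h2' : Tendsto (fun k => energy U α a (gradient (η k) - r)) atTop (𝓝 0) := by
    refine h2.congr fun k => energy_congr ?_
    filter_upwards [hvr] with x hx
    simp [hx]
  have hm : ∀ k, AEStronglyMeasurable (gradient (η k)) (volume.restrict U) := fun k =>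
    (hη k).continuous_gradient.aestronglyMeasurable
  have t1 := tendsto_wip (l := atTop) (v := η) hS (hp.regular.hasTimeDeriv ht).1 hv
    (.of_forall fun k => (hη k).smooth.continuous.aestronglyMeasurable) h1
  have t2 := (tendsto_pair hS hq hr (.of_forall hm) h2').neg
  refine tendsto_nhds_unique t1 (t2.congr' ?_)
  filter_upwards [h2'.eventually_lt_const ENNReal.zero_lt_top] with k hk
  have h3 : FinEnergy U α a (gradient (η k) - r) := ⟨(hm k).sub hr.meas, hk⟩
  have h4 := (h3.add_and_le hS hr).1
  rw [sub_add_cancel] at h4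
  exact (hp.equation t ht (η k) (hη k) h4.lt_top).symm

/-- The equation at time t is tested with another solution at another time s: s ≠ t serves the
difference quotients, and p' ≠ p serves the comparison of two solutions. -/
theorem IsSolution.test_solution (hS : Setting U φ α a) {Ψ p Ψ' p' : ℝ → Space n → ℝ}
    {p₀ p₀' : Space n → ℝ} (hp : IsSolution U φ α a Ψ p₀ p) (hΨ' : IsRegular U φ α a Ψ')
    (hp' : IsSolution U φ α a Ψ' p₀' p') {t s : ℝ} (ht : 0 < t) (hs : 0 < s) :
    wip U φ (timeDeriv U φ p t) (p' s - Ψ' s)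
      = - pair U α a (weakGrad U (p t)) (weakGrad U (p' s) - weakGrad U (Ψ' s)) :=
  hp.test hS ht (hp'.memL2 s hs.le)
    ((hp'.regular.enCurve.fin s hs).sub_and_le hS (hΨ'.enCurve.fin s hs)).1
    (weakGrad_sub hS.isOpen (hp'.regular.grad s hs) (hΨ'.grad s hs)) (hp'.boundary s hs)

/-- The derivative of p̄ is not assumed to vanish on the boundary. The difference quotients of p̄
are admissible in the equation frozen at time t, and the identity passes to the limit. -/
theorem IsSolution.test_deriv (hS : Setting U φ α a) {Ψ p : ℝ → Space n → ℝ}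
    {p₀ : Space n → ℝ} (hΨ : IsRegular U φ α a Ψ) (hp : IsSolution U φ α a Ψ p₀ p) {t : ℝ}
    (ht : 0 < t) :
    wip U φ (timeDeriv U φ p t) (timeDeriv U φ p t - timeDeriv U φ Ψ t)
      = - pair U α a (weakGrad U (p t))
        (weakGrad U (timeDeriv U φ p t) - weakGrad U (timeDeriv U φ Ψ t)) := by
  have hL := hp.l2Curve hS hΨ
  have hE := hp.regular.enCurve.sub hS hΨ.enCurve
  have hw := (hp.regular.hasTimeDeriv ht).1
  have hq := hp.regular.enCurve.fin t ht
  refine tendsto_nhds_unique (hL.tendsto_wip hS ht hw)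
    ((hE.tendsto_pair hS ht hq).neg.congr' ?_)
  filter_upwards [eventually_punctured_pos ht] with s hs
  rw [pair_smul, wip_smul, pair_sub hS hq (hE.fin s hs.1) (hE.fin t ht),
    wip_sub hS hw (hL.mem s hs.1) (hL.mem t ht)]
  have e1 := hp.test_solution hS hΨ hp ht hs.1
  have e2 := hp.test_solution hS hΨ hp ht ht
  change -((s - t)⁻¹ * (pair U α a (weakGrad U (p t)) (weakGrad U (p s) - weakGrad U (Ψ s)) -
      pair U α a (weakGrad U (p t)) (weakGrad U (p t) - weakGrad U (Ψ t)))) =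
    (s - t)⁻¹ * (wip U φ (timeDeriv U φ p t) (p s - Ψ s)
      - wip U φ (timeDeriv U φ p t) (p t - Ψ t))
  rw [e1, e2]
  ring

end Solutions

/-! ### Bounds for the data -/

section Data

variable {n N : ℕ} {U : Set (Space n)} {φ : Space n → ℝ} {α : Fin (N + 1) → ℝ}
  {a : Fin (N + 1) → Space n → ℝ}

theorem integrable_of_lintegral_ofReal_le {Ω : Type*} [MeasurableSpace Ω] {μ : Measure Ω}
    {f : Ω → ℝ} {B : ℝ} (hB : 0 ≤ B) (hf : AEStronglyMeasurable f μ) (h0 : 0 ≤ᵐ[μ] f)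
    (h : ∫⁻ x, ENNReal.ofReal (f x) ∂μ ≤ ENNReal.ofReal B) :
    Integrable f μ ∧ ∫ x, f x ∂μ ≤ B := by
  refine ⟨(lintegral_ofReal_ne_top_iff_integrable hf h0).1
    (h.trans_lt ENNReal.ofReal_lt_top).ne, ?_⟩
  rw [integral_eq_lintegral_of_nonneg_ae h0 hf]
  exact ENNReal.toReal_le_of_le_ofReal hB h

theorem integrable_darcy (hS : Setting U φ α a) {r : Space n → Space n} {B : ℝ} (hB : 0 ≤ B)
    (hr : AEStronglyMeasurable r (volume.restrict U)) (h : darcySq U a r ≤ ENNReal.ofReal B) :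
    Integrable (fun x => (a 0 x)⁻¹ * ‖r x‖ ^ 2) (volume.restrict U) ∧
      ∫ x in U, (a 0 x)⁻¹ * ‖r x‖ ^ 2 ≤ B := by
  refine integrable_of_lintegral_ofReal_le hB ?_ ?_ h
  · exact ((hS.coeff.measurable 0).inv.mul (hr.norm.aemeasurable.pow_const 2)).aestronglyMeasurable
  · filter_upwards [hS.ae_mem] with x hx
    exact mul_nonneg (inv_nonneg.2 (hS.coeff.pos_zero x hx).le) (sq_nonneg _)

/-- After Young's inequality inside the integral, K is kept next to |q|², giving the energy, and is
replaced by 1/a₀ next to |r|². -/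
theorem two_mul_abs_pair_le (hS : Setting U φ α a) {q r : Space n → Space n} {B θ : ℝ}
    (hB : 0 ≤ B) (hθ : 0 < θ) (hq : FinEnergy U α a q)
    (hr : AEStronglyMeasurable r (volume.restrict U)) (h : darcySq U a r ≤ ENNReal.ofReal B) :
    2 * |pair U α a q r| ≤ θ * en U α a q + θ⁻¹ * B := by
  obtain ⟨h1, h2⟩ := integrable_darcy hS hB hr h
  have i1 := (hq.integrable hS).const_mul (θ / 2)
  have i2 := h1.const_mul (θ⁻¹ / 2)
  have h3 := norm_integral_le_of_norm_le
    (f := fun x => K α a x ‖q x‖ * inner ℝ (q x) (r x)) (i1.add i2) (by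
      filter_upwards [hS.ae_mem] with x hx
      have k1 := K_pos hS.exps hS.coeff hx (norm_nonneg (q x))
      have k2 := K_le_inv hS.exps hS.coeff hx (norm_nonneg (q x))
      have k3 := mul_le_mul_of_nonneg_right k2 (sq_nonneg ‖r x‖)
      have k4 : ‖q x‖ * ‖r x‖ ≤ θ / 2 * ‖q x‖ ^ 2 + θ⁻¹ / 2 * ‖r x‖ ^ 2 := by
        have e : θ / 2 * ‖q x‖ ^ 2 + θ⁻¹ / 2 * ‖r x‖ ^ 2 - ‖q x‖ * ‖r x‖
            = θ⁻¹ / 2 * (θ * ‖q x‖ - ‖r x‖) ^ 2 := by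
          field_simp
          ring
        have : 0 ≤ θ⁻¹ / 2 * (θ * ‖q x‖ - ‖r x‖) ^ 2 := by positivity
        linarith
      have k5 := (abs_real_inner_le_norm (q x) (r x)).trans k4
      rw [norm_mul, Real.norm_eq_abs, Real.norm_eq_abs, abs_of_pos k1]
      have k6 := mul_le_mul_of_nonneg_left k5 k1.le
      have k7 := mul_le_mul_of_nonneg_left k3 (by positivity : 0 ≤ θ⁻¹ / 2)
      simp only [Pi.add_apply]
      linarith)
  rw [integral_add' i1 i2, integral_const_mul, integral_const_mul, ← en_eq hS hq.meas] at h3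
  have h4 := mul_le_mul_of_nonneg_left h2 (by positivity : 0 ≤ θ⁻¹ / 2)
  have h5 : |pair U α a q r| ≤ _ := h3
  linarith

theorem integrable_coeff_last (hS : Setting U φ α a) {A : ℝ} (hA : 0 ≤ A)
    (h : BStar U a ≤ ENNReal.ofReal A) :
    Integrable (a (Fin.last N)) (volume.restrict U) ∧ ∫ x in U, a (Fin.last N) x ≤ A := by
  refine integrable_of_lintegral_ofReal_le hA (hS.coeff.measurable _).aestronglyMeasurable ?_
    ((le_max_left _ _).trans h)
  filter_upwards [hS.ae_mem] with x hx
  exact (hS.coeff.pos_last x hx).le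

theorem aemeasurable_W1 (hS : Setting U φ α a) :
    AEMeasurable (W1 α a) (volume.restrict U) := by
  have h : AEMeasurable (maxCoeff a) (volume.restrict U) := by
    have : maxCoeff a = Finset.univ.sup' Finset.univ_nonempty a := by
      funext x
      simp [maxCoeff, Finset.sup'_apply]
    rw [this]
    exact Finset.sup'_induction _ _ (p := fun f => AEMeasurable f (volume.restrict U))
      (fun _ h1 _ h2 => h1.sup h2) fun i _ => hS.coeff.measurable i
  exact ((hS.coeff.measurable _).pow_const _).div (h.const_mul _)

theorem integrable_weighted (hS : Setting U φ α a) {r : Space n → Space n} {A : ℝ} (hA : 0 ≤ A)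
    (hr : AEStronglyMeasurable r (volume.restrict U))
    (h : ∫⁻ x in U, ENNReal.ofReal (W1 α a x * ‖r x‖ ^ (2 - degExp α)) ≤ ENNReal.ofReal A) :
    Integrable (fun x => W1 α a x * ‖r x‖ ^ (2 - degExp α)) (volume.restrict U) ∧
      ∫ x in U, W1 α a x * ‖r x‖ ^ (2 - degExp α) ≤ A := by
  refine integrable_of_lintegral_ofReal_le hA ?_ ?_ h
  · exact ((aemeasurable_W1 hS).mul (hr.norm.aemeasurable.pow_const _)).aestronglyMeasurable
  · filter_upwards [hS.ae_mem] with x hx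
    exact mul_nonneg (W1_pos hS.exps hS.coeff hx).le (Real.rpow_nonneg (norm_nonneg _) _)

/-- The real form of the inequality, raised to the power 2 - a. An integrable majorant f lets later
pointwise estimates be inserted directly. -/
theorem PoincareSobolev.le_integral (hS : Setting U φ α a) {c : ℝ} (hc : 0 ≤ c)
    {u : Space n → ℝ} {f : Space n → ℝ} (hP : PoincareSobolev U φ α a c u) (hu : MemL2 U φ u)
    (hf : Integrable f (volume.restrict U))
    (h : ∀ᵐ x ∂(volume.restrict U), W1 α a x * ‖weakGrad U u x‖ ^ (2 - degExp α) ≤ f x) :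
    wip U φ u u ^ ((2 - degExp α) / 2) ≤ c ^ (2 - degExp α) * ∫ x in U, f x := by
  have h1 := degExp_lt_one hS.exps
  have hγ : 0 < 2 - degExp α := by linarith
  have f0 : 0 ≤ᵐ[volume.restrict U] f := by
    filter_upwards [h, hS.ae_mem] with x hx hxU
    exact (mul_nonneg (W1_pos hS.exps hS.coeff hxU).le
      (Real.rpow_nonneg (norm_nonneg _) _)).trans hx
  have hF := integral_nonneg_of_ae f0
  have hy := wip_self_nonneg hS u
  have h2 : ∫⁻ x in U, ENNReal.ofReal (W1 α a x * ‖weakGrad U u x‖ ^ (2 - degExp α))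
      ≤ ENNReal.ofReal (∫ x in U, f x) := by
    rw [ofReal_integral_eq_lintegral_ofReal hf f0]
    refine lintegral_mono_ae ?_
    filter_upwards [h] with x hx using ENNReal.ofReal_le_ofReal hx
  have h3 : wip U φ u u ^ (1 / 2 : ℝ) ≤ c * (∫ x in U, f x) ^ (1 / (2 - degExp α)) := by
    have h4 := hP.trans (mul_le_mul_right (ENNReal.rpow_le_rpow h2
      (one_div_pos.2 hγ).le) (ENNReal.ofReal c))
    rw [normSq_eq hS hu, ENNReal.ofReal_rpow_of_nonneg hy (by norm_num),
      ENNReal.ofReal_rpow_of_nonneg hF (one_div_pos.2 hγ).le, ← ENNReal.ofReal_mul hc,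
      ENNReal.ofReal_le_ofReal_iff (by positivity)] at h4
    exact h4
  have h5 := Real.rpow_le_rpow (by positivity) h3 hγ.le
  rw [Real.mul_rpow hc (by positivity), ← Real.rpow_mul hy, ← Real.rpow_mul hF,
    one_div_mul_cancel hγ.ne', Real.rpow_one] at h5
  rwa [show (2 - degExp α) / 2 = 1 / 2 * (2 - degExp α) by ring]

/-- The bounds contained in a bound for `G[Ψ](t)`. -/
theorem bounds_of_G_le {Ψ : ℝ → Space n → ℝ} {t : ℝ} {A : ℝ≥0∞} (h : G U φ α a Ψ t ≤ A) :
    BStar U a ≤ A ∧ darcySq U a (weakGrad U (Ψ t)) ≤ A ∧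
      (∫⁻ x in U, ENNReal.ofReal (W1 α a x * ‖weakGrad U (Ψ t) x‖ ^ (2 - degExp α))) ≤ A ∧
      normSq U φ (timeDeriv U φ Ψ t) ^ ((2 - degExp α) / (2 * (1 - degExp α))) ≤ A := by
  unfold G at h
  exact ⟨le_trans (le_add_right (le_add_right le_self_add)) h,
    le_trans (le_add_right (le_add_right le_add_self)) h,
    le_trans (le_add_right le_add_self) h, le_add_self.trans h⟩

theorem wip_timeDeriv_le (hS : Setting U φ α a) {w : Space n → ℝ} {A : ℝ} (hA : 0 ≤ A)
    (hw : MemL2 U φ w)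
    (h : normSq U φ w ^ ((2 - degExp α) / (2 * (1 - degExp α))) ≤ ENNReal.ofReal A) :
    wip U φ w w ≤ A ^ (2 * (1 - degExp α) / (2 - degExp α)) := by
  have h1 := degExp_lt_one hS.exps
  have h2 : 0 < 1 - degExp α := by linarith
  have h3 : 0 < 2 - degExp α := by linarith
  have hy := wip_self_nonneg hS w
  rw [normSq_eq hS hw, ENNReal.ofReal_rpow_of_nonneg hy (by positivity),
    ENNReal.ofReal_le_ofReal_iff hA] at h
  have h4 := Real.rpow_le_rpow (by positivity) h
    (by positivity : 0 ≤ 2 * (1 - degExp α) / (2 - degExp α))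
  rwa [← Real.rpow_mul hy, div_mul_div_comm, mul_comm (2 - degExp α), div_self (by positivity),
    Real.rpow_one] at h4

end Data

/-! ### Energy estimates for one solution -/

section SingleSolution

variable {n N : ℕ} {U : Set (Space n)} {φ : Space n → ℝ} {α : Fin (N + 1) → ℝ}
  {a : Fin (N + 1) → Space n → ℝ}

theorem sub_rpow_norm_le {γ : ℝ} (hγ : 0 ≤ γ) (u v : Space n) :
    ‖u - v‖ ^ γ ≤ 2 ^ γ * (‖u‖ ^ γ + ‖v‖ ^ γ) :=
  (Real.rpow_le_rpow (norm_nonneg _) (norm_sub_le u v) hγ).trans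
    (add_rpow_le hγ (norm_nonneg u) (norm_nonneg v))

/-- Coercivity: the Poincaré–Sobolev inequality bounds `‖p̄‖` by the energy. -/
theorem wip_rpow_le_energy (hS : Setting U φ α a) {c A : ℝ} (hc : 0 ≤ c) (hA : 0 ≤ A)
    {u : Space n → ℝ} {q ψ : Space n → Space n} (hP : PoincareSobolev U φ α a c u)
    (hu : MemL2 U φ u) (hq : FinEnergy U α a q)
    (hψ : AEStronglyMeasurable ψ (volume.restrict U))
    (hgrad : weakGrad U u =ᵐ[volume.restrict U] q - ψ) (hB : BStar U a ≤ ENNReal.ofReal A)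
    (hW : ∫⁻ x in U, ENNReal.ofReal (W1 α a x * ‖ψ x‖ ^ (2 - degExp α)) ≤ ENNReal.ofReal A) :
    wip U φ u u ^ ((2 - degExp α) / 2)
      ≤ c ^ (2 - degExp α) * 2 ^ (2 - degExp α) * 2 * (en U α a q + A) := by
  have h1 := degExp_lt_one hS.exps
  obtain ⟨b1, b2⟩ := integrable_coeff_last hS hA hB
  obtain ⟨w1, w2⟩ := integrable_weighted hS hA hψ hW
  have i1 := (hq.integrable hS).const_mul 2
  have i2 := i1.add b1
  have i3 := (i2.add w1).const_mul (2 ^ (2 - degExp α))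
  have h2 := hP.le_integral hS hc hu i3 (by
    filter_upwards [hS.ae_mem, hgrad] with x hx hg
    rw [hg, Pi.sub_apply]
    have k1 := W1_mul_rpow_le hS.exps hS.coeff hx (norm_nonneg (q x))
    have k2 := mul_le_mul_of_nonneg_left
      (sub_rpow_norm_le (by linarith : 0 ≤ 2 - degExp α) (q x) (ψ x))
      (W1_pos hS.exps hS.coeff hx).le
    have k3 : (0 : ℝ) < 2 ^ (2 - degExp α) := by positivity
    refine k2.trans ?_
    simp only [Pi.add_apply]
    rw [mul_left_comm]
    refine mul_le_mul_of_nonneg_left ?_ k3.le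
    rw [mul_add]
    linarith)
  rw [integral_const_mul, integral_add' i2 w1, integral_add' i1 b1, integral_const_mul,
    ← en_eq hS hq.meas] at h2
  refine h2.trans ?_
  rw [mul_assoc, mul_assoc]
  refine mul_le_mul_of_nonneg_left (mul_le_mul_of_nonneg_left ?_ (by positivity)) (by positivity)
  linarith

/-- Superlinear growth, from γ > 1. In the 3 + 4r, 4r matches the forcing; of the three remaining
units one pays for the additive A in the coercivity estimate, one for the A in the differential
inequality, and one is left as decay. -/
theorem exists_growth_bound {γ c : ℝ} (hγ : 1 < γ) (hc : 0 ≤ c) :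
    ∃ R : ℝ, 1 ≤ R ∧ ∀ r, R ≤ r → c * (3 + 4 * r) ≤ r ^ γ := by
  have h1 := (tendsto_rpow_atTop (by linarith : 0 < γ - 1)).eventually_ge_atTop (c * 7)
  obtain ⟨R, hR⟩ := eventually_atTop.1 h1
  refine ⟨max R 1, le_max_right _ _, fun r hr => ?_⟩
  have hr1 : 1 ≤ r := (le_max_right _ _).trans hr
  have h2 := hR r ((le_max_left _ _).trans hr)
  have h3 : r ^ γ = r ^ (γ - 1) * r := by
    rw [← Real.rpow_add_one (by linarith), sub_add_cancel]
  rw [h3]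
  calc c * (3 + 4 * r) ≤ c * 7 * r := by nlinarith
    _ ≤ _ := by gcongr

theorem two_mul_pair_sub_le (hS : Setting U φ α a) {q ψ : Space n → Space n} {A : ℝ}
    (hA : 0 ≤ A) (hq : FinEnergy U α a q) (hψ : FinEnergy U α a ψ)
    (hd : darcySq U a ψ ≤ ENNReal.ofReal A) :
    -(2 * pair U α a q (q - ψ)) ≤ -en U α a q + A := by
  rw [pair_sub hS hq hq hψ, pair_self hS hq]
  have h := two_mul_abs_pair_le hS hA one_pos hq hψ.meas hd
  have := le_abs_self (pair U α a q ψ)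
  rw [inv_one] at h
  linarith

/-- The derivative of `‖p̄‖²`. -/
theorem IsSolution.two_mul_wip_le (hS : Setting U φ α a) {Ψ p : ℝ → Space n → ℝ}
    {p₀ : Space n → ℝ} (hΨ : IsRegular U φ α a Ψ) (hp : IsSolution U φ α a Ψ p₀ p) {t : ℝ}
    (ht : 0 < t) {A m r : ℝ} (hm : 0 < m) (hmA : m ^ (2 - degExp α) = A)
    (hG : G U φ α a Ψ t ≤ ENNReal.ofReal A) (hr : 0 < r)
    (hy : wip U φ ((p - Ψ) t) ((p - Ψ) t) ≤ r ^ 2 * m ^ 2) :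
    2 * wip U φ ((p - Ψ) t) (timeDeriv U φ p t - timeDeriv U φ Ψ t)
      ≤ -en U α a (weakGrad U (p t)) + A + 4 * r * A := by
  have h1 := degExp_lt_one hS.exps
  have hA : 0 ≤ A := by rw [← hmA]; positivity
  obtain ⟨-, g2, -, g4⟩ := bounds_of_G_le hG
  have hL : MemL2 U φ ((p - Ψ) t) := hp.memL2 t ht.le
  have hpt := (hp.regular.hasTimeDeriv ht).1
  have hΨt := (hΨ.hasTimeDeriv ht).1
  have hw := wip_timeDeriv_le hS hA hΨt g4
  have e1 : A ^ (2 * (1 - degExp α) / (2 - degExp α)) = m ^ (2 * (1 - degExp α)) := by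
    rw [← hmA, ← Real.rpow_mul hm.le]
    congr 1
    have : 2 - degExp α ≠ 0 := by linarith
    field_simp
  rw [e1] at hw
  -- This Young parameter balances the terms in p̄ and Ψ_t: each becomes at most r m^(2-a) = r A.
  have hδ : 0 < r⁻¹ * m ^ (-degExp α) := by positivity
  have h2 := (abs_le.1 (abs_wip_le hS hL hΨt hδ)).1
  have h3 : r⁻¹ * m ^ (-degExp α) * wip U φ ((p - Ψ) t) ((p - Ψ) t) ≤ r * A := by
    refine (mul_le_mul_of_nonneg_left hy hδ.le).trans (le_of_eq ?_)
    rw [← hmA, sub_eq_neg_add, Real.rpow_add hm, Real.rpow_two]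
    field_simp
  have h4 : (r⁻¹ * m ^ (-degExp α))⁻¹ * wip U φ (timeDeriv U φ Ψ t) (timeDeriv U φ Ψ t)
      ≤ r * A := by
    refine (mul_le_mul_of_nonneg_left hw (inv_nonneg.2 hδ.le)).trans (le_of_eq ?_)
    rw [mul_inv, inv_inv, Real.rpow_neg hm.le, inv_inv, mul_assoc, ← Real.rpow_add hm, ← hmA]
    congr 2
    ring
  rw [wip_sub hS hL hpt hΨt, wip_comm _ (timeDeriv U φ p t)]
  have h5 := hp.test_solution hS hΨ hp ht ht
  change wip U φ (timeDeriv U φ p t) ((p - Ψ) t) = _ at h5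
  have h6 := two_mul_pair_sub_le hS hA (hp.regular.enCurve.fin t ht) (hΨ.enCurve.fin t ht) g2
  rw [h5]
  linarith

/-- The derivative of the potential energy. -/
theorem IsSolution.pair_deriv_le (hS : Setting U φ α a) {Ψ p : ℝ → Space n → ℝ}
    {p₀ : Space n → ℝ} (hΨ : IsRegular U φ α a Ψ) (hp : IsSolution U φ α a Ψ p₀ p) {t : ℝ}
    (ht : 0 < t) {A B : ℝ} (hA : 0 ≤ A) (hB : 0 ≤ B) (hG : G U φ α a Ψ t ≤ ENNReal.ofReal A)
    (hG1 : G1 U φ a Ψ t ≤ ENNReal.ofReal B) :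
    pair U α a (weakGrad U (p t)) (weakGrad U (timeDeriv U φ p t))
      ≤ en U α a (weakGrad U (p t)) / 2 + B / 2 + A ^ (2 * (1 - degExp α) / (2 - degExp α)) := by
  obtain ⟨-, -, -, g4⟩ := bounds_of_G_le hG
  have hpt := (hp.regular.hasTimeDeriv ht).1
  have hΨt := (hΨ.hasTimeDeriv ht).1
  have hw := wip_timeDeriv_le hS hA hΨt g4
  have hq := hp.regular.enCurve.fin t ht
  have hq' := hp.regular.enCurve.fin_deriv hS ht
  have hψ' := hΨ.enCurve.fin_deriv hS ht
  have h1 := hp.test_deriv hS hΨ ht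
  rw [pair_sub hS hq hq' hψ', wip_sub hS hpt hpt hΨt] at h1
  -- With parameter 1, the term ‖p_t‖² produced here is cancelled by the one from testing with p̄_t.
  have h2 := (abs_le.1 (abs_wip_le hS hpt hΨt one_pos)).2
  have h3 := two_mul_abs_pair_le hS hB one_pos hq hψ'.meas hG1
  have h4 := le_abs_self (pair U α a (weakGrad U (p t)) (weakGrad U (timeDeriv U φ Ψ t)))
  rw [inv_one] at h2 h3
  linarith

/-- Eventual bounds for the energy and for `‖p̄‖²`. -/
theorem exists_energy_bound {N : ℕ} {α : Fin (N + 1) → ℝ} (hα : IsExponents α) {cP : ℝ}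
    (hcP : 0 < cP) :
    ∃ C : ℝ, 1 ≤ C ∧ ∀ {n : ℕ} {U : Set (Space n)} {φ : Space n → ℝ}
      {a : Fin (N + 1) → Space n → ℝ} {Ψ p : ℝ → Space n → ℝ} {p₀ : Space n → ℝ} {A B : ℝ},
      Setting U φ α a → IsRegular U φ α a Ψ → IsSolution U φ α a Ψ p₀ p →
      (∀ t, 0 < t → PoincareSobolev U φ α a cP (p t - Ψ t)) → 1 ≤ A → 0 ≤ B →
      (∀ᶠ t in atTop, G U φ α a Ψ t ≤ ENNReal.ofReal A) →
      (∀ᶠ t in atTop, G1 U φ a Ψ t ≤ ENNReal.ofReal B) →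
      ∀ᶠ t in atTop, en U α a (weakGrad U (p t)) ≤ C * (A ^ (2 / (2 - degExp α)) + B) ∧
        wip U φ ((p - Ψ) t) ((p - Ψ) t) ≤ C * (A ^ (2 / (2 - degExp α)) + B) := by
  have hd0 := degExp_pos hα
  have hd1 := degExp_lt_one hα
  set γ := 2 - degExp α with hγ
  set c₀ := cP ^ γ * 2 ^ γ * 2 with hc₀
  have hc₀0 : 0 < c₀ := by positivity
  obtain ⟨R, hR1, hR⟩ := exists_growth_bound (γ := γ) (c := c₀) (by linarith) hc₀0.le
  -- Half of Cw X has to absorb half of ‖p̄‖² ≤ R² m² and the forcing (2 + 4R) m² + B/2, and still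
  -- leave slope at most -1.
  set Cw := 2 * (3 + 4 * R + R ^ 2) with hCw
  have hCw1 : 1 ≤ Cw := by nlinarith
  refine ⟨2 * Cw, by linarith, ?_⟩
  intro n U φ a Ψ p p₀ A B hS hΨ hp hP hA hB hG hG1
  have hA0 : 0 ≤ A := by linarith
  -- The natural unit for ‖p̄‖: m^γ = A, and m² is the power of A in the target.
  set m := A ^ γ⁻¹ with hm
  have hm1 : 1 ≤ m := Real.one_le_rpow hA (inv_nonneg.2 (by linarith))
  have hm0 : 0 < m := by linarith
  have hmA : m ^ γ = A := Real.rpow_inv_rpow hA0 (by linarith)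
  have hm2 : A ^ (2 / γ) = m ^ 2 := by
    rw [hm, ← Real.rpow_two, ← Real.rpow_mul hA0, inv_mul_eq_div]
  have hAm : A ≤ m ^ 2 := by
    rw [← hmA, ← Real.rpow_two]
    exact Real.rpow_le_rpow_of_exponent_le hm1 (by linarith)
  have hAm' : A ^ (2 * (1 - degExp α) / γ) ≤ m ^ 2 := by
    rw [← hm2]
    refine Real.rpow_le_rpow_of_exponent_le hA ?_
    have : 0 < γ := by linarith
    gcongr
    linarith
  have hL := hp.l2Curve hS hΨ
  have hE := hp.regular.enCurve
  set y : ℝ → ℝ := fun t => wip U φ ((p - Ψ) t) ((p - Ψ) t) with hy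
  have hy0 : ∀ t, 0 ≤ y t := fun t => wip_self_nonneg hS _
  obtain ⟨T₀, hT₀⟩ := eventually_atTop.1 hG
  have hyR : ∀ᶠ t in atTop, y t ≤ R ^ 2 * m ^ 2 := by
    refine eventually_le_of_leftSlope (δ := 1) (T := max 0 T₀) one_pos
      (fun t ht => hL.continuousAt hS ((le_max_left _ _).trans_lt ht)) (fun t _ => hy0 t)
      fun t ht hYt => ?_
    have ht0 : 0 < t := (le_max_left _ _).trans_lt ht
    have hGt := hT₀ t ((le_max_right _ _).trans ht.le)
    obtain ⟨g1, -, g3, -⟩ := bounds_of_G_le hGt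
    refine (hL.leftSlope hS ht0).mono ?_
    -- Above the level, r ≥ R, so coercivity gives energy at least (2 + 4r)A and hence slope at most
    -- -A ≤ -1.
    set r := √(y t) / m with hr
    have hrR : R ≤ r := by
      rw [hr, le_div_iff₀ hm0]
      refine Real.le_sqrt_of_sq_le ?_
      rw [mul_pow]
      exact hYt.le
    have hr2 : r ^ 2 * m ^ 2 = y t := by
      rw [hr, div_pow, Real.sq_sqrt (hy0 t)]
      field_simp
    have h1 := hp.two_mul_wip_le hS hΨ ht0 hm0 hmA hGt (by linarith : 0 < r) hr2.ge
    have h2 := wip_rpow_le_energy hS hcP.le hA0 (hP t ht0) (hL.mem t ht0) (hE.fin t ht0)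
      (hΨ.enCurve.fin t ht0).meas
      (weakGrad_sub hS.isOpen (hp.regular.grad t ht0) (hΨ.grad t ht0)) g1 g3
    have e1 : y t ^ (γ / 2) = r ^ γ * A := by
      rw [← hr2, ← mul_pow, ← Real.rpow_two, ← Real.rpow_mul (by positivity),
        mul_div_cancel₀ _ (by norm_num), Real.mul_rpow (by linarith) hm0.le, hmA]
    have h3 : r ^ γ * A ≤ c₀ * (en U α a (weakGrad U (p t)) + A) := by
      rw [← e1]
      exact h2
    have h4 := mul_le_mul_of_nonneg_right (hR r hrR) hA0
    have h5 : c₀ * ((3 + 4 * r) * A) ≤ c₀ * (en U α a (weakGrad U (p t)) + A) := by linarith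
    have h6 := le_of_mul_le_mul_left h5 hc₀0
    linarith
  set X := m ^ 2 + B with hX
  have hX1 : 1 ≤ X := by
    have : 1 ≤ m ^ 2 := one_le_pow₀ hm1
    linarith
  -- The potential energy alone may grow at rate E/2; the -E in the derivative of y compensates for
  -- it.
  set w : ℝ → ℝ := fun t => pot U α a (weakGrad U (p t)) + y t with hw
  have hz0 : ∀ t, 0 < t → 0 ≤ pot U α a (weakGrad U (p t)) := fun t ht => by
    have := en_le_pot hS (hE.fin t ht)
    have := en_nonneg (U := U) (α := α) (a := a) (weakGrad U (p t))
    linarith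
  obtain ⟨T₁, hT₁⟩ := eventually_atTop.1 (hG.and (hG1.and hyR))
  have hwC : ∀ᶠ t in atTop, w t ≤ Cw * X := by
    refine eventually_le_of_leftSlope (δ := 1) (T := max 0 T₁) one_pos
      (fun t ht => ?_) (fun t ht => ?_) fun t ht hYt => ?_
    · have ht0 : 0 < t := (le_max_left _ _).trans_lt ht
      exact (hE.continuousAt hS ht0).add (hL.continuousAt hS ht0)
    · exact add_nonneg (hz0 t ((le_max_left _ _).trans_lt ht)) (hy0 t)
    have ht0 : 0 < t := (le_max_left _ _).trans_lt ht
    obtain ⟨hGt, hG1t, hyt⟩ := hT₁ t ((le_max_right _ _).trans ht.le)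
    refine ((hE.leftSlope hS ht0).add (hL.leftSlope hS ht0)).mono ?_
    have h1 := hp.two_mul_wip_le hS hΨ ht0 hm0 hmA hGt (by linarith : 0 < R) hyt
    have h2 := hp.pair_deriv_le hS hΨ ht0 hA0 hB hGt hG1t
    have h3 := pot_le_en hS (hE.fin t ht0)
    have h4 : pot U α a (weakGrad U (p t)) + y t = w t := rfl
    have h5 : 4 * R * A ≤ 4 * R * m ^ 2 := by gcongr
    have h6 : 2 * (3 + 4 * R + R ^ 2) * (m ^ 2 + B) < w t := hYt
    have h7 : 0 ≤ (3 + 4 * R + R ^ 2) * B := by positivity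
    have h8 : 0 ≤ (4 * R + R ^ 2) * B := by positivity
    change _ + 2 * wip U φ ((p - Ψ) t) _ ≤ _
    nlinarith
  filter_upwards [hwC, eventually_gt_atTop 0] with t ht ht0
  have h1 := en_le_pot hS (hE.fin t ht0)
  have h2 : pot U α a (weakGrad U (p t)) + y t = w t := rfl
  have h3 := hz0 t ht0
  have h4 := hy0 t
  have h5 : wip U φ ((p - Ψ) t) ((p - Ψ) t) = y t := rfl
  have h6 : 0 ≤ Cw * X := by positivity
  rw [hm2]
  constructor
  · linarith
  · rw [h5]
    linarith

end SingleSolution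

/-! ### Estimates for the difference of two solutions -/

section Difference

variable {n N : ℕ} {U : Set (Space n)} {φ : Space n → ℝ} {α : Fin (N + 1) → ℝ}
  {a : Fin (N + 1) → Space n → ℝ}

/-- The integrated strong monotonicity of the flux. -/
theorem integrable_maxDensity (hS : Setting U φ α a) {q r : Space n → Space n}
    (hq : FinEnergy U α a q) (hr : FinEnergy U α a r) :
    Integrable (fun x => K α a x (max ‖q x‖ ‖r x‖) * ‖q x - r x‖ ^ 2) (volume.restrict U) ∧
      (1 - degExp α) * ∫ x in U, K α a x (max ‖q x‖ ‖r x‖) * ‖q x - r x‖ ^ 2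
        ≤ pair U α a q (q - r) - pair U α a r (q - r) := by
  have h1 : 0 < 1 - degExp α := by linarith [degExp_lt_one hS.exps]
  have hd := (hq.sub_and_le hS hr).1
  have i := (integrable_pair hS hq hd).sub (integrable_pair hS hr hd)
  have hle : ∀ᵐ x ∂(volume.restrict U),
      (1 - degExp α) * (K α a x (max ‖q x‖ ‖r x‖) * ‖q x - r x‖ ^ 2) ≤
        K α a x ‖q x‖ * inner ℝ (q x) ((q - r) x) - K α a x ‖r x‖ * inner ℝ (r x) ((q - r) x) := by
    filter_upwards [hS.ae_mem] with x hx
    exact flux_monotone hS.exps hS.coeff hx (q x) (r x)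
  have hi : Integrable (fun x => K α a x (max ‖q x‖ ‖r x‖) * ‖q x - r x‖ ^ 2)
      (volume.restrict U) := by
    refine (i.const_mul (1 - degExp α)⁻¹).mono' ?_ ?_
    · exact ((aemeasurable_K hS (hq.meas.norm.aemeasurable.max hr.meas.norm.aemeasurable)
        fun x => (norm_nonneg _).trans (le_max_left _ _)).mul
        (hd.meas.norm.aemeasurable.pow_const 2)).aestronglyMeasurable
    · filter_upwards [hle, hS.ae_mem] with x hx hxU
      have h2 := K_pos hS.exps hS.coeff hxU ((norm_nonneg (q x)).trans (le_max_left _ ‖r x‖))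
      rw [Real.norm_of_nonneg (by positivity)]
      rwa [inv_mul_eq_div, le_div_iff₀' h1]
  refine ⟨hi, ?_⟩
  rw [pair, pair, ← integral_const_mul,
    ← integral_sub (integrable_pair hS hq hd) (integrable_pair hS hr hd)]
  exact integral_mono_ae (hi.const_mul _) i hle

/-- Choosing σ so that the M-term equals half of the left side leaves a bound linear in S. The price
is the power e/(2-e) of M, which becomes the factor X^{a/(2-a)} of the theorem. -/
theorem le_of_forall_young {e Q P S M : ℝ} (he0 : 0 < e) (he1 : e < 1) (hQ : 0 ≤ Q) (hP : 0 < P)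
    (hM : 0 < M) (hS : 0 ≤ S)
    (h : ∀ σ, 0 < σ → Q ^ ((2 - e) / 2) ≤ P * (σ ^ (-e) * S + σ ^ (2 - e) * M)) :
    Q ≤ 2 * P * (2 * P * M) ^ (e / (2 - e)) * S := by
  rcases hQ.eq_or_lt with rfl | hQ
  · positivity
  have hγ : 0 < 2 - e := by linarith
  have hPM : 0 < 2 * P * M := by positivity
  set T := 2 * P * M with hT
  set σ := Q ^ (1 / 2 : ℝ) * T ^ (-(1 / (2 - e))) with hσ
  have hσ0 : 0 < σ := by positivity
  have e1 : σ ^ (2 - e) = Q ^ ((2 - e) / 2) * T⁻¹ := by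
    rw [hσ, Real.mul_rpow (by positivity) (by positivity), ← Real.rpow_mul hQ.le,
      ← Real.rpow_mul hPM.le, neg_mul, one_div_mul_cancel hγ.ne', Real.rpow_neg_one]
    congr 2
    ring
  have e2 : σ ^ e = Q ^ (e / 2) * (T ^ (e / (2 - e)))⁻¹ := by
    rw [hσ, Real.mul_rpow (by positivity) (by positivity), ← Real.rpow_mul hQ.le,
      ← Real.rpow_mul hPM.le, ← Real.rpow_neg hPM.le]
    congr 2 <;> ring
  have h1 := h σ hσ0
  have e3 : P * (σ ^ (2 - e) * M) = Q ^ ((2 - e) / 2) / 2 := by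
    rw [e1, hT]
    field_simp
  have h2 : Q ^ ((2 - e) / 2) ≤ 2 * P * (σ ^ (-e) * S) := by linarith
  have h3 := mul_le_mul_of_nonneg_left h2 (by positivity : 0 ≤ σ ^ e)
  have e4 : σ ^ e * (2 * P * (σ ^ (-e) * S)) = 2 * P * S := by
    rw [Real.rpow_neg hσ0.le]
    field_simp
  have e5 : σ ^ e * Q ^ ((2 - e) / 2) = Q * (T ^ (e / (2 - e)))⁻¹ := by
    rw [e2, mul_right_comm, ← Real.rpow_add hQ, show e / 2 + (2 - e) / 2 = 1 by ring,
      Real.rpow_one]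
  rw [e4, e5, ← div_eq_mul_inv, div_le_iff₀ (by positivity)] at h3
  linarith

/-- Coercivity for the difference of two solutions. -/
theorem wip_difference_le (hS : Setting U φ α a) {c A E d : ℝ} (hc : 0 < c) (hA : 0 < A)
    (hE : 0 ≤ E) (hd : 0 ≤ d) {u : Space n → ℝ} {q r f : Space n → Space n}
    (hP : PoincareSobolev U φ α a c u) (hu : MemL2 U φ u) (hq : FinEnergy U α a q)
    (hr : FinEnergy U α a r) (hf : AEStronglyMeasurable f (volume.restrict U))
    (hgrad : weakGrad U u =ᵐ[volume.restrict U] q - r - f)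
    (hB : BStar U a ≤ ENNReal.ofReal A) (hEq : en U α a q ≤ E) (hEr : en U α a r ≤ E)
    (hfd : darcySq U a f ≤ ENNReal.ofReal d) :
    wip U φ u u ≤ 2 * c ^ (2 - degExp α) *
      (2 * c ^ (2 - degExp α) * (2 ^ (2 / degExp α + 1) * (4 * E + 2 * A)))
        ^ (degExp α / (2 - degExp α)) *
      (2 * ((∫ x in U, K α a x (max ‖q x‖ ‖r x‖) * ‖q x - r x‖ ^ 2) + d)) := by
  have h0 := degExp_pos hS.exps
  have h1 := degExp_lt_one hS.exps
  obtain ⟨j1, -⟩ := integrable_maxDensity hS hq hr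
  obtain ⟨d1, d2⟩ := integrable_darcy hS hd hf hfd
  obtain ⟨b1, b2⟩ := integrable_coeff_last hS hA.le hB
  have hJ : 0 ≤ ∫ x in U, K α a x (max ‖q x‖ ‖r x‖) * ‖q x - r x‖ ^ 2 := by
    refine integral_nonneg_of_ae ?_
    filter_upwards [hS.ae_mem] with x hx
    have := K_pos hS.exps hS.coeff hx ((norm_nonneg (q x)).trans (le_max_left _ ‖r x‖))
    positivity
  refine le_of_forall_young h0 h1 (wip_self_nonneg hS u) (by positivity) (by positivity)
    (by positivity) fun σ hσ => ?_
  have i1 := (j1.add d1).const_mul (σ ^ (-degExp α) * 2)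
  have i2 := (((hq.integrable hS).add (hr.integrable hS)).add b1).const_mul
    (σ ^ (2 - degExp α) * (2 ^ (2 / degExp α + 1) * 2))
  have h2 := hP.le_integral hS hc.le hu (i1.add i2) (by
    filter_upwards [hS.ae_mem, hgrad] with x hx hg
    have hξ : 0 ≤ max ‖q x‖ ‖r x‖ := (norm_nonneg (q x)).trans (le_max_left _ _)
    have k1 := W1_mul_rpow_le_young hS.exps hS.coeff hx hξ (norm_nonneg (weakGrad U u x)) hσ
    have k2 := W1_mul_rpow_le hS.exps hS.coeff hx hξ
    have k3 := W1_mul_last hS.exps hS.coeff hx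
    -- The density at the larger of the two gradients is one of the two densities, so their sum
    -- dominates it.
    have k4 : K α a x (max ‖q x‖ ‖r x‖) * (max ‖q x‖ ‖r x‖) ^ 2
        ≤ K α a x ‖q x‖ * ‖q x‖ ^ 2 + K α a x ‖r x‖ * ‖r x‖ ^ 2 := by
      have n1 := K_mul_sq_nonneg hS.exps hS.coeff hx (norm_nonneg (q x))
      have n2 := K_mul_sq_nonneg hS.exps hS.coeff hx (norm_nonneg (r x))
      rcases max_cases ‖q x‖ ‖r x‖ with ⟨h, -⟩ | ⟨h, -⟩ <;> rw [h] <;> linarith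
    have k5 : ‖weakGrad U u x‖ ^ 2 ≤ 2 * (‖q x - r x‖ ^ 2 + ‖f x‖ ^ 2) := by
      rw [hg, Pi.sub_apply, Pi.sub_apply]
      have := norm_sub_le (q x - r x) (f x)
      nlinarith [norm_nonneg (q x - r x - f x), sq_nonneg (‖q x - r x‖ - ‖f x‖)]
    have k6 := K_pos hS.exps hS.coeff hx hξ
    have k7 := mul_le_mul_of_nonneg_right (K_le_inv hS.exps hS.coeff hx hξ) (sq_nonneg ‖f x‖)
    have k8 := mul_le_mul_of_nonneg_left k5 k6.le
    have k9 : K α a x (max ‖q x‖ ‖r x‖) * ‖weakGrad U u x‖ ^ 2 ≤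
        2 * (K α a x (max ‖q x‖ ‖r x‖) * ‖q x - r x‖ ^ 2 + (a 0 x)⁻¹ * ‖f x‖ ^ 2) := by
      linarith
    have k10 : W1 α a x * max ‖q x‖ ‖r x‖ ^ (2 - degExp α)
        + W1 α a x * a (Fin.last N) x ^ (2 - degExp α) ≤
        2 * (K α a x ‖q x‖ * ‖q x‖ ^ 2 + K α a x ‖r x‖ * ‖r x‖ ^ 2 + a (Fin.last N) x) := by
      linarith
    have s1 : 0 ≤ σ ^ (-degExp α) := by positivity
    have s2 : 0 ≤ σ ^ (2 - degExp α) := by positivity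
    have s3 : (0 : ℝ) ≤ 2 ^ (2 / degExp α + 1) := by positivity
    have k11 := mul_le_mul_of_nonneg_left k9 s1
    have k12 := mul_le_mul_of_nonneg_left (mul_le_mul_of_nonneg_left k10 s3) s2
    simp only [Pi.add_apply]
    linarith)
  rw [integral_add' i1 i2, integral_const_mul, integral_const_mul, integral_add' j1 d1,
    integral_add' ((hq.integrable hS).add (hr.integrable hS)) b1,
    integral_add' (hq.integrable hS) (hr.integrable hS), ← en_eq hS hq.meas,
    ← en_eq hS hr.meas] at h2
  refine h2.trans (mul_le_mul_of_nonneg_left (add_le_add ?_ ?_) (by positivity))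
  · rw [mul_assoc]
    gcongr
  · rw [mul_assoc, mul_assoc]
    gcongr
    linarith

/-- The bounds contained in a bound for `D(t)`. -/
theorem bounds_of_D_le {Φ : ℝ → Space n → ℝ} {t d : ℝ} (hd : 0 < d)
    (h : D U φ a Φ t ≤ ENNReal.ofReal d) :
    darcySq U a (weakGrad U (Φ t)) ≤ ENNReal.ofReal d ∧
      darcySq U a (weakGrad U (Φ t)) ≤ ENNReal.ofReal (d ^ 2) ∧
      normSq U φ (timeDeriv U φ Φ t) ≤ ENNReal.ofReal (d ^ 2) := by
  -- The square roots in D yield bounds by d², needed against θ⁻¹ in the evolution inequality; the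
  -- linear term yields the bound by d used in coercivity.
  have key : ∀ x : ℝ≥0∞, x ^ (1 / 2 : ℝ) ≤ ENNReal.ofReal d → x ≤ ENNReal.ofReal (d ^ 2) := by
    intro x hx
    have h2 := ENNReal.rpow_le_rpow hx (by norm_num : (0 : ℝ) ≤ 2)
    rwa [← ENNReal.rpow_mul, one_div_mul_cancel (by norm_num), ENNReal.rpow_one,
      ENNReal.ofReal_rpow_of_pos hd, Real.rpow_two] at h2
  unfold D at h
  exact ⟨le_trans (le_add_right le_self_add) h,
    key _ (le_trans (le_add_right le_add_self) h), key _ (le_add_self.trans h)⟩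

theorem darcySq_congr {q r : Space n → Space n} (h : q =ᵐ[volume.restrict U] r) :
    darcySq U a q = darcySq U a r := by
  refine lintegral_congr_ae ?_
  filter_upwards [h] with x hx
  rw [hx]

theorem normSq_congr {u v : Space n → ℝ} (h : u =ᵐ[volume.restrict U] v) :
    normSq U φ u = normSq U φ v := by
  refine lintegral_congr_ae ?_
  filter_upwards [h] with x hx
  rw [hx]

theorem timeDeriv_sub (hS : Setting U φ α a) {u v : ℝ → Space n → ℝ} (hu : IsRegular U φ α a u)
    (hv : IsRegular U φ α a v) {t : ℝ} (ht : 0 < t) :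
    timeDeriv U φ (u - v) t =ᵐ[volume.restrict U] timeDeriv U φ u t - timeDeriv U φ v t := by
  have h := HasTimeDeriv.sub hS ht (fun _ hs => hu.aestronglyMeasurable hs)
    (fun _ hs => hv.aestronglyMeasurable hs) (hu.hasTimeDeriv ht) (hv.hasTimeDeriv ht)
  exact (hasTimeDeriv_timeDeriv ⟨_, h⟩).ae_eq hS ht
    (fun _ hs => (hu.aestronglyMeasurable hs).sub (hv.aestronglyMeasurable hs)) h

/-- The derivative of `‖P̄‖²`. -/
theorem IsSolution.two_mul_wip_difference_le (hS : Setting U φ α a)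
    {Ψ₁ Ψ₂ p₁ p₂ : ℝ → Space n → ℝ} {p₁₀ p₂₀ : Space n → ℝ} (hΨ₁ : IsRegular U φ α a Ψ₁)
    (hΨ₂ : IsRegular U φ α a Ψ₂) (hp₁ : IsSolution U φ α a Ψ₁ p₁₀ p₁)
    (hp₂ : IsSolution U φ α a Ψ₂ p₂₀ p₂) {t : ℝ} (ht : 0 < t) {d E θ : ℝ} (hd : 0 < d)
    (hθ : 0 < θ) (hD : D U φ a (Ψ₁ - Ψ₂) t ≤ ENNReal.ofReal d)
    (hE₁ : en U α a (weakGrad U (p₁ t)) ≤ E) (hE₂ : en U α a (weakGrad U (p₂ t)) ≤ E)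
    (hy₁ : wip U φ ((p₁ - Ψ₁) t) ((p₁ - Ψ₁) t) ≤ E)
    (hy₂ : wip U φ ((p₂ - Ψ₂) t) ((p₂ - Ψ₂) t) ≤ E) :
    2 * wip U φ ((p₁ - Ψ₁ - (p₂ - Ψ₂)) t) ((timeDeriv U φ p₁ t - timeDeriv U φ Ψ₁ t)
        - (timeDeriv U φ p₂ t - timeDeriv U φ Ψ₂ t))
      ≤ -(2 * ((1 - degExp α) * ∫ x in U, K α a x (max ‖weakGrad U (p₁ t) x‖
          ‖weakGrad U (p₂ t) x‖) * ‖weakGrad U (p₁ t) x - weakGrad U (p₂ t) x‖ ^ 2))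
        + 10 * (θ * E) + 4 * (θ⁻¹ * d ^ 2) := by
  obtain ⟨-, f2, f3⟩ := bounds_of_D_le hd hD
  have hq₁ := hp₁.regular.enCurve.fin t ht
  have hq₂ := hp₂.regular.enCurve.fin t ht
  have hψ₁ := hΨ₁.enCurve.fin t ht
  have hψ₂ := hΨ₂.enCurve.fin t ht
  have m₁ : MemL2 U φ ((p₁ - Ψ₁) t) := hp₁.memL2 t ht.le
  have m₂ : MemL2 U φ ((p₂ - Ψ₂) t) := hp₂.memL2 t ht.le
  have mP : MemL2 U φ ((p₁ - Ψ₁ - (p₂ - Ψ₂)) t) := m₁.sub hS m₂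
  have dp₁ := (hp₁.regular.hasTimeDeriv ht).1
  have dp₂ := (hp₂.regular.hasTimeDeriv ht).1
  have dΨ₁ := (hΨ₁.hasTimeDeriv ht).1
  have dΨ₂ := (hΨ₂.hasTimeDeriv ht).1
  have hΦ := dΨ₁.sub hS dΨ₂
  rw [Pi.sub_apply,
    darcySq_congr (weakGrad_sub hS.isOpen (hΨ₁.grad t ht) (hΨ₂.grad t ht))] at f2
  rw [normSq_congr (timeDeriv_sub hS hΨ₁ hΨ₂ ht), normSq_eq hS hΦ,
    ENNReal.ofReal_le_ofReal_iff (by positivity)] at f3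
  have hf := (hψ₁.sub_and_le hS hψ₂).1
  have hr := (hq₁.sub_and_le hS hq₂).1
  -- Both equations are tested with the same P̄. Its gradient splits into ∇p₁ - ∇p₂, which gives
  -- monotonicity after subtraction, and the data term ∇Ψ₁ - ∇Ψ₂.
  have test : ∀ {Ψ p : ℝ → Space n → ℝ} {p₀ : Space n → ℝ}, IsSolution U φ α a Ψ p₀ p →
      wip U φ ((p₁ - Ψ₁ - (p₂ - Ψ₂)) t) (timeDeriv U φ p t) =
        -(pair U α a (weakGrad U (p t)) (weakGrad U (p₁ t) - weakGrad U (p₂ t))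
          - pair U α a (weakGrad U (p t)) (weakGrad U (Ψ₁ t) - weakGrad U (Ψ₂ t))) := by
    intro Ψ p p₀ hp
    have hq := hp.regular.enCurve.fin t ht
    have t1 := hp.test_solution hS hΨ₁ hp₁ ht ht
    have t2 := hp.test_solution hS hΨ₂ hp₂ ht ht
    rw [pair_sub hS hq hq₁ hψ₁] at t1
    rw [pair_sub hS hq hq₂ hψ₂] at t2
    rw [wip_comm, pair_sub hS hq hq₁ hq₂, pair_sub hS hq hψ₁ hψ₂]
    have e := wip_sub hS (hp.regular.hasTimeDeriv ht).1 m₁ m₂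
    change wip U φ (timeDeriv U φ p t) ((p₁ - Ψ₁ - (p₂ - Ψ₂)) t)
      = wip U φ _ (p₁ t - Ψ₁ t) - wip U φ _ (p₂ t - Ψ₂ t) at e
    rw [e, t1, t2]
    ring
  have e1 : (timeDeriv U φ p₁ t - timeDeriv U φ Ψ₁ t) - (timeDeriv U φ p₂ t - timeDeriv U φ Ψ₂ t)
      = (timeDeriv U φ p₁ t - timeDeriv U φ p₂ t)
        - (timeDeriv U φ Ψ₁ t - timeDeriv U φ Ψ₂ t) := by abel
  rw [e1, wip_sub hS mP (dp₁.sub hS dp₂) hΦ, wip_sub hS mP dp₁ dp₂, test hp₁, test hp₂]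
  have h1 := (integrable_maxDensity hS hq₁ hq₂).2
  have h2 := two_mul_abs_pair_le hS (sq_nonneg d) hθ hq₁ hf.meas f2
  have h3 := two_mul_abs_pair_le hS (sq_nonneg d) hθ hq₂ hf.meas f2
  have h4 := (abs_le.1 (abs_wip_le hS mP hΦ hθ)).1
  have h5 := wip_sub_self_le hS m₁ m₂
  change wip U φ ((p₁ - Ψ₁ - (p₂ - Ψ₂)) t) ((p₁ - Ψ₁ - (p₂ - Ψ₂)) t) ≤ _ at h5
  -- The bound ‖P̄‖² ≤ 4E makes the Φ_t term cost 8θE; with θE from each flux term the total is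
  -- 10θE.
  have h6 : θ * wip U φ ((p₁ - Ψ₁ - (p₂ - Ψ₂)) t) ((p₁ - Ψ₁ - (p₂ - Ψ₂)) t) ≤ θ * (4 * E) := by
    gcongr
    linarith
  have h7 := mul_le_mul_of_nonneg_left hE₁ hθ.le
  have h8 := mul_le_mul_of_nonneg_left hE₂ hθ.le
  have h9 := mul_le_mul_of_nonneg_left f3 (inv_nonneg.2 hθ.le)
  have h10 := le_abs_self (pair U α a (weakGrad U (p₁ t)) (weakGrad U (Ψ₁ t) - weakGrad U (Ψ₂ t)))
  have h11 := neg_abs_le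
    (pair U α a (weakGrad U (p₂ t)) (weakGrad U (Ψ₁ t) - weakGrad U (Ψ₂ t)))
  linarith

/-- The two sources of κ₀: a/(2-a) from coercivity, and 1/2 from the choice of θ in the evolution
inequality. -/
theorem kappa_eq (hα : IsExponents α) {X : ℝ} (hX : 0 < X) :
    X ^ kappa α = X ^ (degExp α / (2 - degExp α)) * √X := by
  have h1 := degExp_lt_one hα
  rw [Real.sqrt_eq_rpow, ← Real.rpow_add hX, kappa]
  congr 1
  have : 2 - degExp α ≠ 0 := by linarith
  field_simp
  ring

/-- Eventual bounds for `‖P̄‖²`. -/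
theorem exists_difference_bound {N : ℕ} {α : Fin (N + 1) → ℝ} (hα : IsExponents α) {cP : ℝ}
    (hcP : 0 < cP) :
    ∃ C : ℝ, 0 < C ∧ ∀ {n : ℕ} {U : Set (Space n)} {φ : Space n → ℝ}
      {a : Fin (N + 1) → Space n → ℝ} {Ψ₁ Ψ₂ p₁ p₂ : ℝ → Space n → ℝ} {p₁₀ p₂₀ : Space n → ℝ}
      {A B d : ℝ}, Setting U φ α a → IsRegular U φ α a Ψ₁ → IsRegular U φ α a Ψ₂ →
      IsSolution U φ α a Ψ₁ p₁₀ p₁ → IsSolution U φ α a Ψ₂ p₂₀ p₂ →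
      (∀ t, 0 < t → PoincareSobolev U φ α a cP (p₁ t - Ψ₁ t)) →
      (∀ t, 0 < t → PoincareSobolev U φ α a cP (p₂ t - Ψ₂ t)) →
      (∀ t, 0 < t → PoincareSobolev U φ α a cP ((p₁ t - Ψ₁ t) - (p₂ t - Ψ₂ t))) →
      1 ≤ A → 0 ≤ B → 0 < d →
      (∀ᶠ t in atTop, G U φ α a Ψ₁ t ≤ ENNReal.ofReal A) →
      (∀ᶠ t in atTop, G U φ α a Ψ₂ t ≤ ENNReal.ofReal A) →
      (∀ᶠ t in atTop, G1 U φ a Ψ₁ t ≤ ENNReal.ofReal B) →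
      (∀ᶠ t in atTop, G1 U φ a Ψ₂ t ≤ ENNReal.ofReal B) →
      (∀ᶠ t in atTop, D U φ a (Ψ₁ - Ψ₂) t ≤ ENNReal.ofReal d) →
      ∀ᶠ t in atTop, normSq U φ ((p₁ t - Ψ₁ t) - (p₂ t - Ψ₂ t)) ≤
        ENNReal.ofReal (C * (A ^ (2 / (2 - degExp α)) + B) ^ kappa α * d) := by
  have hd0 := degExp_pos hα
  have hd1 := degExp_lt_one hα
  obtain ⟨C₁, hC₁, hbound⟩ := exists_energy_bound hα hcP
  set γ := 2 - degExp α with hγ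
  set P := 2 * cP ^ γ with hP
  have hP0 : 0 < P := by positivity
  set M := P * (2 ^ (2 / degExp α + 1) * (4 * C₁ + 2)) with hM
  have hM0 : 0 < M := by positivity
  set C₂ := P * M ^ (degExp α / γ) * 2 with hC₂
  have hC₂0 : 0 < C₂ := by positivity
  have h1a : 0 < 1 - degExp α := by linarith
  -- The 1 removes the d in J + d. Of 10 C₁ + 5, the part 10 C₁ + 4 cancels the forcing and the last
  -- unit leaves slope at most -d.
  set C₃ := 1 + (10 * C₁ + 5) / (2 * (1 - degExp α)) with hC₃
  have hC₃0 : 0 < C₃ := by positivity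
  refine ⟨C₂ * C₃, by positivity, ?_⟩
  intro n U φ a Ψ₁ Ψ₂ p₁ p₂ p₁₀ p₂₀ A B d hS hΨ₁ hΨ₂ hp₁ hp₂ hP₁ hP₂ hP₁₂ hA hB hd hG₁ hG₂ hH₁
    hH₂ hD
  have hγ1 : 1 ≤ 2 / γ := by
    rw [le_div_iff₀ (by linarith)]
    linarith
  set X := A ^ (2 / γ) + B with hX
  have hAX : A ≤ X := by
    have := Real.rpow_le_rpow_of_exponent_le hA hγ1
    rw [Real.rpow_one] at this
    linarith
  have hX1 : 1 ≤ X := hA.trans hAX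
  have hX0 : 0 < X := by linarith
  have hsX : 1 ≤ √X := Real.one_le_sqrt.2 hX1
  have hsX0 : 0 < √X := by linarith
  have hL := (hp₁.l2Curve hS hΨ₁).sub hS (hp₂.l2Curve hS hΨ₂)
  set Q : ℝ → ℝ := fun t => wip U φ ((p₁ - Ψ₁ - (p₂ - Ψ₂)) t) ((p₁ - Ψ₁ - (p₂ - Ψ₂)) t) with hQ
  obtain ⟨T, hT⟩ := eventually_atTop.1 (((hbound hS hΨ₁ hp₁ hP₁ hA hB hG₁ hH₁).and
    (hbound hS hΨ₂ hp₂ hP₂ hA hB hG₂ hH₂)).and (hG₁.and hD))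
  have hfinal : ∀ᶠ t in atTop, Q t ≤ C₂ * C₃ * X ^ kappa α * d := by
    refine eventually_le_of_leftSlope (δ := d) (T := max 0 T) hd
      (fun t ht => hL.continuousAt hS ((le_max_left _ _).trans_lt ht))
      (fun t _ => wip_self_nonneg hS _) fun t ht hYt => ?_
    have ht0 : 0 < t := (le_max_left _ _).trans_lt ht
    obtain ⟨⟨⟨hE₁, hy₁⟩, hE₂, hy₂⟩, hGt, hDt⟩ := hT t ((le_max_right _ _).trans ht.le)
    refine (hL.leftSlope hS ht0).mono ?_
    have hq₁ := hp₁.regular.enCurve.fin t ht0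
    have hq₂ := hp₂.regular.enCurve.fin t ht0
    have hf := ((hΨ₁.enCurve.fin t ht0).sub_and_le hS (hΨ₂.enCurve.fin t ht0)).1
    have f1 := (bounds_of_D_le hd hDt).1
    rw [Pi.sub_apply,
      darcySq_congr (weakGrad_sub hS.isOpen (hΨ₁.grad t ht0) (hΨ₂.grad t ht0))] at f1
    have hgrad : weakGrad U (p₁ t - Ψ₁ t - (p₂ t - Ψ₂ t)) =ᵐ[volume.restrict U]
        weakGrad U (p₁ t) - weakGrad U (p₂ t) - (weakGrad U (Ψ₁ t) - weakGrad U (Ψ₂ t)) := by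
      have g1 := (hasWeakGrad_weakGrad (hp₁.regular.grad t ht0)).sub
        (hasWeakGrad_weakGrad (hΨ₁.grad t ht0))
      have g2 := (hasWeakGrad_weakGrad (hp₂.regular.grad t ht0)).sub
        (hasWeakGrad_weakGrad (hΨ₂.grad t ht0))
      rw [sub_sub_sub_comm (weakGrad U (p₁ t))]
      exact (hasWeakGrad_weakGrad ⟨_, g1.sub g2⟩).ae_eq hS.isOpen (g1.sub g2)
    have h1 := wip_difference_le hS hcP (by linarith : 0 < A) (by positivity : 0 ≤ C₁ * X) hd.le
      (hP₁₂ t ht0) (hL.mem t ht0) hq₁ hq₂ hf.meas hgrad (bounds_of_G_le hGt).1 hE₁ hE₂ f1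
    -- Taking θ = d/√X makes θX and θ⁻¹d² both equal to √X d.
    have h2 := hp₁.two_mul_wip_difference_le hS hΨ₁ hΨ₂ hp₂ ht0 hd (div_pos hd hsX0) hDt hE₁ hE₂
      hy₁ hy₂
    set J := ∫ x in U, K α a x (max ‖weakGrad U (p₁ t) x‖ ‖weakGrad U (p₂ t) x‖) *
      ‖weakGrad U (p₁ t) x - weakGrad U (p₂ t) x‖ ^ 2 with hJ
    have e1 : d / √X * (C₁ * X) = C₁ * (√X * d) := by
      rw [div_mul_eq_mul_div, div_eq_iff hsX0.ne']
      linear_combination (-C₁ * d) * Real.mul_self_sqrt hX0.le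
    have e2 : (d / √X)⁻¹ * d ^ 2 = √X * d := by
      field_simp
    rw [e1, e2] at h2
    have hJ0 : 0 ≤ J := by
      refine integral_nonneg_of_ae ?_
      filter_upwards [hS.ae_mem] with x hx
      have := K_pos hS.exps hS.coeff hx
        ((norm_nonneg (weakGrad U (p₁ t) x)).trans (le_max_left _ ‖weakGrad U (p₂ t) x‖))
      positivity
    have h3 : Q t ≤ C₂ * X ^ (degExp α / γ) * (J + d) := by
      refine h1.trans ?_
      have e3 : 2 * cP ^ γ * (2 ^ (2 / degExp α + 1) * (4 * (C₁ * X) + 2 * A)) ≤ M * X := by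
        rw [hM, hP, mul_assoc _ _ X, mul_assoc _ _ X]
        gcongr
        linarith
      have e4 := Real.rpow_le_rpow (by positivity) e3
        (div_nonneg hd0.le (by linarith) : 0 ≤ degExp α / γ)
      rw [Real.mul_rpow hM0.le hX0.le] at e4
      calc 2 * cP ^ γ * (2 * cP ^ γ * (2 ^ (2 / degExp α + 1) * (4 * (C₁ * X) + 2 * A)))
            ^ (degExp α / γ) * (2 * (J + d))
          ≤ 2 * cP ^ γ * (M ^ (degExp α / γ) * X ^ (degExp α / γ)) * (2 * (J + d)) := by
            gcongr
        _ = _ := by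
          rw [hC₂, hP]
          ring
    -- Exceeding the threshold forces J + d > C₃ √X d, a lower bound for the dissipation.
    have h4 : C₂ * X ^ (degExp α / γ) * (C₃ * (√X * d)) < C₂ * X ^ (degExp α / γ) * (J + d) := by
      refine lt_of_eq_of_lt ?_ (lt_of_lt_of_le hYt h3)
      rw [kappa_eq hα hX0]
      ring
    have h5 := lt_of_mul_lt_mul_left h4 (by positivity)
    have h6 : d ≤ √X * d := le_mul_of_one_le_left hd.le hsX
    have h7 : (10 * C₁ + 5) * (√X * d) ≤ 2 * ((1 - degExp α) * J) := by
      have h8 : (10 * C₁ + 5) / (2 * (1 - degExp α)) * (√X * d) ≤ J := by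
        rw [hC₃, add_mul, one_mul] at h5
        linarith
      rw [div_mul_eq_mul_div, div_le_iff₀ (by positivity)] at h8
      linarith
    refine h2.trans ?_
    linarith
  filter_upwards [hfinal, eventually_gt_atTop 0] with t ht ht0
  have hm := hL.mem t ht0
  have := normSq_eq hS hm
  change normSq U φ (p₁ t - Ψ₁ t - (p₂ t - Ψ₂ t)) = _ at this
  rw [this]
  exact ENNReal.ofReal_le_ofReal ht

end Difference

/-! ### Passage to upper limits and the theorem. -/

/-- B_* ≥ 1 enters here. It ensures A ≥ 1 and makes each of the two upper limits strictly smaller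
than their sum. -/
theorem one_le_limsup_G {n N : ℕ} (U : Set (Space n)) (φ : Space n → ℝ) (α : Fin (N + 1) → ℝ)
    (a : Fin (N + 1) → Space n → ℝ) (Ψ : ℝ → Space n → ℝ) :
    1 ≤ limsup (G U φ α a Ψ) atTop := by
  refine le_limsup_of_frequently_le (Eventually.frequently (.of_forall fun t => ?_))
  exact (le_max_right _ _).trans (bounds_of_G_le le_rfl).1

end Forchheimer

theorem mainTheorem7 {n N : ℕ} (hn : 2 ≤ n)
    (U : Set (Forchheimer.Space n)) (hUo : IsOpen U) (hUb : Bornology.IsBounded U)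
    (α : Fin (N + 1) → ℝ) (hα : Forchheimer.IsExponents α) (cP : ℝ) (hcP : 0 < cP) :
    ∃ C : ℝ, 0 < C ∧
      ∀ (φ : Forchheimer.Space n → ℝ) (a : Fin (N + 1) → Forchheimer.Space n → ℝ)
        (Ψ₁ Ψ₂ p₁ p₂ : ℝ → Forchheimer.Space n → ℝ) (p₁₀ p₂₀ : Forchheimer.Space n → ℝ),
        Forchheimer.IsPorosity U φ → Forchheimer.IsCoeff U a →
        Forchheimer.IsRegular U φ α a Ψ₁ → Forchheimer.IsRegular U φ α a Ψ₂ →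
        Forchheimer.IsSolution U φ α a Ψ₁ p₁₀ p₁ →
        Forchheimer.IsSolution U φ α a Ψ₂ p₂₀ p₂ →
        (∀ t, 0 < t → Forchheimer.PoincareSobolev U φ α a cP (p₁ t - Ψ₁ t)) →
        (∀ t, 0 < t → Forchheimer.PoincareSobolev U φ α a cP (p₂ t - Ψ₂ t)) →
        (∀ t, 0 < t →
          Forchheimer.PoincareSobolev U φ α a cP ((p₁ t - Ψ₁ t) - (p₂ t - Ψ₂ t))) →
        Forchheimer.calA U φ α a Ψ₁ Ψ₂ < ⊤ → Forchheimer.calG1 U φ a Ψ₁ Ψ₂ < ⊤ →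
        limsup (fun t => Forchheimer.normSq U φ ((p₁ t - Ψ₁ t) - (p₂ t - Ψ₂ t))) atTop ≤
          ENNReal.ofReal C *
            (Forchheimer.calA U φ α a Ψ₁ Ψ₂ ^ (2 / (2 - Forchheimer.degExp α))
              + Forchheimer.calG1 U φ a Ψ₁ Ψ₂) ^ Forchheimer.kappa α *
            Forchheimer.calD U φ a Ψ₁ Ψ₂ := by
  have hd0 := Forchheimer.degExp_pos hα
  have hd1 := Forchheimer.degExp_lt_one hα
  obtain ⟨C₁, hC₁, hbound⟩ := Forchheimer.exists_difference_bound hα hcP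
  -- The factor 2^κ₀ pays for replacing B by B + 1, since the power of A is at least 1.
  refine ⟨C₁ * 2 ^ Forchheimer.kappa α, by positivity, ?_⟩
  intro φ a Ψ₁ Ψ₂ p₁ p₂ p₁₀ p₂₀ hφ ha hΨ₁ hΨ₂ hp₁ hp₂ hP₁ hP₂ hP₁₂ hA hG1
  have hS : Forchheimer.Setting U φ α a := ⟨hUo, hα, ha, hφ⟩
  have l1 := Forchheimer.one_le_limsup_G U φ α a Ψ₁
  have l2 := Forchheimer.one_le_limsup_G U φ α a Ψ₂
  have hκ : 0 ≤ Forchheimer.kappa α := by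
    unfold Forchheimer.kappa
    exact div_nonneg (by linarith) (by linarith)
  have hγ : 0 ≤ 2 / (2 - Forchheimer.degExp α) := div_nonneg (by norm_num) (by linarith)
  have hA1 : 1 ≤ Forchheimer.calA U φ α a Ψ₁ Ψ₂ := le_add_right l1
  obtain ⟨f1, f2⟩ := ENNReal.add_lt_top.1 hA
  have g1 : limsup (Forchheimer.G U φ α a Ψ₁) atTop < Forchheimer.calA U φ α a Ψ₁ Ψ₂ :=
    ENNReal.lt_add_right f1.ne (one_pos.trans_le l2).ne'
  have g2 : limsup (Forchheimer.G U φ α a Ψ₂) atTop < Forchheimer.calA U φ α a Ψ₁ Ψ₂ := by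
    rw [Forchheimer.calA, add_comm]
    exact ENNReal.lt_add_right f2.ne (one_pos.trans_le l1).ne'
  -- 𝓖₁ may vanish, so a unit is added to obtain a strict bound.
  have h1 : limsup (Forchheimer.G1 U φ a Ψ₁) atTop < Forchheimer.calG1 U φ a Ψ₁ Ψ₂ + 1 :=
    lt_of_le_of_lt le_self_add (ENNReal.lt_add_right hG1.ne one_ne_zero)
  have h2 : limsup (Forchheimer.G1 U φ a Ψ₂) atTop < Forchheimer.calG1 U φ a Ψ₁ Ψ₂ + 1 :=
    lt_of_le_of_lt le_add_self (ENNReal.lt_add_right hG1.ne one_ne_zero)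
  replace g1 := eventually_lt_of_limsup_lt g1
  replace g2 := eventually_lt_of_limsup_lt g2
  replace h1 := eventually_lt_of_limsup_lt h1
  replace h2 := eventually_lt_of_limsup_lt h2
  obtain ⟨A, hA0, eA⟩ : ∃ A : ℝ, 0 ≤ A ∧ Forchheimer.calA U φ α a Ψ₁ Ψ₂ = ENNReal.ofReal A :=
    ⟨_, ENNReal.toReal_nonneg, (ENNReal.ofReal_toReal hA.ne).symm⟩
  obtain ⟨B, hB0, eB⟩ : ∃ B : ℝ, 0 ≤ B ∧ Forchheimer.calG1 U φ a Ψ₁ Ψ₂ = ENNReal.ofReal B :=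
    ⟨_, ENNReal.toReal_nonneg, (ENNReal.ofReal_toReal hG1.ne).symm⟩
  rw [eA] at hA1 g1 g2 ⊢
  rw [eB] at h1 h2 ⊢
  rw [ENNReal.one_le_ofReal] at hA1
  rw [← ENNReal.ofReal_one, ← ENNReal.ofReal_add hB0 zero_le_one] at h1 h2
  have hY1 : 1 ≤ A ^ (2 / (2 - Forchheimer.degExp α)) := Real.one_le_rpow hA1 hγ
  have hY0 : 0 < A ^ (2 / (2 - Forchheimer.degExp α)) + B := by linarith
  rw [ENNReal.ofReal_rpow_of_nonneg hA0 hγ, ← ENNReal.ofReal_add (by positivity) hB0,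
    ENNReal.ofReal_rpow_of_nonneg hY0.le hκ, ← ENNReal.ofReal_mul (by positivity)]
  -- For infinite 𝓓 the right-hand side is infinite, because the prefactor is positive.
  rcases eq_or_ne (Forchheimer.calD U φ a Ψ₁ Ψ₂) ⊤ with hD | hD
  · rw [hD, ENNReal.mul_top]
    · exact le_top
    · exact (ENNReal.ofReal_pos.2 (by positivity)).ne'
  obtain ⟨d, hd0, ed⟩ : ∃ d : ℝ, 0 ≤ d ∧ Forchheimer.calD U φ a Ψ₁ Ψ₂ = ENNReal.ofReal d :=
    ⟨_, ENNReal.toReal_nonneg, (ENNReal.ofReal_toReal hD).symm⟩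
  rw [ed, ← ENNReal.ofReal_mul (by positivity)]
  set X := A ^ (2 / (2 - Forchheimer.degExp α)) + (B + 1) with hX
  -- The eventual bound needs a positive d strictly above the upper limit, which may be 0; ε is sent
  -- to 0 afterwards.
  have key : ∀ ε : ℝ, 0 < ε →
      limsup (fun t => Forchheimer.normSq U φ ((p₁ t - Ψ₁ t) - (p₂ t - Ψ₂ t))) atTop ≤
        ENNReal.ofReal (C₁ * X ^ Forchheimer.kappa α * (d + ε)) := by
    intro ε hε
    have hDε : Forchheimer.calD U φ a Ψ₁ Ψ₂ < ENNReal.ofReal (d + ε) := by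
      rw [ed, ENNReal.ofReal_lt_ofReal_iff (by linarith)]
      linarith
    replace hDε := eventually_lt_of_limsup_lt hDε
    exact limsup_le_of_le (by isBoundedDefault) (hbound hS hΨ₁ hΨ₂ hp₁ hp₂ hP₁ hP₂ hP₁₂ hA1
      (by linarith : 0 ≤ B + 1) (by linarith : 0 < d + ε) (g1.mono fun _ h => h.le)
      (g2.mono fun _ h => h.le) (h1.mono fun _ h => h.le) (h2.mono fun _ h => h.le)
      (hDε.mono fun _ h => h.le))
  have hlim : Tendsto (fun ε : ℝ => ENNReal.ofReal (C₁ * X ^ Forchheimer.kappa α * (d + ε)))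
      (𝓝[>] 0) (𝓝 (ENNReal.ofReal (C₁ * X ^ Forchheimer.kappa α * (d + 0)))) := by
    have hc : Continuous fun ε : ℝ =>
        ENNReal.ofReal (C₁ * X ^ Forchheimer.kappa α * (d + ε)) :=
      ENNReal.continuous_ofReal.comp (by fun_prop)
    exact (hc.tendsto 0).mono_left nhdsWithin_le_nhds
  have hle := ge_of_tendsto hlim (eventually_nhdsWithin_of_forall fun ε hε => key ε hε)
  refine hle.trans (ENNReal.ofReal_le_ofReal ?_)
  rw [add_zero, mul_assoc C₁ (2 ^ _), ← Real.mul_rpow (by norm_num) hY0.le]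
  have hX0 : 0 ≤ X := by linarith
  gcongr
  linarith
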